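/- An *arithmetic term* is an expression built from variables and natural-number constants with $+$, bounded subtraction $a\mathbin{\dot-}b=\max(a-b,0)$, multiplication, integer division $\lfloor a/b\rfloor$ and exponentiation $a^b$ on $\mathbb N=\{0,1,2,\dots\}$. As usual $a\bmod b$ abbreviates $a\mathbin{\dot-}b\lfloor a/b\rfloor$; below, $-$ inside a term is $\dot-$. Consider the following arithmetic terms. **Basic terms.** $$\binom ab=\left\lfloor\frac{2^{2(a+2)((a+1)^2+b+1)}}{2^{2(a+2)^2}-2^{2(a+2)}-1}\right\rfloor\bmod 2^{2(a+2)},\qquad \gcd(a,b)=\left\lfloor\frac{(2^{a^2b(b+1)}-2^{a^2b})(2^{a^2b^2}-1)}{(2^{a^2b}-1)(2^{ab^2}-1)2^{a^2b^2}}\right\rfloor\bmod 2^{ab},$$ $$\nu_2(a)=\left\lfloor\frac{\gcd(a,2^a)^{a+1}\bmod(2^{a+1}-1)^2}{2^{a+1}-1}\right\rfloor,\qquad \operatorname{HW}(a)=\nu_2\!\left(\binom{2a}{a}\right),\qquad a!=\left\lfloor 2^{3a^3}\Big/\binom{2^{3a^2}}{a}\right\rfloor .$$ For each constant $r$ let $G_r(q,t)$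 be the term for $\sum_{j<t}j^rq^j$ ($q>1$) given recursively by $G_r=\bigl(t^rq^t-0^r-q\sum_{i<r}\binom ri G_i\bigr)/(q-1)$. **Hypercube terms.** Let $P(n,\vec x)$ be an exponential polynomial in $x_1,\dots,x_k$, written as a sum of pairwise unlike monomials $c\,v_1^{x_1}\cdots v_k^{x_k}x_1^{r_1}\cdots x_k^{r_k}$, where the $v_i$ are constant powers of $2$ and $c=c(n)$, and with free term $c_0(n)$ (the sum of the monomials without unknowns). For terms $n,t,u$ put $$W_P(n,t,u)=\frac{(2^u-c_0+1)(2^{2ut^k}-1)}{2^u+1}-\sum(2^u-1)\,c\prod_{i=1}^kG_{r_i}(2^{2ut^{i-1}}v_i,t),$$ the sum being over the non-free monomials (summands with a positive sign are added first, and those with a negative sign are then subtracted), and $$Z_P(n,t,u)=\left\lfloor\operatorname{HW}(W_P(n,t,u))/u\right\rfloor-t^k .$$ **The term $\pi$.** Let $M(n)=W_{P_0}(n,n+1,n+5)$ for $P_0=(x_1^2-nx_2-1)^2$ with $k=2$, expanded, and $$\pi(x)=\nu_2\!\left(\left\lfloor\frac{\operatorname{HW}(M(4\,x!))}{4\,x!+5}\right\rfloor-(4\,x!+1)^2\right)-1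 .$$ **The term $p$.** The following are exponential polynomials with auxiliary unknowns $y_i$, different for different occurrences: - $E_/(x,y,z)=(x-yz-y_1)^2+(y_1+y_2+1-y)^2$ and $E_{\bmod}(x,y,z)=(x-yy_1-z)^2+(z+y_2+1-y)^2$; - $E_\nu(x,z)=(x-2^{z+1}y_1-y_2-1)^2+(y_2+y_3+2-2^{z+1})^2+(x-2^zy_4)^2$; - $E_{\rm bin}(x,y,z)=\bigl(y_1-(2x^3+8x^2+2xy+12x+4y+8)\bigr)^2+\bigl(y_2-(2x^2+8x+8)\bigr)^2+E_/(2^{y_1},2^{y_2}-2^{2x+4}-1,y_3)+E_{\bmod}(y_3,2^{2x+4},z)$; - $E_!(x,z)=(y_1-x^2)^2+(y_2-2^{3y_1})^2+(y_3-xy_1)^2+E_{\rm bin}(y_2,x,y_4)+E_/(2^{3y_3},y_4,z)$; - $E_{\operatorname{HW}}(x,z)=E_{\rm bin}(2x,x,y_1)+E_\nu(y_1,z)$; - $E_{M4}(f_1,f_2,f_3,f_4,m)$, with auxiliary unknowns $q_{1,1},q_{2,1},g_{0,1},g_{2,1},g_{4,1},g_{0,2},g_{1,2},g_{2,2},C$.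 Abbreviate $\upsilon=4f_1+5$, $\tau=4f_1+1$, $\tau_1=4f_1$, $h=1-2^{\upsilon}$, $q_1=2^{2\upsilon}$, $q_2=2^{2\tau\upsilon}$, where in exponents $f_1^2,f_1^3$ are replaced by $f_2,f_3$. $E_{M4}$ is the sum of the squares of $q_{1,1}-q_1+1$; $q_{2,1}-q_2+1$; $g_{0,i}q_{i,1}-(q_i^{\tau}-1)$ for $i=1,2$; $g_{1,2}q_{2,1}^2-q_2(\tau_1q_2^{\tau}-f_4q_2^{\tau_1}+1)$; $g_{2,i}q_{i,1}^3-q_i\bigl(\tau_1^2q_i^{\tau_1+2}-(2\tau_1^2+2\tau_1-1)q_i^{\tau}+f_4^2q_i^{\tau_1}-q_i-1\bigr)$ for $i=1,2$; $$\begin{aligned}g_{4,1}q_{1,1}^5-q_1\bigl(&\tau_1^4q_1^{\tau_1+4}+(-4\tau_1^4-4\tau_1^3+6\tau_1^2-4\tau_1+1)q_1^{\tau_1+3}+(6\tau_1^4+12\tau_1^3-6\tau_1^2-12\tau_1+11)q_1^{\tau_1+2}\\&+(-4\tau_1^4-12\tau_1^3-6\tau_1^2+12\tau_1+11)q_1^{\tau}+f_4^4q_1^{\tau_1}-q_1^3-11q_1^2-11q_1-1\bigr);\end{aligned}$$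 $C(2^{\upsilon}+1)-2^{\upsilon}(q_2^{\tau}-1)$; and $m-\bigl(C+hg_{4,1}g_{0,2}-2hg_{2,1}g_{0,2}-8f_1hg_{2,1}g_{1,2}+16f_1^2hg_{0,1}g_{2,2}+8f_1hg_{0,1}g_{1,2}\bigr)$. Let $\hat F(n,\vec x)$ be the monomial expansion, in the $42$ unknowns consisting of $a,f_1,f_2,f_3,f_4,m,b,d$ and the $13+9+12$ auxiliary ones, in this order, of $$E_!(a,f_1)+(f_2-f_1^2)^2+(f_3-f_1f_2)^2+(f_4-4f_1-1)^2+E_{M4}(f_1,f_2,f_3,f_4,m)+E_{\operatorname{HW}}(m,b)+\bigl(b+(4f_1+5)(-f_4^2+d-2^n)\bigr)^2 ,$$ and let $$p(n)=Z_{\hat F}(n,t(n),u(n)),\qquad t(n)=2^{2^{2^{2n^4+16}}},\quad u(n)=2^{2^{9t(n)+8}+9}.$$ **Theorem.** The arithmetic term $T(x)=p(\pi(x)+1)$ (the composition of the above terms, an arithmetic term in the single variable $x$) has the property that for every $x\in\mathbb N$ the number $T(x)$ is the smallest prime strictly greater than $x$. Consequently, if $x(1)=2$ and $x(n+1)=T(x(n))$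 for all $n\ge1$, then for every $n\ge1$ the number $x(n)$ is the $n$-th prime, and it is also the value of the term $p(n)$. -/

import Mathlib

/-- Arithmetic terms in `k` variables: the expressions built from variables and numerals with
addition, bounded subtraction, multiplication, integer division and exponentiation. -/
inductive ArithTerm (k : ℕ) : Type where
  | var (i : Fin k) : ArithTerm k
  | num (c : ℕ) : ArithTerm k
  | add (a b : ArithTerm k) : ArithTerm k
  | monus (a b : ArithTerm k) : ArithTerm k
  | mul (a b : ArithTerm k) : ArithTerm k
  | div (a b : ArithTerm k) : ArithTerm k
  | pow (a b : ArithTerm k) : ArithTerm k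

namespace ArithTerm

/-- The function `ℕ ^ k → ℕ` expressed by an arithmetic term. -/
def eval {k : ℕ} (e : Fin k → ℕ) : ArithTerm k → ℕ
  | var i => e i
  | num c => c
  | add a b => a.eval e + b.eval e
  | monus a b => a.eval e - b.eval e
  | mul a b => a.eval e * b.eval e
  | div a b => a.eval e / b.eval e
  | pow a b => a.eval e ^ b.eval e

instance {k : ℕ} (c : ℕ) : OfNat (ArithTerm k) c := ⟨num c⟩
instance {k : ℕ} : Add (ArithTerm k) := ⟨add⟩
instance {k : ℕ} : Sub (ArithTerm k) := ⟨monus⟩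
instance {k : ℕ} : Mul (ArithTerm k) := ⟨mul⟩
instance {k : ℕ} : Div (ArithTerm k) := ⟨div⟩
instance {k : ℕ} : Pow (ArithTerm k) (ArithTerm k) := ⟨pow⟩

/-- The remainder is an abbreviation: `a mod b = a - b * ⌊a / b⌋`. -/
instance {k : ℕ} : Mod (ArithTerm k) := ⟨fun a b => a - b * (a / b)⟩

/-- The sum of a fixed finite list of terms. -/
def sum {k : ℕ} (l : List (ArithTerm k)) : ArithTerm k := l.foldr (· + ·) 0

/-- The product of a fixed finite list of terms. -/
def prod {k : ℕ} (l : List (ArithTerm k)) : ArithTerm k := l.foldr (· * ·) 1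

/-! ### Number-theoretic terms -/

/-- The term for the binomial coefficient `a.choose b`. -/
def binom {k : ℕ} (a b : ArithTerm k) : ArithTerm k :=
  2 ^ (2 * (a + 2) * ((a + 1) * (a + 1) + b + 1)) /
      (2 ^ (2 * ((a + 2) * (a + 2))) - 2 ^ (2 * (a + 2)) - 1) %
    2 ^ (2 * (a + 2))

/-- The term for the greatest common divisor. -/
def gcd {k : ℕ} (a b : ArithTerm k) : ArithTerm k :=
  (2 ^ (a * a * b * (b + 1)) - 2 ^ (a * a * b)) * (2 ^ (a * a * b * b) - 1) /
      ((2 ^ (a * a * b) - 1) * (2 ^ (a * b * b) - 1) * 2 ^ (a * a * b * b)) %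
    2 ^ (a * b)

/-- The term for the exponent of `2` in `a`. -/
def nu2 {k : ℕ} (a : ArithTerm k) : ArithTerm k :=
  gcd a (2 ^ a) ^ (a + 1) % ((2 ^ (a + 1) - 1) * (2 ^ (a + 1) - 1)) / (2 ^ (a + 1) - 1)

/-- The term for the Hamming weight (number of binary digits `1`) of `a`. -/
def hw {k : ℕ} (a : ArithTerm k) : ArithTerm k := nu2 (binom (2 * a) a)

/-- The term for the factorial: `a! = ⌊8 ^ (a ^ 3) / binom (8 ^ (a ^ 2), a)⌋`. -/
def fact {k : ℕ} (a : ArithTerm k) : ArithTerm k :=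
  2 ^ (3 * (a * a * a)) / binom (2 ^ (3 * (a * a))) a

/-- The term, for each constant `r`, for the generalized geometric progression
`G_r(q, t) = ∑_{j < t} j ^ r * q ^ j` (where `q > 1`), in closed form through
`(q - 1) G_r(q, t) = t ^ r q ^ t - 0 ^ r - q ∑_{i < r} (r choose i) G_i(q, t)`. -/
def geom {k : ℕ} (r : ℕ) (q t : ArithTerm k) : ArithTerm k :=
  (t ^ (num r : ArithTerm k) * q ^ t - num (0 ^ r) -
      q * sum (List.ofFn fun i : Fin r => num (r.choose i) * geom i q t)) / (q - 1)
termination_by r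
decreasing_by exact i.2

end ArithTerm

/-! ### Exponential polynomials that are simple in the unknowns -/

/-- A simple exponential monomial in the unknowns `x_0, …, x_{m-1}`, with one parameter `n`:
`coeff * n ^ pdeg * 2 ^ (pexp * n) * ∏ i, x_i ^ (deg i) * (2 ^ (exp i)) ^ x_i`. -/
structure ExpMono (m : ℕ) where
  coeff : ℤ
  pdeg : ℕ
  pexp : ℕ
  deg : Fin m → ℕ
  exp : Fin m → ℕ

/-- The product of two monomials. -/
def ExpMono.mul {m : ℕ} (a b : ExpMono m) : ExpMono m :=
  ⟨a.coeff * b.coeff, a.pdeg + b.pdeg, a.pexp + b.pexp, a.deg + b.deg, a.exp + b.exp⟩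

/-- Like monomials: equal up to the coefficient. -/
def ExpMono.Like {m : ℕ} (a b : ExpMono m) : Prop :=
  a.pdeg = b.pdeg ∧ a.pexp = b.pexp ∧ a.deg = b.deg ∧ a.exp = b.exp

instance {m : ℕ} (a b : ExpMono m) : Decidable (a.Like b) :=
  inferInstanceAs (Decidable (_ ∧ _ ∧ _ ∧ _))

/-- A monomial is free if no unknown occurs in it. -/
def ExpMono.Free {m : ℕ} (a : ExpMono m) : Prop := a.deg = 0 ∧ a.exp = 0

instance {m : ℕ} (a : ExpMono m) : Decidable a.Free := inferInstanceAs (Decidable (_ ∧ _))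

/-- Exponential polynomials, as finite sums (lists) of simple exponential monomials. -/
def ExpPoly (m : ℕ) : Type := List (ExpMono m)

namespace ExpPoly

def const {m : ℕ} (c : ℤ) : ExpPoly m := [⟨c, 0, 0, 0, 0⟩]

instance {m : ℕ} (c : ℕ) : OfNat (ExpPoly m) c := ⟨const c⟩
instance {m : ℕ} : Add (ExpPoly m) := ⟨fun P Q => List.append P Q⟩
instance {m : ℕ} : Mul (ExpPoly m) := ⟨fun P Q => List.flatMap (fun a => List.map a.mul Q) P⟩
instance {m : ℕ} : Neg (ExpPoly m) := ⟨fun P => const (-1) * P⟩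
instance {m : ℕ} : Sub (ExpPoly m) := ⟨fun P Q => P + -Q⟩

def npow {m : ℕ} (P : ExpPoly m) : ℕ → ExpPoly m
  | 0 => 1
  | j + 1 => P.npow j * P

instance {m : ℕ} : Pow (ExpPoly m) ℕ := ⟨npow⟩

/-- The parameter `n`. -/
def param {m : ℕ} : ExpPoly m := [⟨1, 1, 0, 0, 0⟩]

/-- `2 ^ n` for the parameter `n`. -/
def twoPowParam {m : ℕ} : ExpPoly m := [⟨1, 0, 1, 0, 0⟩]

/-- The unknown `x_i`. -/
def X {m : ℕ} (i : Fin m) : ExpPoly m := [⟨1, 0, 0, Pi.single i 1, 0⟩]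

/-- `2 ^ (c + ∑ a * x_i)`, where the sum is over the pairs `(a, i)` in the list `l`. -/
def twoPow {m : ℕ} (c : ℕ) (l : List (ℕ × Fin m)) : ExpPoly m :=
  [⟨2 ^ c, 0, 0, 0, (l.map fun s => Pi.single s.2 s.1).sum⟩]

/-- Add a monomial to a list of pairwise unlike monomials. -/
def insertMono {m : ℕ} (a : ExpMono m) : List (ExpMono m) → List (ExpMono m)
  | [] => [a]
  | b :: l => if a.Like b then { b with coeff := a.coeff + b.coeff } :: l
      else b :: insertMono a l

/-- The monomial expansion: like monomials are collected, zero monomials are dropped. -/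
def collect {m : ℕ} (P : ExpPoly m) : ExpPoly m :=
  (List.foldr insertMono [] P).filter fun a => a.coeff ≠ 0

end ExpPoly

/-! ### The hypercube method -/

namespace ArithTerm

/-- The absolute value of the coefficient `c(n)` of a monomial, without the unknowns. -/
def coeffAbs {k m : ℕ} (n : ArithTerm k) (a : ExpMono m) : ArithTerm k :=
  num a.coeff.natAbs * n ^ (num a.pdeg : ArithTerm k) * 2 ^ (num a.pexp * n)

/-- The absolute value of the contribution of a monomial that is not free,
`(2 ^ u - 1) * |c| * ∏_{i < m} G_{deg i} (2 ^ (2 * u * t ^ i) * 2 ^ (exp i), t)`. -/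
def contribAbs {k m : ℕ} (n t u : ArithTerm k) (a : ExpMono m) : ArithTerm k :=
  (2 ^ u - 1) * coeffAbs n a *
    prod (List.ofFn fun i : Fin m =>
      geom (a.deg i)
        (2 ^ (2 * u * t ^ (num i : ArithTerm k)) * 2 ^ (num (a.exp i) : ArithTerm k)) t)

/-- The contribution of the free term `c` of `P`,
`(2 ^ u - c + 1) * (2 ^ (2 * u * t ^ m) - 1) / (2 ^ u + 1)`. -/
def freeContrib {k m : ℕ} (P : ExpPoly m) (n t u : ArithTerm k) : ArithTerm k :=
  (2 ^ u + 1 +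
      sum ((List.filter (fun a => a.Free ∧ a.coeff < 0) P).map (coeffAbs n)) -
      sum ((List.filter (fun a => a.Free ∧ 0 < a.coeff) P).map (coeffAbs n))) *
    (2 ^ (2 * u * t ^ (num m : ArithTerm k)) - 1) / (2 ^ u + 1)

/-- The sum of all contributions of the monomials of `P`, the parameter being `n`. A monomial with
a negative coefficient has a positive contribution and vice versa. -/
def hypercube {k m : ℕ} (P : ExpPoly m) (n t u : ArithTerm k) : ArithTerm k :=
  freeContrib P n t u +
      sum ((List.filter (fun a => ¬ a.Free ∧ a.coeff < 0) P).map (contribAbs n t u)) -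
    sum ((List.filter (fun a => ¬ a.Free ∧ 0 < a.coeff) P).map (contribAbs n t u))

/-- The term that counts the zeros of `P` in the cube `{0, …, t - 1} ^ m`, for
`0 ≤ P < 2 ^ u` on the cube. -/
def countZeros {k m : ℕ} (P : ExpPoly m) (n t u : ArithTerm k) : ArithTerm k :=
  hw (hypercube P n t u) / u - t ^ (num m : ArithTerm k)

end ArithTerm

/-! ### The prime-counting term -/

/-- `(x_1 ^ 2 - n x_2 - 1) ^ 2`, expanded. -/
def sqrtUnityPoly : ExpPoly 2 :=
  ExpPoly.collect
    (.X 0 ^ 4 - 2 * .X 0 ^ 2 - 2 * .param * .X 0 ^ 2 * .X 1 + .param ^ 2 * .X 1 ^ 2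
      + 2 * .param * .X 1 + 1)

namespace ArithTerm

/-- The term for the number of square roots of unity modulo `a`, with `t = a + 1`, `u = a + 5`. -/
def sqrtUnityCount {k : ℕ} (a : ArithTerm k) : ArithTerm k :=
  countZeros sqrtUnityPoly a (a + 1) (a + 5)

/-- The term for the number of distinct prime divisors. -/
def omega {k : ℕ} (a : ArithTerm k) : ArithTerm k := nu2 (sqrtUnityCount (4 * a)) - 1

/-- The term for the prime-counting function. -/
def primePi {k : ℕ} (a : ArithTerm k) : ArithTerm k := omega (fact a)

end ArithTerm

/-! ### The exponential Diophantine equation for the `n`-th prime -/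

namespace PrimeEquation

open ExpPoly

/-- `z = ⌊x / y⌋` -/
def eDiv {m : ℕ} (x y y₁ y₂ z : ExpPoly m) : ExpPoly m :=
  (x - y * z - y₁) ^ 2 + (y₁ + y₂ + 1 - y) ^ 2

/-- `z = x mod y` -/
def eMod {m : ℕ} (x y y₁ y₂ z : ExpPoly m) : ExpPoly m :=
  (x - y * y₁ - z) ^ 2 + (z + y₂ + 1 - y) ^ 2

/-- `y ∣ x` -/
def eDvd {m : ℕ} (x y₁ y : ExpPoly m) : ExpPoly m := (x - y * y₁) ^ 2

/-- `¬ y ∣ x` -/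
def eNotDvd {m : ℕ} (x y₁ y₂ y₃ y : ExpPoly m) : ExpPoly m :=
  (x - y * y₁ - y₂ - 1) ^ 2 + (y₂ + y₃ + 2 - y) ^ 2

/-- The label of the unknown `x_j`, `1 ≤ j ≤ 42`. -/
def lab (j : ℕ) : Fin 42 := Fin.ofNat 42 (j - 1)

/-- The unknown `x_j`, `1 ≤ j ≤ 42`. -/
def x (j : ℕ) : ExpPoly 42 := X (lab j)

/-- `2 ^ (c + ∑ a * x_j)`, the sum over the pairs `(a, j)` in `l`. -/
def tp (c : ℕ) (l : List (ℕ × ℕ)) : ExpPoly 42 := twoPow c (l.map fun s => (s.1, lab s.2))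

/-- The exponent of `2` in `x_i` is `x_j`, with the auxiliary unknowns `x_{y+1}, …, x_{y+4}`. -/
def eNu (i y j : ℕ) : ExpPoly 42 :=
  eNotDvd (x i) (x (y + 1)) (x (y + 2)) (x (y + 3)) (tp 1 [(1, j)])
    + eDvd (x i) (x (y + 4)) (tp 0 [(1, j)])

/-- `x_l` is the binomial coefficient `(c x_i).choose x_j`, with the auxiliary unknowns
`x_{y+1}, …, x_{y+7}`. -/
def eBinom (c i j y l : ℕ) : ExpPoly 42 :=
  let a : ExpPoly 42 := const c * x i
  (x (y + 1) - (2 * a ^ 3 + 8 * a ^ 2 + 2 * a * x j + 12 * a + 4 * x j + 8)) ^ 2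
    + (x (y + 2) - (2 * a ^ 2 + 8 * a + 8)) ^ 2
    + eDiv (tp 0 [(1, y + 1)]) (tp 0 [(1, y + 2)] - tp 4 [(2 * c, i)] - 1)
        (x (y + 4)) (x (y + 5)) (x (y + 3))
    + eMod (x (y + 3)) (tp 4 [(2 * c, i)]) (x (y + 6)) (x (y + 7)) (x l)

/-- `x_j = x_i !`, with the auxiliary unknowns `x_{y+1}, …, x_{y+13}`. -/
def eFact (i y j : ℕ) : ExpPoly 42 :=
  (x (y + 1) - x i ^ 2) ^ 2
    + (x (y + 2) - tp 0 [(3, y + 1)]) ^ 2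
    + (x (y + 3) - x i * x (y + 1)) ^ 2
    + eBinom 1 (y + 2) i (y + 4) (y + 4)
    + eDiv (tp 0 [(3, y + 3)]) (x (y + 4)) (x (y + 12)) (x (y + 13)) (x j)

/-- `x_j` is the Hamming weight of `x_i`, with the auxiliary unknowns `x_{y+1}, …, x_{y+12}`. -/
def eHW (i y j : ℕ) : ExpPoly 42 :=
  eBinom 2 i i (y + 1) (y + 1) + eNu (y + 1) (y + 8) j

/-- `x_6 = M(4 f₁)`, where `f₁ = x_2`, `x_3 = f₁ ^ 2`, `x_4 = f₁ ^ 3`, `x_5 = 4 f₁ + 1`, with the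
auxiliary unknowns `x_22, …, x_30`. Here `M(n)` is the value of the hypercube term of
`(x_1 ^ 2 - n x_2 - 1) ^ 2` for `t = n + 1` and `u = n + 5`; with `t = 4 f₁ + 1`, `u = 4 f₁ + 5`,
the unknowns `gri` stand for `G_r(q_i, t)`, where `q₁ = 2 ^ (2 u)`, `q₂ = 2 ^ (2 t u)`. -/
def eM4 : ExpPoly 42 :=
  let f₁ := x 2
  let f₄ := x 5
  let q11 := x 22
  let q21 := x 23
  let g01 := x 24
  let g21 := x 25
  let g41 := x 26
  let g02 := x 27
  let g12 := x 28
  let g22 := x 29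
  let C := x 30
  let t₁ := 4 * f₁
  let twoU := tp 5 [(4, 2)]
  let h := 1 - twoU
  let q₁ := tp 10 [(8, 2)]
  let q₂ := tp 10 [(48, 2), (32, 3)]
  let q₁t := q₂
  let q₁t₁ := tp 0 [(40, 2), (32, 3)]
  let q₂t := tp 10 [(88, 2), (224, 3), (128, 4)]
  let q₂t₁ := tp 0 [(40, 2), (192, 3), (128, 4)]
  (q11 - q₁ + 1) ^ 2
    + (q21 - q₂ + 1) ^ 2
    + (g01 * q11 - (q₁t - 1)) ^ 2
    + (g02 * q21 - (q₂t - 1)) ^ 2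
    + (g12 * q21 ^ 2 - q₂ * (t₁ * q₂t - f₄ * q₂t₁ + 1)) ^ 2
    + (g21 * q11 ^ 3
        - q₁ * (t₁ ^ 2 * q₁t₁ * q₁ ^ 2 - (2 * t₁ ^ 2 + 2 * t₁ - 1) * q₁t + f₄ ^ 2 * q₁t₁
          - q₁ - 1)) ^ 2
    + (g22 * q21 ^ 3
        - q₂ * (t₁ ^ 2 * q₂t₁ * q₂ ^ 2 - (2 * t₁ ^ 2 + 2 * t₁ - 1) * q₂t + f₄ ^ 2 * q₂t₁
          - q₂ - 1)) ^ 2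
    + (g41 * q11 ^ 5
        - q₁ * (t₁ ^ 4 * q₁t₁ * q₁ ^ 4
          + (1 - 4 * t₁ + 6 * t₁ ^ 2 - 4 * t₁ ^ 3 - 4 * t₁ ^ 4) * q₁t₁ * q₁ ^ 3
          + (11 - 12 * t₁ - 6 * t₁ ^ 2 + 12 * t₁ ^ 3 + 6 * t₁ ^ 4) * q₁t₁ * q₁ ^ 2
          + (11 + 12 * t₁ - 6 * t₁ ^ 2 - 12 * t₁ ^ 3 - 4 * t₁ ^ 4) * q₁t
          + f₄ ^ 4 * q₁t₁ - q₁ ^ 3 - 11 * q₁ ^ 2 - 11 * q₁ - 1)) ^ 2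
    + (C * (twoU + 1) - twoU * (q₂t - 1)) ^ 2
    + (x 6 - (C + h * g41 * g02 - 2 * h * g21 * g02 - 2 * (4 * f₁) * h * g21 * g12
        + (4 * f₁) ^ 2 * h * g01 * g22 + 2 * (4 * f₁) * h * g01 * g12)) ^ 2

/-- The exponential polynomial in the parameter `n` and the unknowns `x_1, …, x_42` that has
exactly as many zeros as the value of the `n`-th prime. The unknowns `x_1, …, x_8` stand for
`a`, `f₁ = a !`, `f₂ = f₁ ^ 2`, `f₃ = f₁ ^ 3`, `f₄ = 4 f₁ + 1`, `M(4 f₁)`, its Hamming weight,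
and a slack variable. -/
def poly : ExpPoly 42 :=
  collect
    (eFact 1 8 2
      + (x 3 - x 2 ^ 2) ^ 2
      + (x 4 - x 2 * x 3) ^ 2
      + (x 5 - 4 * x 2 - 1) ^ 2
      + eM4
      + eHW 6 30 7
      + (x 7 + (4 * x 2 + 5) * (- x 5 ^ 2 + x 8 - twoPowParam)) ^ 2)

end PrimeEquation

/-! ### The term for the `n`-th prime and the term for the next prime -/

namespace ArithTerm

/-- The side `t(n) = 2 ^ 2 ^ 2 ^ (2 n ^ 4 + 16)` of the cube. -/
def primeT {k : ℕ} (n : ArithTerm k) : ArithTerm k :=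
  2 ^ (2 ^ (2 ^ (2 * n ^ (4 : ArithTerm k) + 16) : ArithTerm k) : ArithTerm k)

/-- `u(n) = 2 ^ (2 ^ (9 t(n) + 8) + 9)`. -/
def primeU {k : ℕ} (n : ArithTerm k) : ArithTerm k :=
  2 ^ (2 ^ (9 * primeT n + 8 : ArithTerm k) + 9 : ArithTerm k)

/-- The term for the `n`-th prime, `n ≥ 1`. -/
def nthPrime {k : ℕ} (n : ArithTerm k) : ArithTerm k :=
  countZeros PrimeEquation.poly n (primeT n) (primeU n)

/-- The closed term `T(x) = p(π(x) + 1)` in one variable `x`. -/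
def nextPrime : ArithTerm 1 := nthPrime (primePi (var 0) + 1)

end ArithTerm

/-!
All terms are evaluated exactly, and the final term is traced back to a count of zeros.

*Basic terms.* The terms `binom`, `gcd` and `nu2` read off a digit, to a large base, of a sum of powers
of this base (`binom_formula`, `gcd_formula`, `nu2_formula`); `fact` approximates `a !` by a quotient
from above (`factorial_formula`), and `geom` solves a recurrence (`geomSum_formula`). By Kummer's
theorem the exponent of `2` in `(2a).choose a` is the number of binary digits `1` of `a`, which yields the term for the Hamming weight.

*Counting zeros.* Let `0 ≤ P ≤ 2 ^ u` on the cube `{0, …, t - 1} ^ m`. The hypercube term is a number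
whose blocks of `2 u` binary digits are indexed by the points of the cube, the block of a point being
`(2 ^ u - 1) (2 ^ u + 1 - P)`. If `P = 0` all `2 u` digits are `1`; if `1 ≤ P ≤ 2 ^ u`, exactly half of
them are. So the digit sum is `u (t ^ m + #zeros)` (`ArithTerm.eval_countZeros`). The sums of monomials
over the cube are products of generalized geometric progressions (`ExpMono.prod_geomSum`), which is why
the number is given by a term.

*Prime counting.* The zeros of `(x_1 ^ 2 - n x_2 - 1) ^ 2` in `{0, …, n} ^ 2` are the square roots of
unity modulo `n`. By the Chinese remainder theorem there are `2 ^ (ω(a) + 1)` of them for `n = 4 a`, and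
`ω(x !) = π(x)` (`ArithTerm.eval_primePi`).

*The `n`-th prime.* The polynomial `PrimeEquation.poly` is a sum of squares that forces all its unknowns
to follow this computation of `2 ^ (π(a) + 1)` from the first unknown `a`, and has a last equation with
a slack variable that requires `2 ^ (π(a) + 1) ≤ 2 ^ n` (`PrimeEquation.poly_val_eq_zero_iff`). Its
zeros therefore correspond to the `a` with `π(a) < n`, that is, to the numbers below the `n`-th prime,
and the number of zeros is the `n`-th prime. It remains to see that the cube contains all the zeros and
that `u` is large enough. The first holds since the `n`-th prime is at most `n ^ 2 + 1` by Chebyshev's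
bound (`nth_prime_le`, `PrimeEquation.solution_lt`), the second since the polynomial, whose exponents
are linear in the unknowns, is at most `2 ^ (e t)` on the cube for a constant `e`
(`PrimeEquation.poly_logBound`).

The next prime after `x` is the prime of index `π(x) + 1`.
-/

/-! ### Base-`x` expansions -/

theorem sum_mul_pow_lt_pow {x : ℕ} (d : ℕ → ℕ) (hd : ∀ i, d i < x) (c : ℕ) :
    ∑ i ∈ Finset.range c, d i * x ^ i < x ^ c := by
  induction c with
  | zero => simp
  | succ c ih =>
    rw [Finset.sum_range_succ, pow_succ]
    have := Nat.mul_le_mul_right (x ^ c) (Nat.succ_le_of_lt (hd c))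
    rw [Nat.succ_mul] at this
    linarith [mul_comm x (x ^ c)]

/-- The floor of a sum of powers of `y` divided by `y ^ M`, reduced modulo `y`, counts the summands
equal to `y ^ M`, provided that there are fewer than `y` summands. -/
theorem sum_pow_div_mod_eq_card {ι : Type*} (s : Finset ι) (e : ι → ℕ) (y M : ℕ) (hy : s.card < y) :
    (∑ i ∈ s, y ^ e i) / y ^ M % y = (s.filter fun i => e i = M).card := by
  have hy0 : 0 < y := by omega
  have hyM : 0 < y ^ M := pow_pos hy0 M
  have hlow : ∑ i ∈ s.filter (fun i => e i < M), y ^ e i < y ^ M := by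
    refine lt_of_mul_lt_mul_right ?_ hy0.le
    calc (∑ i ∈ s.filter (fun i => e i < M), y ^ e i) * y
        = ∑ i ∈ s.filter (fun i => e i < M), y ^ (e i + 1) := by
          rw [Finset.sum_mul]; simp_rw [pow_succ]
      _ ≤ ∑ i ∈ s.filter (fun i => e i < M), y ^ M := Finset.sum_le_sum fun i hi =>
          Nat.pow_le_pow_right hy0 (by have := (Finset.mem_filter.1 hi).2; omega)
      _ = (s.filter fun i => e i < M).card * y ^ M := by simp
      _ ≤ s.card * y ^ M := Nat.mul_le_mul_right _ (Finset.card_filter_le _ _)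
      _ < y * y ^ M := Nat.mul_lt_mul_of_pos_right hy hyM
      _ = y ^ M * y := mul_comm _ _
  obtain ⟨H, hH⟩ : y ^ (M + 1) ∣ ∑ i ∈ s.filter (fun i => M < e i), y ^ e i :=
    Finset.dvd_sum fun i hi => pow_dvd_pow _ (by have := (Finset.mem_filter.1 hi).2; omega)
  have hsplit : ∑ i ∈ s, y ^ e i = ∑ i ∈ s.filter (fun i => e i < M), y ^ e i
      + y ^ M * ((s.filter fun i => e i = M).card + y * H) := by
    have h1 : ∑ i ∈ s.filter (fun i => e i = M), y ^ e i
        = (s.filter fun i => e i = M).card * y ^ M := by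
      rw [Finset.sum_congr rfl (g := fun _ => y ^ M)
        (fun i hi => by rw [(Finset.mem_filter.1 hi).2])]
      simp
    have h2 : ∑ i ∈ s.filter (fun i => ¬ e i < M), y ^ e i
        = ∑ i ∈ s.filter (fun i => e i = M), y ^ e i
          + ∑ i ∈ s.filter (fun i => M < e i), y ^ e i := by
      rw [← Finset.sum_filter_add_sum_filter_not (s.filter fun i => ¬ e i < M) (fun i => e i = M),
        Finset.filter_filter, Finset.filter_filter]
      congr 2 <;> ext i <;> simp only [Finset.mem_filter] <;> constructor <;>
        rintro ⟨h1, h2⟩ <;> exact ⟨h1, by omega⟩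
    rw [← Finset.sum_filter_add_sum_filter_not s (fun i => e i < M), h2, h1, hH]
    ring
  have hcard : (s.filter fun i => e i = M).card < y := (Finset.card_filter_le _ _).trans_lt hy
  rw [hsplit, Nat.add_mul_div_left _ _ hyM, Nat.div_eq_of_lt hlow, zero_add,
    Nat.add_mul_mod_self_left, Nat.mod_eq_of_lt hcard]

/-! ### Binomial coefficients -/

/-- The geometric expansion of `x ^ N / (x ^ N - q)`, up to the power `n + 1`, as an identity of
natural numbers: here `D + q` plays the role of `x ^ N`, and `A` collects the terms of higher order. -/
theorem exists_pow_succ_eq_geom (D q n : ℕ) :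
    ∃ A, (D + q) ^ (n + 1) = D * (q ^ n + (D + q) * A) + q ^ (n + 1) := by
  induction n with
  | zero => exact ⟨0, by ring⟩
  | succ n ih =>
    obtain ⟨A, hA⟩ := ih
    refine ⟨q ^ n + (D + q) * A, ?_⟩
    rw [pow_succ, hA]
    ring

/-- Let `x = 2 ^ (2 (a + 2))`. The expansion of `x ^ ((a + 2) (a + 1)) / (x ^ (a + 2) - (x + 1))` as a
geometric series consists of multiples of `x ^ (a + 2)`, the term `(x + 1) ^ a`, and a rest less than
`1`. Dividing by a further `x ^ (a - b)` brings the base-`x` digit `a.choose (a - b)` of `(x + 1) ^ a`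
to the position of the units. -/
theorem binom_formula {a b : ℕ} (h : b ≤ a) :
    2 ^ (2 * (a + 2) * ((a + 1) * (a + 1) + b + 1)) /
      (2 ^ (2 * ((a + 2) * (a + 2))) - 2 ^ (2 * (a + 2)) - 1) % 2 ^ (2 * (a + 2))
      = a.choose b := by
  obtain ⟨c, rfl⟩ := Nat.exists_eq_add_of_le h
  set a := b + c with ha
  set x := 2 ^ (2 * (a + 2)) with hx
  have hx4 : x = 2 ^ (a + 2) * 2 ^ (a + 2) := by rw [hx, ← pow_add]; congr 1; ring
  have hpa : 2 ^ a < x := by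
    rw [hx]; exact Nat.pow_lt_pow_right (by norm_num) (by omega)
  have hx0 : 0 < x := by positivity
  have e1 : 2 ^ (2 * (a + 2) * ((a + 1) * (a + 1) + b + 1)) = x ^ ((a + 1) * (a + 1) + b + 1) := by
    rw [hx, ← pow_mul]
  have e2 : 2 ^ (2 * ((a + 2) * (a + 2))) = x ^ (a + 2) := by
    rw [hx, ← pow_mul]; congr 1; ring
  rw [e1, e2]
  have hbig : (x + 1) ^ (a + 1) + (x + 1) < x ^ (a + 2) := by
    have h1 : (x + 1) ^ (a + 1) ≤ 2 ^ (a + 1) * x ^ (a + 1) := by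
      rw [← mul_pow]; exact Nat.pow_le_pow_left (by omega) _
    have h2 : x + 1 ≤ 2 ^ (a + 1) * x ^ (a + 1) := by
      calc x + 1 ≤ 2 ^ 1 * x ^ 1 := by rw [pow_one, pow_one]; omega
        _ ≤ _ := Nat.mul_le_mul (Nat.pow_le_pow_right (by norm_num) (by omega))
            (Nat.pow_le_pow_right hx0 (by omega))
    have h3 : 2 ^ (a + 2) * x ^ (a + 1) < x * x ^ (a + 1) := by
      refine Nat.mul_lt_mul_of_pos_right ?_ (by positivity)
      rw [hx4]
      have : 1 < 2 ^ (a + 2) := Nat.one_lt_two_pow (by omega)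
      nlinarith
    have h4 : x ^ (a + 2) = x * x ^ (a + 1) := by ring
    have h5 : 2 ^ (a + 2) * x ^ (a + 1) = 2 ^ (a + 1) * x ^ (a + 1) + 2 ^ (a + 1) * x ^ (a + 1) := by
      ring
    omega
  obtain ⟨D, hD⟩ := Nat.exists_eq_add_of_le (show x + 1 ≤ x ^ (a + 2) by omega)
  have hDsub : x ^ (a + 2) - x - 1 = D := by omega
  have hDlt : (x + 1) ^ (a + 1) < D := by omega
  rw [hDsub]
  obtain ⟨A, hA⟩ := exists_pow_succ_eq_geom D (x + 1) a
  rw [show D + (x + 1) = x ^ (a + 2) by omega] at hA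
  have hchoose : ∀ i, a.choose i < x := fun i => (Nat.choose_le_two_pow a i).trans_lt hpa
  set R := ∑ i ∈ Finset.range c, a.choose i * x ^ i with hR
  have hRlt : R < x ^ c := sum_mul_pow_lt_pow _ hchoose c
  obtain ⟨B, hB⟩ : ∃ B, (x + 1) ^ a = R + x ^ c * (a.choose c + x * B) := by
    refine ⟨∑ i ∈ Finset.range b, a.choose (c + (1 + i)) * x ^ i, ?_⟩
    rw [add_pow, show a + 1 = c + (1 + b) by omega, Finset.sum_range_add, Finset.sum_range_add]
    simp only [one_pow, mul_one, Finset.sum_range_one, hR]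
    congr 1
    · exact Finset.sum_congr rfl fun i _ => by push_cast; ring
    · rw [Finset.mul_sum, mul_add, Finset.mul_sum]
      exact congrArg₂ _ (by push_cast; ring_nf) (Finset.sum_congr rfl fun i _ => by push_cast; ring)
  have hcc : a.choose c = a.choose b := Nat.choose_symm_of_eq_add (by omega)
  obtain ⟨K, hK⟩ : ∃ K, x ^ (a + 2) * A = x ^ c * (x * K) :=
    ⟨x ^ (b + 1) * A, by rw [ha]; ring⟩
  set Q := a.choose c + x * (B + K) with hQ
  have key : x ^ ((a + 1) * (a + 1) + b + 1) * x ^ c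
      = D * R + (x + 1) ^ (a + 1) + x ^ c * (D * Q) := by
    rw [← pow_add, show (a + 1) * (a + 1) + b + 1 + c = (a + 2) * (a + 1) by rw [ha]; ring,
      pow_mul, hA, hK, hB, hQ]
    ring
  have hxc : 0 < x ^ c := by positivity
  have hdiv : x ^ ((a + 1) * (a + 1) + b + 1) / D = Q := by
    refine Nat.div_eq_of_lt_le ?_ ?_
    · refine le_of_mul_le_mul_right ?_ hxc
      rw [key, mul_comm (x ^ c), mul_comm Q]
      exact Nat.le_add_left _ _
    · refine lt_of_mul_lt_mul_right ?_ hxc.le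
      rw [key]
      have : D * (R + 1) ≤ D * x ^ c := Nat.mul_le_mul_left _ hRlt
      nlinarith
  rw [hdiv, hQ, Nat.add_mul_mod_self_left, Nat.mod_eq_of_lt (hchoose c), hcc]

/-! ### Greatest common divisors and the exponent of two -/

/-- The lattice points on the segment from `(0, a)` to `(b, 0)`, apart from the first one. -/
theorem card_linear_solutions {a b : ℕ} (ha : 0 < a) (hb : 0 < b) :
    ((Finset.range b ×ˢ Finset.range a).filter fun ij => a * (ij.1 + 1) + b * ij.2 = a * b).card
      = a.gcd b := by
  have hg : 0 < a.gcd b := Nat.gcd_pos_of_pos_left _ ha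
  have h1 : ((Finset.range b ×ˢ Finset.range a).filter
      fun ij => a * (ij.1 + 1) + b * ij.2 = a * b).card
      = ((Finset.range b).filter fun i => b / a.gcd b ∣ i + 1).card := by
    refine Finset.card_bij (fun ij _ => ij.1) ?_ ?_ ?_
    · rintro ⟨i, j⟩ h
      simp only [Finset.mem_filter, Finset.mem_product, Finset.mem_range] at h ⊢
      refine ⟨h.1.1, ?_⟩
      have hd : b ∣ a * (i + 1) := by
        have : b ∣ a * (i + 1) + b * j := h.2 ▸ dvd_mul_left _ _
        exact (Nat.dvd_add_left (dvd_mul_right _ _)).1 this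
      have hcop := Nat.coprime_div_gcd_div_gcd hg
      refine (hcop.symm.dvd_mul_left (n := i + 1)).1 ?_
      refine (Nat.mul_dvd_mul_iff_right hg).1 ?_
      rw [Nat.div_mul_cancel (Nat.gcd_dvd_right a b), mul_right_comm,
        Nat.div_mul_cancel (Nat.gcd_dvd_left a b)]
      exact hd
    · rintro ⟨i, j⟩ h ⟨i', j'⟩ h' hii
      simp only [Finset.mem_filter, Finset.mem_product, Finset.mem_range] at h h' hii
      subst hii
      have : b * j = b * j' := by omega
      rw [Nat.eq_of_mul_eq_mul_left hb this]
    · intro i hi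
      simp only [Finset.mem_filter, Finset.mem_range] at hi
      obtain ⟨hib, k, hk⟩ := hi
      have hbe : b / a.gcd b * a.gcd b = b := Nat.div_mul_cancel (Nat.gcd_dvd_right a b)
      have hae : a / a.gcd b * a.gcd b = a := Nat.div_mul_cancel (Nat.gcd_dvd_left a b)
      set a' := a / a.gcd b
      set b' := b / a.gcd b
      set g := a.gcd b
      have hb' : 0 < b' := Nat.pos_of_mul_pos_right (hbe ▸ hb)
      have ha' : 0 < a' := Nat.pos_of_mul_pos_right (hae ▸ ha)
      have hk0 : 0 < k := by
        rcases Nat.eq_zero_or_pos k with h | h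
        · simp [h] at hk
        · exact h
      have hkg : k ≤ g := by
        have : b' * k ≤ b' * g := by omega
        exact le_of_mul_le_mul_left this hb'
      refine ⟨(i, a' * (g - k)), ?_, rfl⟩
      obtain ⟨l, hl⟩ := Nat.exists_eq_add_of_le hkg
      have hgk : g - k = l := by omega
      simp only [Finset.mem_filter, Finset.mem_product, Finset.mem_range]
      refine ⟨⟨hib, ?_⟩, ?_⟩
      · rw [hgk]; nlinarith
      · rw [hgk, hk, ← hbe, ← hae, hl]; ring
  rw [h1, Nat.card_multiples]
  exact Nat.div_eq_of_eq_mul_left (Nat.div_pos (Nat.le_of_dvd hb (Nat.gcd_dvd_right a b)) hg)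
    (Nat.mul_div_cancel' (Nat.gcd_dvd_right a b)).symm

/-- The quotient is `∑ y ^ (a i + b j - a b)` over `1 ≤ i ≤ b` and `0 ≤ j < a` with `y = 2 ^ (a b)`;
the pairs with `a i + b j = a b` are counted. -/
theorem gcd_formula {a b : ℕ} (ha : 0 < a) (hb : 0 < b) :
    (2 ^ (a * a * b * (b + 1)) - 2 ^ (a * a * b)) * (2 ^ (a * a * b * b) - 1) /
      ((2 ^ (a * a * b) - 1) * (2 ^ (a * b * b) - 1) * 2 ^ (a * a * b * b)) % 2 ^ (a * b)
      = a.gcd b := by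
  set y := 2 ^ (a * b) with hy
  have hab : 0 < a * b := Nat.mul_pos ha hb
  have hy1 : 1 < y := Nat.one_lt_two_pow hab.ne'
  have e1 : 2 ^ (a * a * b * (b + 1)) = y ^ a * (y ^ a) ^ b := by
    rw [hy]; simp only [← pow_mul, ← pow_add]; congr 1; ring
  have e2 : 2 ^ (a * a * b) = y ^ a := by
    rw [hy]; simp only [← pow_mul]; congr 1; ring
  have e3 : 2 ^ (a * a * b * b) = (y ^ b) ^ a := by
    rw [hy]; simp only [← pow_mul]; congr 1; ring
  have e4 : 2 ^ (a * b * b) = y ^ b := by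
    rw [hy]; simp only [← pow_mul]
  have h1 : 1 < y ^ a := Nat.one_lt_pow ha.ne' hy1
  have h2 : 1 < y ^ b := Nat.one_lt_pow hb.ne' hy1
  have g1 : (∑ i ∈ Finset.range b, (y ^ a) ^ i) * (y ^ a - 1) = (y ^ a) ^ b - 1 := by
    have := geom_sum_mul_add (y ^ a - 1) b
    rw [Nat.sub_add_cancel h1.le] at this
    omega
  have g2 : (∑ i ∈ Finset.range a, (y ^ b) ^ i) * (y ^ b - 1) = (y ^ b) ^ a - 1 := by
    have := geom_sum_mul_add (y ^ b - 1) a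
    rw [Nat.sub_add_cancel h2.le] at this
    omega
  have hnum : (y ^ a * (y ^ a) ^ b - y ^ a) * ((y ^ b) ^ a - 1)
      = ((y ^ a - 1) * (y ^ b - 1)) *
        ∑ ij ∈ Finset.range b ×ˢ Finset.range a, y ^ (a * (ij.1 + 1) + b * ij.2) := by
    have : ∑ ij ∈ Finset.range b ×ˢ Finset.range a, y ^ (a * (ij.1 + 1) + b * ij.2)
        = y ^ a * ((∑ i ∈ Finset.range b, (y ^ a) ^ i) * ∑ i ∈ Finset.range a, (y ^ b) ^ i) := by
      rw [Finset.sum_mul_sum, Finset.mul_sum, Finset.sum_product]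
      refine Finset.sum_congr rfl fun i _ => ?_
      rw [Finset.mul_sum]
      exact Finset.sum_congr rfl fun j _ => by ring
    rw [this, ← g2, show y ^ a * (y ^ a) ^ b - y ^ a = y ^ a * ((y ^ a) ^ b - 1) by
      rw [Nat.mul_sub, mul_one], ← g1]
    ring
  rw [e1, e2, e3, e4, hnum, Nat.mul_div_mul_left _ _ (Nat.mul_pos (by omega) (by omega)), ← pow_mul,
    sum_pow_div_mod_eq_card _ _ y (b * a), ← card_linear_solutions ha hb, mul_comm b a]
  rw [Finset.card_product, Finset.card_range, Finset.card_range, mul_comm, hy]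
  exact Nat.lt_two_pow_self

theorem gcd_two_pow_self {a : ℕ} (ha : 0 < a) : a.gcd (2 ^ a) = 2 ^ padicValNat 2 a := by
  obtain ⟨k, hk, h⟩ := (Nat.dvd_prime_pow Nat.prime_two).1 (Nat.gcd_dvd_right a (2 ^ a))
  rw [h]
  congr 1
  refine le_antisymm ?_ ?_
  · rw [← padicValNat_dvd_iff_le ha.ne', ← h]; exact Nat.gcd_dvd_left _ _
  · refine (Nat.pow_dvd_pow_iff_le_right (x := 2) (by norm_num)).1 ?_
    rw [← h]
    refine Nat.dvd_gcd pow_padicValNat_dvd (pow_dvd_pow _ ?_)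
    have := Nat.le_of_dvd ha (pow_padicValNat_dvd (p := 2) (n := a))
    exact (Nat.lt_two_pow_self).le.trans this

/-- The binomial theorem modulo `w ^ 2`. -/
theorem exists_succ_pow_eq (w v : ℕ) : ∃ K, (w + 1) ^ v = 1 + v * w + w * w * K := by
  induction v with
  | zero => exact ⟨0, by ring⟩
  | succ v ih =>
    obtain ⟨K, hK⟩ := ih
    exact ⟨v + (w + 1) * K, by rw [pow_succ, hK]; ring⟩

/-- With `2 ^ (a + 1) = w + 1` and `gcd (a, 2 ^ a) = 2 ^ v`, the power is
`(w + 1) ^ v ≡ 1 + v w` modulo `w ^ 2`, from which `v` is recovered. -/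
theorem nu2_formula {a : ℕ} (ha : 0 < a) :
    (a.gcd (2 ^ a)) ^ (a + 1) % ((2 ^ (a + 1) - 1) * (2 ^ (a + 1) - 1)) / (2 ^ (a + 1) - 1)
      = padicValNat 2 a := by
  rw [gcd_two_pow_self ha]
  set v := padicValNat 2 a
  have hv : v < a + 1 := by
    have := Nat.le_of_dvd ha (pow_padicValNat_dvd (p := 2) (n := a))
    exact (Nat.lt_two_pow_self.trans_le this).trans (Nat.lt_succ_self a)
  have hpow : a + 1 < 2 ^ (a + 1) := Nat.lt_two_pow_self
  obtain ⟨w, hw⟩ : ∃ w, 2 ^ (a + 1) = w + 1 := ⟨2 ^ (a + 1) - 1, by omega⟩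
  obtain ⟨K, hK⟩ := exists_succ_pow_eq w v
  have hvw : v + 1 ≤ w := by omega
  have hlt : 1 + v * w < w * w := by
    have h1 := Nat.mul_le_mul_right w hvw
    have h2 : 1 < w := by omega
    nlinarith
  rw [← pow_mul, mul_comm v, pow_mul, hw, hK, Nat.add_sub_cancel, Nat.add_mul_mod_self_left,
    Nat.mod_eq_of_lt hlt, Nat.add_mul_div_right _ _ (by omega), Nat.div_eq_of_lt (by omega),
    zero_add]

/-! ### Binary digit sums -/

/-- The Hamming weight of `n`: the sum of its binary digits. -/
def digitSum (n : ℕ) : ℕ := (Nat.digits 2 n).sum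

@[simp] theorem digitSum_zero : digitSum 0 = 0 := by simp [digitSum]

theorem digitSum_bit (r n : ℕ) (hr : r < 2) : digitSum (r + 2 * n) = r + digitSum n := by
  unfold digitSum
  by_cases h : r ≠ 0 ∨ n ≠ 0
  · rw [Nat.digits_add 2 (by norm_num) r n hr h, List.sum_cons]
  · push Not at h
    simp [h.1, h.2]

theorem digitSum_add_two_pow_mul (w b a : ℕ) (hb : b < 2 ^ w) :
    digitSum (b + 2 ^ w * a) = digitSum b + digitSum a := by
  induction w generalizing b with
  | zero => obtain rfl : b = 0 := by simpa using hb
            simp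
  | succ w ih =>
    have hb2 : b / 2 < 2 ^ w := by rw [Nat.div_lt_iff_lt_mul (by norm_num), ← pow_succ]; exact hb
    have hm : b % 2 < 2 := Nat.mod_lt _ (by norm_num)
    have h1 : b + 2 ^ (w + 1) * a = b % 2 + 2 * (b / 2 + 2 ^ w * a) := by
      have := Nat.mod_add_div b 2
      rw [pow_succ]; nlinarith
    have h2 : digitSum b = b % 2 + digitSum (b / 2) := by
      conv_lhs => rw [← Nat.mod_add_div b 2]
      exact digitSum_bit _ _ hm
    rw [h1, digitSum_bit _ _ hm, ih _ hb2, h2]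
    ring

theorem digitSum_compl (u j : ℕ) (hj : j < 2 ^ u) : digitSum j + digitSum (2 ^ u - 1 - j) = u := by
  induction u generalizing j with
  | zero => obtain rfl : j = 0 := by simpa using hj
            simp
  | succ u ih =>
    have hj2 : j / 2 < 2 ^ u := by rw [Nat.div_lt_iff_lt_mul (by norm_num), ← pow_succ]; exact hj
    have hm : j % 2 < 2 := Nat.mod_lt _ (by norm_num)
    have hd := Nat.mod_add_div j 2
    have h1 : 2 ^ (u + 1) - 1 - j = (1 - j % 2) + 2 * (2 ^ u - 1 - j / 2) := by
      rw [pow_succ]; omega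
    have h2 : digitSum j = j % 2 + digitSum (j / 2) := by
      conv_lhs => rw [← hd]
      exact digitSum_bit _ _ hm
    rw [h1, digitSum_bit _ _ (by omega), h2]
    have := ih _ hj2
    omega

/-- The number is `(m - 1) * 2 ^ u + (2 ^ u - 1 - (m - 1))`: the digits of `m - 1`, followed by their
complements. -/
theorem digitSum_two_pow_sub_one_mul (u m : ℕ) (h1 : 1 ≤ m) (h2 : m ≤ 2 ^ u) :
    digitSum ((2 ^ u - 1) * m) = u := by
  have h : (2 ^ u - 1) * m = (2 ^ u - 1 - (m - 1)) + 2 ^ u * (m - 1) := by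
    obtain ⟨k, rfl⟩ := Nat.exists_eq_add_of_le h1
    obtain ⟨l, hl⟩ := Nat.exists_eq_add_of_le h2
    have : 2 ^ u - 1 = k + l := by omega
    rw [show 1 + k - 1 = k by omega, show 2 ^ u - 1 - k = l by omega, this, hl]
    ring
  have hlt : 2 ^ u - 1 - (m - 1) < 2 ^ u := by have := Nat.one_le_two_pow (n := u); omega
  rw [h, digitSum_add_two_pow_mul _ _ _ hlt, add_comm]
  exact digitSum_compl u (m - 1) (by omega)

theorem digitSum_two_pow_sub_one (u : ℕ) : digitSum (2 ^ u - 1) = u := by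
  simpa using digitSum_two_pow_sub_one_mul u 1 le_rfl Nat.one_le_two_pow

theorem digitSum_sum_blocks (w : ℕ) (B : ℕ → ℕ) (K : ℕ) (hB : ∀ k < K, B k < 2 ^ w) :
    digitSum (∑ k ∈ Finset.range K, 2 ^ (w * k) * B k) = ∑ k ∈ Finset.range K, digitSum (B k) := by
  induction K generalizing B with
  | zero => simp
  | succ K ih =>
    rw [Finset.sum_range_succ', Finset.sum_range_succ' _ K]
    have : ∑ k ∈ Finset.range K, 2 ^ (w * (k + 1)) * B (k + 1)
        = 2 ^ w * ∑ k ∈ Finset.range K, 2 ^ (w * k) * B (k + 1) := by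
      rw [Finset.mul_sum]
      exact Finset.sum_congr rfl fun k _ => by ring
    rw [this, mul_zero, pow_zero, one_mul, add_comm,
      digitSum_add_two_pow_mul _ _ _ (hB 0 (Nat.succ_pos K)),
      ih (fun k => B (k + 1)) fun k hk => hB _ (Nat.succ_lt_succ hk), add_comm]

/-- Kummer's theorem for the central binomial coefficient and the prime `2`. -/
theorem padicValNat_choose_two_mul_self (a : ℕ) :
    padicValNat 2 ((2 * a).choose a) = digitSum a := by
  have h := sub_one_mul_padicValNat_choose_eq_sub_sum_digits' (p := 2) (k := a) (n := a)
  have h2 := digitSum_bit 0 a (by norm_num)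
  rw [zero_add, zero_add] at h2
  rw [two_mul]
  unfold digitSum at *
  rw [← two_mul, h2] at h
  rw [← two_mul]
  omega

/-! ### Factorials -/

/-- The falling factorial `N (N - 1) ⋯ (N - k + 1)` is at least `N ^ k (1 - k ^ 2 / N)`. -/
theorem pow_succ_le_descFactorial (N k : ℕ) (hk : k ≤ N) :
    N ^ (k + 1) ≤ N * N.descFactorial k + k ^ 2 * N ^ k := by
  induction k with
  | zero => simp
  | succ k ih =>
    obtain ⟨M, rfl⟩ := Nat.exists_eq_add_of_le (show k ≤ N by omega)
    have ih := ih (by omega)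
    rw [Nat.descFactorial_succ, Nat.add_sub_cancel_left]
    have h1 := Nat.mul_le_mul_left M ih
    have e : (k + M) ^ (k + 1 + 1) = M * (k + M) ^ (k + 1) + k * (k + M) ^ (k + 1) := by ring
    have e2 : M * (k ^ 2 * (k + M) ^ k) ≤ k ^ 2 * (k + M) ^ (k + 1) := by
      rw [pow_succ (k + M) k]
      have := Nat.mul_le_mul_left (k ^ 2 * (k + M) ^ k) (Nat.le_add_left M k)
      linarith
    rw [e]
    nlinarith [Nat.zero_le ((k + 1) * (k + M) ^ (k + 1))]

/-- The quotient `N ^ a / N.choose a` is `a !` up to the factor `N ^ a / (N (N - 1) ⋯ (N - a + 1))`,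
which for `N = 8 ^ (a ^ 2)` is too close to `1` to change the integer part. -/
theorem factorial_formula (a : ℕ) :
    2 ^ (3 * (a * a * a)) / (2 ^ (3 * (a * a))).choose a = a.factorial := by
  set N := 2 ^ (3 * (a * a)) with hN
  have e : 2 ^ (3 * (a * a * a)) = N ^ a := by rw [hN, ← pow_mul]; congr 1; ring
  have haa : a * a < 2 ^ (a * a) := Nat.lt_two_pow_self
  have hN3 : N = 2 ^ (a * a) * 2 ^ (a * a) * 2 ^ (a * a) := by
    rw [hN, ← pow_add, ← pow_add]; congr 1; ring
  have hfact : a.factorial ≤ 2 ^ (a * a) := by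
    rw [pow_mul]
    exact (Nat.factorial_le_pow a).trans (Nat.pow_le_pow_left Nat.lt_two_pow_self.le _)
  have hbig : (a.factorial + 1) * (a * a) < N := by
    rcases Nat.eq_zero_or_pos a with rfl | ha
    · simp [hN]
    · have h2 : 2 ≤ 2 ^ (a * a) := by
        calc 2 = 2 ^ 1 := rfl
          _ ≤ _ := Nat.pow_le_pow_right (by norm_num) (Nat.mul_pos ha ha)
      rw [hN3]
      set z := 2 ^ (a * a)
      calc (a.factorial + 1) * (a * a) ≤ (z * z) * (a * a) := Nat.mul_le_mul_right _ (by nlinarith)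
        _ < z * z * z := Nat.mul_lt_mul_of_pos_left haa (by positivity)
  have hf1 : 1 ≤ a.factorial := Nat.factorial_pos a
  have haN : a ≤ N := by nlinarith
  have hd : N.descFactorial a = a.factorial * N.choose a := Nat.descFactorial_eq_factorial_mul_choose N a
  have hN0 : 0 < N := by positivity
  rw [e]
  refine Nat.div_eq_of_lt_le ?_ ?_
  · rw [← hd]; exact Nat.descFactorial_le_pow N a
  · have h := pow_succ_le_descFactorial N a haN
    rw [hd] at h
    have h2 : (a.factorial + 1) * (a * a) * N ^ a < N * N ^ a :=
      Nat.mul_lt_mul_of_pos_right hbig (by positivity)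
    have h3 := Nat.mul_le_mul_left (a.factorial + 1) h
    have hN' : N ^ (a + 1) = N * N ^ a := by ring
    rw [hN'] at h3
    refine lt_of_mul_lt_mul_left (a := N * a.factorial) ?_ (by positivity)
    nlinarith

/-! ### Generalized geometric progressions -/

/-- The generalized geometric progression `∑_{j < t} j ^ r * q ^ j`. -/
def geomSum (r q t : ℕ) : ℕ := ∑ j ∈ Finset.range t, j ^ r * q ^ j

/-- Shifting the summation index by one, and expanding `(j + 1) ^ r`. -/
theorem geomSum_recurrence (r q t : ℕ) :
    q * geomSum r q t + q * (∑ i ∈ Finset.range r, r.choose i * geomSum i q t) + 0 ^ r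
      = t ^ r * q ^ t + geomSum r q t := by
  have h1 : ∑ j ∈ Finset.range t, (j + 1) ^ r * q ^ (j + 1) + 0 ^ r
      = t ^ r * q ^ t + geomSum r q t := by
    have := Finset.sum_range_succ (fun j => j ^ r * q ^ j) t
    rw [Finset.sum_range_succ'] at this
    simp only [pow_zero, mul_one] at this
    rw [this, geomSum, add_comm]
  rw [← h1]
  congr 1
  have h2 : q * geomSum r q t + q * (∑ i ∈ Finset.range r, r.choose i * geomSum i q t)
      = q * ∑ i ∈ Finset.range (r + 1), r.choose i * geomSum i q t := by
    rw [Finset.sum_range_succ, Nat.choose_self]; ring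
  rw [h2]
  simp only [geomSum, Finset.mul_sum]
  rw [Finset.sum_comm]
  refine Finset.sum_congr rfl fun j _ => ?_
  rw [add_pow, Finset.sum_mul]
  refine Finset.sum_congr rfl fun i _ => ?_
  simp only [one_pow]
  push_cast
  ring

theorem geomSum_formula (r q t : ℕ) (hq : 1 < q) :
    (t ^ r * q ^ t - 0 ^ r - q * ∑ i ∈ Finset.range r, r.choose i * geomSum i q t) / (q - 1)
      = geomSum r q t := by
  have h := geomSum_recurrence r q t
  obtain ⟨p, rfl⟩ := Nat.exists_eq_add_of_le hq.le
  have h2 : t ^ r * (1 + p) ^ t - 0 ^ r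
      - (1 + p) * ∑ i ∈ Finset.range r, r.choose i * geomSum i (1 + p) t
      = p * geomSum r (1 + p) t := by
    have : (1 + p) * geomSum r (1 + p) t = geomSum r (1 + p) t + p * geomSum r (1 + p) t := by ring
    omega
  rw [h2, Nat.add_sub_cancel_left]
  exact Nat.mul_div_cancel_left _ (by omega)

/-! ### The size of the `n`-th prime -/

/-- Chebyshev's lower bound for `π`, through `2 ^ x ≤ (x + 1) * lcm(1, …, x)`. -/
theorem two_pow_le_mul_pow_primeCounting (x : ℕ) : 2 ^ x ≤ (x + 1) * x ^ x.primeCounting := by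
  rcases Nat.eq_zero_or_pos x with rfl | hx
  · simp
  refine (Chebyshev.two_pow_le_mul_lcmUpto x).trans (Nat.mul_le_mul_left _ ?_)
  rw [Nat.lcmUpto_eq_prod_pow_log, ← Nat.primesLE_card_eq_primeCounting]
  exact Finset.prod_le_pow_card _ _ _ fun p _ => Nat.pow_log_le_self p hx.ne'

theorem sq_add_one_lt_two_pow {n : ℕ} (hn : 5 ≤ n) : n ^ 2 + 1 < 2 ^ n := by
  induction n, hn using Nat.le_induction with
  | base => norm_num
  | succ n hn ih => rw [pow_succ 2]; nlinarith

/-- A crude upper bound for the `n`-th prime, sufficient for the size of the cube: fewer than `n` primes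
up to `n ^ 2` would give `2 ^ (n ^ 2) ≤ (n ^ 2 + 1) ^ n`, which is false for `n ≥ 5`. -/
theorem nth_prime_le (n : ℕ) (hn : 1 ≤ n) : Nat.nth Nat.Prime (n - 1) ≤ n ^ 2 + 1 := by
  have key : n - 1 < Nat.count Nat.Prime (n ^ 2 + 2) := by
    rcases Nat.lt_or_ge n 5 with h | h
    · interval_cases n <;> decide
    · by_contra! hc
      have hpi : (n ^ 2).primeCounting ≤ n - 1 :=
        (Nat.monotone_primeCounting (Nat.le_succ _)).trans hc
      have h1 := two_pow_le_mul_pow_primeCounting (n ^ 2)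
      have h2 : (n ^ 2 + 1) * (n ^ 2) ^ (n ^ 2).primeCounting ≤ (n ^ 2 + 1) ^ n := by
        calc (n ^ 2 + 1) * (n ^ 2) ^ (n ^ 2).primeCounting
            ≤ (n ^ 2 + 1) * (n ^ 2 + 1) ^ (n - 1) :=
              Nat.mul_le_mul_left _ ((Nat.pow_le_pow_left (Nat.le_succ _) _).trans
                (Nat.pow_le_pow_right (Nat.succ_pos _) hpi))
          _ = (n ^ 2 + 1) ^ n := by rw [← pow_succ', Nat.sub_add_cancel hn]
      have h3 : (n ^ 2 + 1) ^ n < (2 ^ n) ^ n :=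
        Nat.pow_lt_pow_left (sq_add_one_lt_two_pow h) (by omega)
      rw [← pow_mul, ← sq] at h3
      omega
  have := Nat.nth_lt_of_lt_count key
  omega

/-! ### Evaluation of terms -/

namespace ArithTerm

section Eval

variable {k : ℕ} (e : Fin k → ℕ) (a b : ArithTerm k)

@[simp] theorem eval_add : (a + b).eval e = a.eval e + b.eval e := rfl
@[simp] theorem eval_sub : (a - b).eval e = a.eval e - b.eval e := rfl
@[simp] theorem eval_mul : (a * b).eval e = a.eval e * b.eval e := rfl
@[simp] theorem eval_div : (a / b).eval e = a.eval e / b.eval e := rfl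
@[simp] theorem eval_pow : (a ^ b).eval e = a.eval e ^ b.eval e := rfl
@[simp] theorem eval_num (c : ℕ) : (num c : ArithTerm k).eval e = c := rfl
@[simp] theorem eval_ofNat (c : ℕ) :
    eval e (no_index (OfNat.ofNat c) : ArithTerm k) = (OfNat.ofNat c : ℕ) := rfl

@[simp] theorem eval_mod : (a % b).eval e = a.eval e % b.eval e := (Nat.mod_eq_sub _ _).symm

@[simp] theorem eval_sum (l : List (ArithTerm k)) : (sum l).eval e = (l.map (eval e)).sum := by
  induction l with
  | nil => rfl
  | cons a l ih => rw [List.map_cons, List.sum_cons, ← ih]; rfl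

@[simp] theorem eval_prod (l : List (ArithTerm k)) : (prod l).eval e = (l.map (eval e)).prod := by
  induction l with
  | nil => rfl
  | cons a l ih => rw [List.map_cons, List.prod_cons, ← ih]; rfl

theorem eval_binom (h : b.eval e ≤ a.eval e) :
    (binom a b).eval e = (a.eval e).choose (b.eval e) := by
  simp only [binom, eval_mod, eval_div, eval_pow, eval_mul, eval_add, eval_sub]
  exact binom_formula h

theorem eval_gcd (ha : 0 < a.eval e) (hb : 0 < b.eval e) :
    (gcd a b).eval e = (a.eval e).gcd (b.eval e) := by
  simp only [gcd, eval_mod, eval_div, eval_pow, eval_mul, eval_add, eval_sub]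
  exact gcd_formula ha hb

theorem eval_nu2 (ha : 0 < a.eval e) : (nu2 a).eval e = padicValNat 2 (a.eval e) := by
  have h : (2 ^ a : ArithTerm k).eval e = 2 ^ a.eval e := rfl
  simp only [nu2, eval_mod, eval_div, eval_pow, eval_mul, eval_add, eval_sub]
  rw [eval_gcd e a _ ha (by rw [h]; positivity), h]
  exact nu2_formula ha

/-- The arguments of `binom` and `nu2` stay in the range in which these terms are correct, so that no
hypothesis is needed; `a = 0` is included. -/
theorem eval_hw : (hw a).eval e = digitSum (a.eval e) := by
  have h : (2 * a : ArithTerm k).eval e = 2 * a.eval e := rfl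
  have hb : (binom (2 * a) a).eval e = (2 * a.eval e).choose (a.eval e) := by
    rw [eval_binom e _ _ (by rw [h]; omega), h]
  rw [hw, eval_nu2 e _ (by rw [hb]; exact Nat.choose_pos (by omega)), hb,
    padicValNat_choose_two_mul_self]

theorem eval_fact : (fact a).eval e = (a.eval e).factorial := by
  have h : (2 ^ (3 * (a * a)) : ArithTerm k).eval e = 2 ^ (3 * (a.eval e * a.eval e)) := rfl
  have hle : a.eval e ≤ 2 ^ (3 * (a.eval e * a.eval e)) :=
    calc a.eval e ≤ 3 * (a.eval e * a.eval e) := by nlinarith [Nat.le_mul_self (a.eval e)]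
      _ ≤ _ := Nat.lt_two_pow_self.le
  rw [fact, eval_div, eval_binom e _ _ (by rw [h]; exact hle), h]
  simp only [eval_pow, eval_mul]
  exact factorial_formula _

theorem eval_geom (r : ℕ) (q t : ArithTerm k) (hq : 1 < q.eval e) :
    (geom r q t).eval e = geomSum r (q.eval e) (t.eval e) := by
  induction r using Nat.strong_induction_on with
  | _ r ih =>
    have hs : ((List.ofFn fun i : Fin r => num (r.choose i) * geom i q t).map (eval e)).sum
        = ∑ i ∈ Finset.range r, r.choose i * geomSum i (q.eval e) (t.eval e) := by
      rw [List.map_ofFn, List.sum_ofFn, ← Fin.sum_univ_eq_sum_range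
        (fun i => r.choose i * geomSum i (q.eval e) (t.eval e))]
      exact Finset.sum_congr rfl fun i _ => by
        simp only [Function.comp_apply, eval_mul, eval_num, ih i i.2]
    rw [geom]
    simp only [eval_div, eval_sub, eval_mul, eval_pow, eval_num, eval_ofNat, eval_sum, hs]
    exact geomSum_formula r _ _ hq

end Eval

end ArithTerm

/-! ### Evaluation of exponential polynomials -/

/-- The value of a monomial without its coefficient, at the parameter `n` and the unknowns `v`. -/
def ExpMono.size {m : ℕ} (n : ℕ) (v : Fin m → ℕ) (a : ExpMono m) : ℕ :=
  n ^ a.pdeg * 2 ^ (a.pexp * n) * ∏ i, v i ^ a.deg i * (2 ^ a.exp i) ^ v i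

theorem ExpMono.size_mul {m : ℕ} (n : ℕ) (v : Fin m → ℕ) (a b : ExpMono m) :
    (a.mul b).size n v = a.size n v * b.size n v := by
  have h : ∏ i, v i ^ (a.deg i + b.deg i) * (2 ^ (a.exp i + b.exp i)) ^ v i
      = (∏ i, v i ^ a.deg i * (2 ^ a.exp i) ^ v i) * ∏ i, v i ^ b.deg i * (2 ^ b.exp i) ^ v i := by
    rw [← Finset.prod_mul_distrib]
    exact Finset.prod_congr rfl fun i _ => by rw [pow_add, pow_add, mul_pow]; ring
  simp only [ExpMono.size, ExpMono.mul, Pi.add_apply, h]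
  ring

theorem ExpMono.Like.size_eq {m : ℕ} (n : ℕ) (v : Fin m → ℕ) {a b : ExpMono m} (h : a.Like b) :
    a.size n v = b.size n v := by
  obtain ⟨h1, h2, h3, h4⟩ := h
  simp only [ExpMono.size, h1, h2, h3, h4]

theorem ExpMono.Free.size_eq {m : ℕ} (n : ℕ) (v : Fin m → ℕ) {a : ExpMono m} (h : a.Free) :
    a.size n v = n ^ a.pdeg * 2 ^ (a.pexp * n) := by
  simp [ExpMono.size, h.1, h.2]

namespace ExpPoly

/-- The sum of the monomials of `P`, their coefficients being mapped along `f`. The identity of `ℤ`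
gives the value of `P`, the absolute value gives an upper bound that is compatible with products. -/
def evalWith {m : ℕ} {R : Type*} [CommSemiring R] (f : ℤ →* R) (n : ℕ) (v : Fin m → ℕ)
    (P : ExpPoly m) : R :=
  (List.map (fun a : ExpMono m => f a.coeff * (a.size n v : R)) P).sum

section EvalWith

variable {m : ℕ} {R : Type*} [CommSemiring R] (f : ℤ →* R) (n : ℕ) (v : Fin m → ℕ)

theorem evalWith_add (P Q : ExpPoly m) :
    evalWith f n v (P + Q) = evalWith f n v P + evalWith f n v Q := by
  have h (P Q : List (ExpMono m)) : ((P ++ Q).map fun a => f a.coeff * (a.size n v : R)).sum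
      = (P.map fun a => f a.coeff * (a.size n v : R)).sum
        + (Q.map fun a => f a.coeff * (a.size n v : R)).sum := by
    rw [List.map_append, List.sum_append]
  exact h P Q

theorem evalWith_mul (P Q : ExpPoly m) :
    evalWith f n v (P * Q) = evalWith f n v P * evalWith f n v Q := by
  have h (P Q : List (ExpMono m)) :
      ((P.flatMap fun a => Q.map a.mul).map fun a => f a.coeff * (a.size n v : R)).sum
      = (P.map fun a => f a.coeff * (a.size n v : R)).sum
        * (Q.map fun a => f a.coeff * (a.size n v : R)).sum := by
    induction P with
    | nil => simp
    | cons a l ih =>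
      rw [List.flatMap_cons, List.map_append, List.sum_append, ih, List.map_cons, List.sum_cons,
        add_mul, List.map_map]
      refine congrArg₂ _ ?_ rfl
      rw [← List.sum_map_mul_left]
      congr 2
      funext b
      simp only [Function.comp_apply, ExpMono.size_mul]
      simp only [ExpMono.mul, map_mul]
      push_cast
      ring
  exact h P Q

theorem evalWith_const (c : ℤ) : evalWith f n v (const c) = f c := by
  simp [evalWith, const, ExpMono.size]

theorem evalWith_pow (P : ExpPoly m) (j : ℕ) : evalWith f n v (P ^ j) = evalWith f n v P ^ j := by
  induction j with
  | zero =>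
    change evalWith f n v (const 1) = _
    rw [evalWith_const, map_one, pow_zero]
  | succ j ih =>
    change evalWith f n v (P ^ j * P) = _
    rw [evalWith_mul, ih, pow_succ]

theorem evalWith_neg (P : ExpPoly m) : evalWith f n v (-P) = f (-1) * evalWith f n v P := by
  change evalWith f n v (const (-1) * P) = _
  rw [evalWith_mul, evalWith_const]

theorem evalWith_param : evalWith f n v (param : ExpPoly m) = n := by
  simp [evalWith, param, ExpMono.size]

theorem evalWith_twoPowParam : evalWith f n v (twoPowParam : ExpPoly m) = 2 ^ n := by
  simp [evalWith, twoPowParam, ExpMono.size]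

theorem evalWith_X (i : Fin m) : evalWith f n v (X i : ExpPoly m) = v i := by
  have h : ∏ j, v j ^ (Pi.single i 1 : Fin m → ℕ) j = v i := by
    rw [Finset.prod_eq_single i]
    · simp
    · intro j _ hj; simp [Pi.single_eq_of_ne hj]
    · simp
  simp [evalWith, X, ExpMono.size, ← h]

theorem evalWith_twoPow (c : ℕ) (l : List (ℕ × Fin m)) :
    evalWith f n v (twoPow c l)
      = f (2 ^ c) * ((2 ^ (l.map fun s => s.1 * v s.2).sum : ℕ) : R) := by
  have h : ∏ j, (2 ^ (l.map fun s => (Pi.single s.2 s.1 : Fin m → ℕ)).sum j) ^ v j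
      = 2 ^ (l.map fun s => s.1 * v s.2).sum := by
    induction l with
    | nil => simp
    | cons s l ih =>
      simp only [List.map_cons, List.sum_cons, Pi.add_apply, pow_add, mul_pow,
        Finset.prod_mul_distrib, ih]
      congr 1
      rw [Finset.prod_eq_single s.2]
      · rw [Pi.single_eq_same, pow_mul]
      · intro j _ hj; simp [Pi.single_eq_of_ne hj]
      · simp
  simp [evalWith, twoPow, ExpMono.size, ← h]

end EvalWith

section Val

variable {m : ℕ} (n : ℕ) (v : Fin m → ℕ)

/-- The value of an exponential polynomial. -/
def val (P : ExpPoly m) : ℤ := evalWith (MonoidHom.id ℤ) n v P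

/-- The value of an exponential polynomial after its coefficients are replaced with their absolute
values. -/
def absVal (P : ExpPoly m) : ℕ := evalWith (Int.natAbsHom : ℤ →* ℕ) n v P

variable (P Q : ExpPoly m)

theorem val_eq_sum : P.val n v = (List.map (fun a : ExpMono m => a.coeff * (a.size n v : ℤ)) P).sum :=
  rfl

theorem absVal_eq_sum :
    P.absVal n v = (List.map (fun a : ExpMono m => a.coeff.natAbs * a.size n v) P).sum := rfl

@[simp] theorem val_add : (P + Q).val n v = P.val n v + Q.val n v := evalWith_add _ _ _ _ _
@[simp] theorem val_mul : (P * Q).val n v = P.val n v * Q.val n v := evalWith_mul _ _ _ _ _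
@[simp] theorem val_pow (j : ℕ) : (P ^ j).val n v = P.val n v ^ j := evalWith_pow _ _ _ _ _
@[simp] theorem val_neg : (-P).val n v = -P.val n v := by
  rw [val, evalWith_neg, MonoidHom.id_apply, neg_one_mul, val]
@[simp] theorem val_sub : (P - Q).val n v = P.val n v - Q.val n v := by
  rw [sub_eq_add_neg, ← val_neg, ← val_add]; rfl
@[simp] theorem val_const (c : ℤ) : (const c : ExpPoly m).val n v = c := evalWith_const _ _ _ _
@[simp] theorem val_ofNat (c : ℕ) : (no_index (OfNat.ofNat c) : ExpPoly m).val n v = (c : ℤ) :=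
  evalWith_const _ _ _ _
@[simp] theorem val_param : (param : ExpPoly m).val n v = n := evalWith_param _ _ _
@[simp] theorem val_twoPowParam : (twoPowParam : ExpPoly m).val n v = 2 ^ n :=
  evalWith_twoPowParam _ _ _
@[simp] theorem val_X (i : Fin m) : (X i : ExpPoly m).val n v = v i := evalWith_X _ _ _ _
@[simp] theorem val_twoPow (c : ℕ) (l : List (ℕ × Fin m)) :
    (twoPow c l : ExpPoly m).val n v = 2 ^ (c + (l.map fun s => s.1 * v s.2).sum) := by
  rw [val, evalWith_twoPow, MonoidHom.id_apply, pow_add]; push_cast; rfl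

@[simp] theorem absVal_add : (P + Q).absVal n v = P.absVal n v + Q.absVal n v :=
  evalWith_add _ _ _ _ _
@[simp] theorem absVal_mul : (P * Q).absVal n v = P.absVal n v * Q.absVal n v :=
  evalWith_mul _ _ _ _ _
@[simp] theorem absVal_pow (j : ℕ) : (P ^ j).absVal n v = P.absVal n v ^ j := evalWith_pow _ _ _ _ _
@[simp] theorem absVal_neg : (-P).absVal n v = P.absVal n v := by
  rw [absVal, evalWith_neg]; exact one_mul _
@[simp] theorem absVal_sub : (P - Q).absVal n v = P.absVal n v + Q.absVal n v := by
  rw [← absVal_neg n v Q, ← absVal_add]; rfl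
@[simp] theorem absVal_const (c : ℤ) : (const c : ExpPoly m).absVal n v = c.natAbs :=
  evalWith_const _ _ _ _
@[simp] theorem absVal_ofNat (c : ℕ) : (no_index (OfNat.ofNat c) : ExpPoly m).absVal n v = c :=
  evalWith_const _ _ _ _
@[simp] theorem absVal_param : (param : ExpPoly m).absVal n v = n := evalWith_param _ _ _
@[simp] theorem absVal_twoPowParam : (twoPowParam : ExpPoly m).absVal n v = 2 ^ n :=
  evalWith_twoPowParam _ _ _
@[simp] theorem absVal_X (i : Fin m) : (X i : ExpPoly m).absVal n v = v i := evalWith_X _ _ _ _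
@[simp] theorem absVal_twoPow (c : ℕ) (l : List (ℕ × Fin m)) :
    (twoPow c l : ExpPoly m).absVal n v = 2 ^ (c + (l.map fun s => s.1 * v s.2).sum) := by
  rw [absVal, evalWith_twoPow, pow_add]
  exact congrArg (· * _) (Int.natAbs_pow 2 c)

theorem abs_val_le : |P.val n v| ≤ P.absVal n v := by
  rw [val_eq_sum, absVal_eq_sum]
  induction (P : List (ExpMono m)) with
  | nil => simp
  | cons a l ih =>
    rw [List.map_cons, List.map_cons, List.sum_cons, List.sum_cons, Nat.cast_add]
    refine (abs_add_le _ _).trans (add_le_add (le_of_eq ?_) ih)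
    rw [abs_mul, Nat.cast_mul, Int.natCast_natAbs, Nat.abs_cast]

theorem val_insertMono (a : ExpMono m) (l : List (ExpMono m)) :
    ((insertMono a l).map fun a => a.coeff * (a.size n v : ℤ)).sum
      = a.coeff * (a.size n v : ℤ) + (l.map fun a => a.coeff * (a.size n v : ℤ)).sum := by
  induction l with
  | nil => rfl
  | cons b l ih =>
    rw [insertMono]
    split_ifs with h
    · have hb : ExpMono.size n v { b with coeff := a.coeff + b.coeff } = b.size n v := rfl
      simp only [List.map_cons, List.sum_cons, hb, h.size_eq n v]
      ring
    · simp only [List.map_cons, List.sum_cons, ih]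
      ring

theorem absVal_insertMono_le (a : ExpMono m) (l : List (ExpMono m)) :
    ((insertMono a l).map fun a => a.coeff.natAbs * a.size n v).sum
      ≤ a.coeff.natAbs * a.size n v + (l.map fun a => a.coeff.natAbs * a.size n v).sum := by
  induction l with
  | nil => exact le_rfl
  | cons b l ih =>
    rw [insertMono]
    split_ifs with h
    · have hb : ExpMono.size n v { b with coeff := a.coeff + b.coeff } = b.size n v := rfl
      simp only [List.map_cons, List.sum_cons, hb, h.size_eq n v]
      have := Nat.mul_le_mul_right (b.size n v) (Int.natAbs_add_le a.coeff b.coeff)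
      linarith
    · simp only [List.map_cons, List.sum_cons]
      linarith

theorem val_collect : (collect P).val n v = P.val n v := by
  have h1 : ∀ l : List (ExpMono m), ((l.filter fun a => a.coeff ≠ 0).map
      fun a => a.coeff * (a.size n v : ℤ)).sum = (l.map fun a => a.coeff * (a.size n v : ℤ)).sum := by
    intro l
    induction l with
    | nil => rfl
    | cons a l ih =>
      rw [List.filter_cons]
      by_cases h : a.coeff = 0 <;> simp_all
  rw [val_eq_sum, val_eq_sum]
  refine (h1 _).trans ?_
  induction (P : List (ExpMono m)) with
  | nil => rfl
  | cons a l ih => rw [List.foldr_cons, val_insertMono, ih, List.map_cons, List.sum_cons]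

theorem absVal_collect_le : (collect P).absVal n v ≤ P.absVal n v := by
  have h1 : ∀ l : List (ExpMono m), ((l.filter fun a => a.coeff ≠ 0).map
      fun a => a.coeff.natAbs * a.size n v).sum = (l.map fun a => a.coeff.natAbs * a.size n v).sum := by
    intro l
    induction l with
    | nil => rfl
    | cons a l ih =>
      rw [List.filter_cons]
      by_cases h : a.coeff = 0 <;> simp_all
  rw [absVal_eq_sum, absVal_eq_sum]
  refine (h1 _).le.trans ?_
  induction (P : List (ExpMono m)) with
  | nil => exact le_rfl
  | cons a l ih =>
    rw [List.foldr_cons, List.map_cons, List.sum_cons]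
    exact (absVal_insertMono_le n v _ _).trans (Nat.add_le_add_left ih _)

end Val

end ExpPoly

/-! ### The hypercube method -/

/-- The index of a point of the cube `{0, …, t - 1} ^ m`, with the coordinates as digits to the
base `t`. -/
def cubeIndex {m t : ℕ} (v : Fin m → Fin t) : ℕ := ∑ i, (v i : ℕ) * t ^ (i : ℕ)

theorem sum_cubeIndex {m t : ℕ} {M : Type*} [AddCommMonoid M] (g : ℕ → M) :
    ∑ v : Fin m → Fin t, g (cubeIndex v) = ∑ k ∈ Finset.range (t ^ m), g k := by
  rw [← Fin.sum_univ_eq_sum_range, ← Equiv.sum_comp finFunctionFinEquiv]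
  simp only [finFunctionFinEquiv_apply]
  rfl

/-- The blocks of `2 u` binary digits of `W` are indexed by the points of the cube; the block of a
point has digit sum `2 u` if `p` vanishes there, and `u` otherwise. -/
theorem digitSum_eq_of_blocks {m t u W : ℕ} (p : (Fin m → Fin t) → ℤ)
    (hp0 : ∀ v, 0 ≤ p v) (hp : ∀ v, p v ≤ 2 ^ u)
    (hW : (W : ℤ) = ∑ v, 2 ^ (2 * u * cubeIndex v) * ((2 ^ u - 1) * (2 ^ u + 1 - p v))) :
    digitSum W = u * (t ^ m + (Finset.univ.filter fun v => p v = 0).card) := by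
  let q : ℕ → ℕ := fun k => if h : k < t ^ m then (p (finFunctionFinEquiv.symm ⟨k, h⟩)).toNat else 0
  have hq : ∀ v, q (cubeIndex v) = (p v).toNat := by
    intro v
    have h1 : cubeIndex v = (finFunctionFinEquiv v : ℕ) := (finFunctionFinEquiv_apply v).symm
    have h2 : cubeIndex v < t ^ m := h1 ▸ (finFunctionFinEquiv v).2
    have h3 : (⟨cubeIndex v, h2⟩ : Fin (t ^ m)) = finFunctionFinEquiv v := Fin.ext h1
    simp only [q, dif_pos h2, h3, Equiv.symm_apply_apply]
  have hq' : ∀ v, (q (cubeIndex v) : ℤ) = p v := fun v => by rw [hq, Int.toNat_of_nonneg (hp0 v)]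
  have hqu : ∀ k, q k ≤ 2 ^ u := by
    intro k
    simp only [q]
    split_ifs with h
    · have := hp (finFunctionFinEquiv.symm ⟨k, h⟩)
      zify
      rw [Int.toNat_of_nonneg (hp0 _)]
      exact this
    · exact Nat.zero_le _
  have h1u : 1 ≤ 2 ^ u := Nat.one_le_two_pow
  have hWn : W = ∑ k ∈ Finset.range (t ^ m), 2 ^ (2 * u * k) * ((2 ^ u - 1) * (2 ^ u + 1 - q k)) := by
    rw [← sum_cubeIndex (fun k => 2 ^ (2 * u * k) * ((2 ^ u - 1) * (2 ^ u + 1 - q k)))]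
    zify
    rw [hW]
    refine Finset.sum_congr rfl fun v _ => ?_
    rw [Nat.cast_sub h1u, Nat.cast_sub ((hqu _).trans (Nat.le_succ _)), hq']
    push_cast
    ring
  have hblock : ∀ k, (2 ^ u - 1) * (2 ^ u + 1 - q k) < 2 ^ (2 * u) := by
    intro k
    calc (2 ^ u - 1) * (2 ^ u + 1 - q k) ≤ (2 ^ u - 1) * (2 ^ u + 1) :=
          Nat.mul_le_mul_left _ (Nat.sub_le _ _)
      _ < 2 ^ (2 * u) := by
        rw [two_mul u, pow_add]
        obtain ⟨z, hz⟩ := Nat.exists_eq_add_of_le h1u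
        rw [hz, Nat.add_sub_cancel_left]
        nlinarith
  have hdig : ∀ k, digitSum ((2 ^ u - 1) * (2 ^ u + 1 - q k)) = u + if q k = 0 then u else 0 := by
    intro k
    split_ifs with h
    · have : (2 ^ u - 1) * (2 ^ u + 1 - q k) = 2 ^ (u + u) - 1 := by
        rw [h, pow_add]
        obtain ⟨z, hz⟩ := Nat.exists_eq_add_of_le h1u
        rw [hz, Nat.add_sub_cancel_left, Nat.sub_zero]
        have : (1 + z) * (1 + z) = z * (1 + z + 1) + 1 := by ring
        omega
      rw [this, digitSum_two_pow_sub_one]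
    · have := hqu k
      exact digitSum_two_pow_sub_one_mul _ _ (by omega) (by omega)
  rw [hWn, digitSum_sum_blocks _ _ _ fun k _ => hblock k]
  simp only [hdig]
  rw [← sum_cubeIndex (m := m) (t := t) (fun k => u + if q k = 0 then u else 0),
    Finset.sum_add_distrib, Finset.card_filter, mul_add, Finset.mul_sum]
  congr 1
  · simp [mul_comm]
  · refine Finset.sum_congr rfl fun v _ => ?_
    have : q (cubeIndex v) = 0 ↔ p v = 0 := by rw [← hq' v]; exact Nat.cast_eq_zero.symm
    simp only [this, mul_ite, mul_one, mul_zero]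

namespace ExpMono

theorem size_zero_of_free {m : ℕ} (n : ℕ) {a : ExpMono m} (h : a.Free) :
    a.size n 0 = n ^ a.pdeg * 2 ^ (a.pexp * n) := h.size_eq n 0

/-- A product of generalized geometric progressions is a sum over the points of the cube. -/
theorem prod_geomSum {m : ℕ} (n t u : ℕ) (a : ExpMono m) :
    n ^ a.pdeg * 2 ^ (a.pexp * n) *
        ∏ i : Fin m, geomSum (a.deg i) (2 ^ (2 * u * t ^ (i : ℕ)) * 2 ^ a.exp i) t
      = ∑ v : Fin m → Fin t, 2 ^ (2 * u * cubeIndex v) * a.size n fun i => v i := by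
  have h : ∀ i : Fin m, geomSum (a.deg i) (2 ^ (2 * u * t ^ (i : ℕ)) * 2 ^ a.exp i) t
      = ∑ j : Fin t, (j : ℕ) ^ a.deg i * (2 ^ (2 * u * t ^ (i : ℕ)) * 2 ^ a.exp i) ^ (j : ℕ) :=
    fun i => (Fin.sum_univ_eq_sum_range
      (fun j => j ^ a.deg i * (2 ^ (2 * u * t ^ (i : ℕ)) * 2 ^ a.exp i) ^ j) t).symm
  simp only [h, Finset.prod_univ_sum, Fintype.piFinset_univ, Finset.mul_sum]
  refine Finset.sum_congr rfl fun v _ => ?_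
  have h2 : 2 ^ (2 * u * cubeIndex v) = ∏ i : Fin m, (2 ^ (2 * u * t ^ (i : ℕ))) ^ (v i : ℕ) := by
    simp only [← pow_mul, Finset.prod_pow_eq_pow_sum, cubeIndex, Finset.mul_sum]
    congr 1
    exact Finset.sum_congr rfl fun i _ => by ring
  rw [h2, size, mul_left_comm, ← Finset.prod_mul_distrib]
  congr 1
  exact Finset.prod_congr rfl fun i _ => by rw [mul_pow]; ring

end ExpMono

/-- Splitting a sum of integers according to sign: the terms of the theory have no negative values, so
the positive and the negative summands are added up separately. -/
theorem sum_filter_pos_sub_neg {α : Type*} (p : α → Prop) [DecidablePred p] (c : α → ℤ) (h : α → ℕ)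
    (l : List α) :
    (((l.filter fun a => p a ∧ 0 < c a).map fun a => (c a).natAbs * h a).sum : ℤ)
      - ((l.filter fun a => p a ∧ c a < 0).map fun a => (c a).natAbs * h a).sum
      = ((l.filter p).map fun a => c a * (h a : ℤ)).sum := by
  induction l with
  | nil => simp
  | cons a l ih =>
    simp only [List.filter_cons]
    by_cases hp : p a
    · rcases lt_trichotomy (c a) 0 with hc | hc | hc
      · have h1 : ¬ 0 < c a := by omega
        have h2 : ((c a).natAbs : ℤ) = -c a := by omega
        simp only [hp, hc, h1, and_false, and_true, decide_true, decide_false, if_true,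
          List.map_cons, List.sum_cons, Bool.false_eq_true, if_false] at ih ⊢
        push_cast [h2] at ih ⊢
        linarith
      · simp [hp, hc] at ih ⊢
        linarith
      · have h1 : ¬ c a < 0 := by omega
        have h2 : ((c a).natAbs : ℤ) = c a := by omega
        simp only [hp, hc, h1, and_false, and_true, decide_true, decide_false, if_true,
          List.map_cons, List.sum_cons, Bool.false_eq_true, if_false] at ih ⊢
        push_cast [h2] at ih ⊢
        linarith
    · simp [hp] at ih ⊢
      linarith

theorem list_sum_filter_add_sum_filter_not {α M : Type*} [AddCommMonoid M] (p : α → Prop)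
    [DecidablePred p] (g : α → M) (l : List α) :
    ((l.filter p).map g).sum + ((l.filter fun a => ¬ p a).map g).sum = (l.map g).sum := by
  induction l with
  | nil => simp
  | cons a l ih =>
    simp only [List.filter_cons]
    by_cases hp : p a
    · simp only [hp, decide_true, if_true, List.map_cons, List.sum_cons, not_true, decide_false,
        Bool.false_eq_true, if_false]
      rw [add_assoc, ih]
    · simp only [hp, decide_true, if_true, List.map_cons, List.sum_cons, not_false_iff, decide_false,
        Bool.false_eq_true, if_false]
      rw [add_left_comm, ih]

theorem list_sum_filter_le {α : Type*} (p : α → Bool) (g : α → ℕ) (l : List α) :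
    ((l.filter p).map g).sum ≤ (l.map g).sum := by
  induction l with
  | nil => simp
  | cons a l ih =>
    simp only [List.filter_cons]
    split_ifs <;> simp <;> omega

namespace ArithTerm

variable {k m : ℕ} (e : Fin k → ℕ) (n t u : ArithTerm k)

theorem eval_coeffAbs (a : ExpMono m) :
    (coeffAbs n a).eval e
      = a.coeff.natAbs * (n.eval e ^ a.pdeg * 2 ^ (a.pexp * n.eval e)) := by
  simp [coeffAbs, mul_assoc]

theorem eval_contribAbs (ht : 1 ≤ t.eval e) (hu : 1 ≤ u.eval e) (a : ExpMono m) :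
    (contribAbs n t u a).eval e = a.coeff.natAbs * ((2 ^ u.eval e - 1) *
      ∑ v : Fin m → Fin (t.eval e), 2 ^ (2 * u.eval e * cubeIndex v) *
        a.size (n.eval e) fun i => v i) := by
  have hprod : (prod (List.ofFn fun i : Fin m =>
      geom (a.deg i)
        (2 ^ (2 * u * t ^ (num i : ArithTerm k)) * 2 ^ (num (a.exp i) : ArithTerm k)) t)).eval e
      = ∏ i : Fin m, geomSum (a.deg i)
        (2 ^ (2 * u.eval e * t.eval e ^ (i : ℕ)) * 2 ^ a.exp i) (t.eval e) := by
    rw [eval_prod, List.map_ofFn, List.prod_ofFn]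
    refine Finset.prod_congr rfl fun i _ => ?_
    have hq : (2 ^ (2 * u * t ^ (num i : ArithTerm k)) * 2 ^ (num (a.exp i) : ArithTerm k)
        : ArithTerm k).eval e = 2 ^ (2 * u.eval e * t.eval e ^ (i : ℕ)) * 2 ^ a.exp i := rfl
    rw [Function.comp_apply, eval_geom, hq]
    rw [hq]
    have h1 : 1 < 2 ^ (2 * u.eval e * t.eval e ^ (i : ℕ)) :=
      Nat.one_lt_two_pow (Nat.mul_pos (by omega) (Nat.pow_pos ht)).ne'
    exact h1.trans_le (Nat.le_mul_of_pos_right _ (by positivity))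
  rw [← ExpMono.prod_geomSum, contribAbs, eval_mul, eval_mul, hprod, eval_coeffAbs]
  simp only [eval_sub, eval_pow, eval_ofNat]
  ring

/-- The sum of the coefficients of the free monomials. -/
def freeValue (P : ExpPoly m) (n : ℕ) : ℤ :=
  ((List.filter (fun a : ExpMono m => a.Free) P).map fun a =>
    a.coeff * ((n ^ a.pdeg * 2 ^ (a.pexp * n) : ℕ) : ℤ)).sum

/-- The division is exact, and the truncated subtraction of the positive free coefficients is a true one
since these are bounded by the absolute value of `P` at the origin. -/
theorem eval_freeContrib (P : ExpPoly m) (hfree : P.absVal (n.eval e) 0 ≤ 2 ^ u.eval e + 1) :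
    ((freeContrib P n t u).eval e : ℤ)
      = ∑ v : Fin m → Fin (t.eval e), 2 ^ (2 * u.eval e * cubeIndex v) *
        ((2 ^ u.eval e - 1) * (2 ^ u.eval e + 1 - freeValue P (n.eval e))) := by
  set N := n.eval e
  set T := t.eval e
  set U := u.eval e
  let g : ExpMono m → ℕ := fun a => a.coeff.natAbs * (N ^ a.pdeg * 2 ^ (a.pexp * N))
  have hpos : ((List.filter (fun a : ExpMono m => a.Free ∧ 0 < a.coeff) P).map g).sum
      ≤ P.absVal N 0 := by
    rw [ExpPoly.absVal_eq_sum]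
    refine le_trans (le_of_eq ?_) (list_sum_filter_le (fun a : ExpMono m => a.Free ∧ 0 < a.coeff)
      (fun a : ExpMono m => a.coeff.natAbs * a.size N 0) P)
    refine congrArg List.sum (List.map_congr_left fun a ha => ?_)
    have := (List.mem_filter.1 ha).2
    simp only [decide_eq_true_eq] at this
    simp only [g, ExpMono.size_zero_of_free N this.1]
  have hsum := sum_filter_pos_sub_neg (fun a : ExpMono m => a.Free) (fun a => a.coeff)
    (fun a => N ^ a.pdeg * 2 ^ (a.pexp * N)) P
  change (((List.filter (fun a : ExpMono m => a.Free ∧ 0 < a.coeff) P).map g).sum : ℤ)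
    - ((List.filter (fun a : ExpMono m => a.Free ∧ a.coeff < 0) P).map g).sum
    = freeValue P N at hsum
  set A := ((List.filter (fun a : ExpMono m => a.Free ∧ 0 < a.coeff) P).map g).sum
  set B := ((List.filter (fun a : ExpMono m => a.Free ∧ a.coeff < 0) P).map g).sum
  have heval : (freeContrib P n t u).eval e
      = (2 ^ U + 1 + B - A) * (2 ^ (2 * U * T ^ m) - 1) / (2 ^ U + 1) := by
    have hg : eval e ∘ coeffAbs n = g := funext fun a => eval_coeffAbs e n a
    simp only [freeContrib, eval_div, eval_mul, eval_sub, eval_add, eval_sum, eval_pow, eval_num,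
      List.map_map, hg]
    rfl
  set S := ∑ k ∈ Finset.range (T ^ m), 2 ^ (2 * U * k) with hS
  have hgeom : 2 ^ (2 * U * T ^ m) - 1 = (2 ^ U + 1) * ((2 ^ U - 1) * S) := by
    have h1 : 1 ≤ 2 ^ U := Nat.one_le_two_pow
    have h2 := geom_sum_mul_add ((2 ^ U) ^ 2 - 1) (T ^ m)
    rw [Nat.sub_add_cancel (Nat.one_le_pow _ _ h1)] at h2
    have h3 : (2 ^ U) ^ 2 - 1 = (2 ^ U + 1) * (2 ^ U - 1) := Nat.sq_sub_sq (2 ^ U) 1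
    have h4 : ∀ j, ((2 ^ U) ^ 2) ^ j = 2 ^ (2 * U * j) := fun j => by
      rw [← pow_mul, ← pow_mul]; congr 1; ring
    simp only [h4] at h2
    rw [← h2, Nat.add_sub_cancel, h3, ← hS]
    ring
  rw [heval, hgeom, mul_left_comm, Nat.mul_div_cancel_left _ (Nat.succ_pos _),
    sum_cubeIndex (fun k => (2 : ℤ) ^ (2 * U * k) *
      ((2 ^ U - 1) * (2 ^ U + 1 - freeValue P N))), ← Finset.sum_mul, Nat.cast_mul,
    Nat.cast_sub (by omega), Nat.cast_mul, Nat.cast_sub Nat.one_le_two_pow, ← hsum, hS]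
  push_cast
  ring

/-- The hypercube term has, at the position of each point of the cube, the block
`(2 ^ u - 1) * (2 ^ u + 1 - P)`. -/
theorem eval_hypercube (P : ExpPoly m) (ht : 1 ≤ t.eval e) (hu : 1 ≤ u.eval e)
    (hfree : P.absVal (n.eval e) 0 ≤ 2 ^ u.eval e + 1)
    (hP : ∀ v : Fin m → Fin (t.eval e), P.val (n.eval e) (fun i => v i) ≤ 2 ^ u.eval e) :
    ((hypercube P n t u).eval e : ℤ)
      = ∑ v : Fin m → Fin (t.eval e), 2 ^ (2 * u.eval e * cubeIndex v) *
        ((2 ^ u.eval e - 1) * (2 ^ u.eval e + 1 - P.val (n.eval e) fun i => v i)) := by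
  have hF := eval_freeContrib e n t u P hfree
  set N := n.eval e
  set T := t.eval e
  set U := u.eval e
  let h : ExpMono m → ℕ := fun a => (2 ^ U - 1) *
      ∑ v : Fin m → Fin T, 2 ^ (2 * U * cubeIndex v) * a.size N fun i => v i
  have hg : eval e ∘ contribAbs n t u = fun a : ExpMono m => a.coeff.natAbs * h a :=
    funext fun a => eval_contribAbs e n t u ht hu a
  have heval : (hypercube P n t u).eval e = (freeContrib P n t u).eval e
      + ((List.filter (fun a : ExpMono m => ¬ a.Free ∧ a.coeff < 0) P).map
          fun a => a.coeff.natAbs * h a).sum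
      - ((List.filter (fun a : ExpMono m => ¬ a.Free ∧ 0 < a.coeff) P).map
          fun a => a.coeff.natAbs * h a).sum := by
    simp only [hypercube, eval_sub, eval_add, eval_sum, List.map_map, hg]
  have hsum := sum_filter_pos_sub_neg (fun a : ExpMono m => ¬ a.Free) (fun a => a.coeff) h P
  set A := ((List.filter (fun a : ExpMono m => ¬ a.Free ∧ 0 < a.coeff) P).map
          fun a => a.coeff.natAbs * h a).sum
  set B := ((List.filter (fun a : ExpMono m => ¬ a.Free ∧ a.coeff < 0) P).map
          fun a => a.coeff.natAbs * h a).sum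
  have hval : ∀ v : Fin m → Fin T, P.val N (fun i => v i) = freeValue P N
      + ((List.filter (fun a : ExpMono m => ¬ a.Free) P).map
          fun a => a.coeff * (a.size N (fun i => v i) : ℤ)).sum := by
    intro v
    rw [ExpPoly.val_eq_sum]
    refine (list_sum_filter_add_sum_filter_not (fun a : ExpMono m => a.Free) _ _).symm.trans ?_
    refine congrArg₂ _ (congrArg List.sum (List.map_congr_left fun a ha => ?_)) rfl
    have := (List.mem_filter.1 ha).2
    simp only [decide_eq_true_eq] at this
    rw [this.size_eq]
  have hnf : ((List.filter (fun a : ExpMono m => ¬ a.Free) P).map fun a => a.coeff * (h a : ℤ)).sum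
      = ∑ v : Fin m → Fin T, 2 ^ (2 * U * cubeIndex v) * ((2 ^ U - 1) *
        ((List.filter (fun a : ExpMono m => ¬ a.Free) P).map
          fun a => a.coeff * (a.size N (fun i => v i) : ℤ)).sum) := by
    induction List.filter (fun a : ExpMono m => ¬ a.Free) P with
    | nil => simp
    | cons a l ih =>
      simp only [List.map_cons, List.sum_cons, mul_add, Finset.sum_add_distrib, ih]
      refine congrArg₂ _ ?_ rfl
      simp only [h]
      rw [Nat.cast_mul, Nat.cast_sub Nat.one_le_two_pow]
      push_cast
      rw [Finset.mul_sum, Finset.mul_sum]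
      exact Finset.sum_congr rfl fun v _ => by ring
  rw [hnf] at hsum
  have htotal : ((freeContrib P n t u).eval e : ℤ) + B - A
      = ∑ v : Fin m → Fin T, 2 ^ (2 * U * cubeIndex v) *
        ((2 ^ U - 1) * (2 ^ U + 1 - P.val N fun i => v i)) := by
    have : ((freeContrib P n t u).eval e : ℤ) + B - A
      = (freeContrib P n t u).eval e - (A - B : ℤ) := by ring
    rw [this, hsum, hF, ← Finset.sum_sub_distrib]
    exact Finset.sum_congr rfl fun v _ => by rw [hval v]; ring
  have hnonneg : 0 ≤ ((freeContrib P n t u).eval e : ℤ) + B - A := by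
    rw [htotal]
    refine Finset.sum_nonneg fun v _ => mul_nonneg (by positivity) (mul_nonneg ?_ ?_)
    · have : (1 : ℤ) ≤ 2 ^ U := one_le_pow₀ (by norm_num)
      linarith
    · have := hP v
      linarith
  rw [heval, ← htotal, Nat.cast_sub (by omega), Nat.cast_add]

/-- The digit sum of the hypercube term determines the number of zeros of `P` in the cube. -/
theorem digitSum_eval_hypercube (P : ExpPoly m) (ht : 1 ≤ t.eval e) (hu : 1 ≤ u.eval e)
    (hfree : P.absVal (n.eval e) 0 ≤ 2 ^ u.eval e + 1)
    (hP0 : ∀ v : Fin m → Fin (t.eval e), 0 ≤ P.val (n.eval e) fun i => v i)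
    (hP : ∀ v : Fin m → Fin (t.eval e), P.val (n.eval e) (fun i => v i) ≤ 2 ^ u.eval e) :
    digitSum ((hypercube P n t u).eval e) = u.eval e * (t.eval e ^ m +
      (Finset.univ.filter fun v : Fin m → Fin (t.eval e) =>
        P.val (n.eval e) (fun i => v i) = 0).card) :=
  digitSum_eq_of_blocks (fun v : Fin m → Fin (t.eval e) => P.val (n.eval e) fun i => v i) hP0 hP
    (eval_hypercube e n t u P ht hu hfree hP)

/-- The hypercube method: a polynomial that takes values between `0` and `2 ^ u` on the cube of side `t`
has its zeros there counted by an arithmetic term. The bound `hfree` concerns the coefficients of the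
free monomials only. -/
theorem eval_countZeros (P : ExpPoly m) (ht : 1 ≤ t.eval e) (hu : 1 ≤ u.eval e)
    (hfree : P.absVal (n.eval e) 0 ≤ 2 ^ u.eval e + 1)
    (hP0 : ∀ v : Fin m → Fin (t.eval e), 0 ≤ P.val (n.eval e) fun i => v i)
    (hP : ∀ v : Fin m → Fin (t.eval e), P.val (n.eval e) (fun i => v i) ≤ 2 ^ u.eval e) :
    (countZeros P n t u).eval e = (Finset.univ.filter fun v : Fin m → Fin (t.eval e) =>
        P.val (n.eval e) (fun i => v i) = 0).card := by
  rw [countZeros, eval_sub, eval_div, eval_hw, digitSum_eval_hypercube e n t u P ht hu hfree hP0 hP,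
    Nat.mul_div_cancel_left _ (by omega), eval_pow, eval_num, Nat.add_sub_cancel_left]

end ArithTerm

/-! ### Square roots of unity modulo `n` -/

/-- The number of square roots of unity modulo `n`. -/
noncomputable def sqrtOneCount (n : ℕ) : ℕ := Nat.card {y : ZMod n // y ^ 2 = 1}

theorem sqrtOneCount_mul {m n : ℕ} (h : m.Coprime n) :
    sqrtOneCount (m * n) = sqrtOneCount m * sqrtOneCount n := by
  unfold sqrtOneCount
  rw [← Nat.card_prod]
  refine Nat.card_congr (Equiv.trans ?_ Equiv.subtypeProdEquivProd)
  refine (ZMod.chineseRemainder h).toEquiv.subtypeEquiv fun y => ?_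
  rw [← (ZMod.chineseRemainder h).injective.eq_iff, map_pow, map_one, Prod.ext_iff]
  rfl

theorem intCast_sq_eq_one_iff (n : ℕ) (x : ℤ) :
    ((x : ZMod n) ^ 2 = 1) ↔ (n : ℤ) ∣ (x - 1) * (x + 1) := by
  have h : (x : ZMod n) ^ 2 = 1 ↔ (((x - 1) * (x + 1) : ℤ) : ZMod n) = 0 := by
    rw [← sub_eq_zero]; push_cast; ring_nf
  rw [h, ZMod.intCast_zmod_eq_zero_iff_dvd]

theorem intCast_ne_intCast_of_abs_lt {n : ℕ} {x y : ℤ} (h : x ≠ y) (hlt : |x - y| < n) :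
    (x : ZMod n) ≠ y := by
  intro he
  rw [ZMod.intCast_eq_intCast_iff_dvd_sub] at he
  have := Int.eq_zero_of_abs_lt_dvd he (by rwa [abs_sub_comm])
  omega

theorem sqrtOneCount_eq_card {n : ℕ} (s : Finset (ZMod n)) (h : ∀ y, y ∈ s ↔ y ^ 2 = 1) :
    sqrtOneCount n = s.card := by
  rw [sqrtOneCount, Nat.card_congr (Equiv.subtypeEquivRight fun y => (h y).symm)]
  simp

theorem sqrtOneCount_odd_prime_pow {p k : ℕ} (hp : p.Prime) (h2 : p ≠ 2) (hk : 0 < k) :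
    sqrtOneCount (p ^ k) = 2 := by
  have hp3 : 2 < p := lt_of_le_of_ne hp.two_le (Ne.symm h2)
  have hlt : 2 < p ^ k := hp3.trans_le (Nat.le_self_pow hk.ne' p)
  rw [sqrtOneCount_eq_card {((1 : ℤ) : ZMod (p ^ k)), ((-1 : ℤ) : ZMod (p ^ k))}]
  · refine Finset.card_pair (intCast_ne_intCast_of_abs_lt (by norm_num) ?_)
    norm_num
    exact_mod_cast hlt
  · intro y
    obtain ⟨x, rfl⟩ := ZMod.intCast_surjective y
    rw [intCast_sq_eq_one_iff, Finset.mem_insert, Finset.mem_singleton,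
      ZMod.intCast_eq_intCast_iff_dvd_sub, ZMod.intCast_eq_intCast_iff_dvd_sub,
      ← dvd_neg, neg_sub, ← dvd_neg (b := -1 - x), show -(-1 - x) = x + 1 by ring]
    constructor
    · rintro (h | h)
      · exact h.mul_right _
      · exact h.mul_left _
    · intro h
      have hpi : Prime (p : ℤ) := Nat.prime_iff_prime_int.1 hp
      push_cast at h ⊢
      by_cases hd : (p : ℤ) ∣ x - 1
      · refine Or.inl (hpi.pow_dvd_of_dvd_mul_right k (fun hd' => ?_) h)
        have h3 : (p : ℤ) ∣ 2 := by
          have := dvd_sub hd' hd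
          rwa [show x + 1 - (x - 1) = 2 by ring] at this
        have := Int.le_of_dvd (by norm_num) h3
        omega
      · exact Or.inr (hpi.pow_dvd_of_dvd_mul_left k hd h)

theorem sqrtOneCount_four : sqrtOneCount 4 = 2 := by
  rw [sqrtOneCount_eq_card (n := 4) {1, 3} (by decide)]
  decide

/-- For `k ≥ 3` the square roots of unity modulo `2 ^ k` are `± 1` and `± 1 + 2 ^ (k - 1)`. -/
theorem sqrtOneCount_two_pow (k : ℕ) : sqrtOneCount (2 ^ (k + 3)) = 4 := by
  have hn : ((2 ^ (k + 3) : ℕ) : ℤ) = 8 * 2 ^ k := by push_cast; ring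
  have hj : (1 : ℤ) ≤ 2 ^ k := one_le_pow₀ (by norm_num)
  rw [sqrtOneCount_eq_card {((1 : ℤ) : ZMod (2 ^ (k + 3))), ((-1 : ℤ) : ZMod (2 ^ (k + 3))),
    ((1 + 4 * 2 ^ k : ℤ) : ZMod (2 ^ (k + 3))), ((-1 + 4 * 2 ^ k : ℤ) : ZMod (2 ^ (k + 3)))}]
  · rw [Finset.card_insert_of_notMem, Finset.card_insert_of_notMem, Finset.card_pair]
    · refine intCast_ne_intCast_of_abs_lt ?_ ?_
      · omega
      · rw [hn, abs_lt]; constructor <;> omega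
    · simp only [Finset.mem_insert, Finset.mem_singleton, not_or]
      constructor <;> refine intCast_ne_intCast_of_abs_lt ?_ ?_
      · omega
      · rw [hn, abs_lt]; constructor <;> omega
      · omega
      · rw [hn, abs_lt]; constructor <;> omega
    · simp only [Finset.mem_insert, Finset.mem_singleton, not_or]
      refine ⟨?_, ?_, ?_⟩ <;> refine intCast_ne_intCast_of_abs_lt ?_ ?_
      · omega
      · rw [hn, abs_lt]; constructor <;> omega
      · omega
      · rw [hn, abs_lt]; constructor <;> omega
      · omega
      · rw [hn, abs_lt]; constructor <;> omega
  · intro y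
    obtain ⟨x, rfl⟩ := ZMod.intCast_surjective y
    rw [intCast_sq_eq_one_iff]
    simp only [Finset.mem_insert, Finset.mem_singleton, ZMod.intCast_eq_intCast_iff_dvd_sub, hn]
    constructor
    · generalize (2 : ℤ) ^ k = j at hj
      rintro (h | h | h | h) <;> obtain ⟨c, hc⟩ := h
      · exact Dvd.intro (-c * (x + 1)) (by linear_combination (x + 1) * hc)
      · exact Dvd.intro (-c * (x - 1)) (by linear_combination (x - 1) * hc)
      · obtain rfl : x = 1 + 4 * j - 8 * j * c := by linarith
        exact ⟨(1 - 2 * c) * (1 + 2 * j - 4 * j * c), by ring⟩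
      · obtain rfl : x = -1 + 4 * j - 8 * j * c := by linarith
        exact ⟨(1 - 2 * c) * (-1 + 2 * j - 4 * j * c), by ring⟩
    · rintro ⟨c, hc⟩
      obtain ⟨z, rfl | rfl⟩ := Int.even_or_odd' x
      · exfalso
        have : 2 * (2 * z ^ 2 - 4 * 2 ^ k * c) = 1 := by linear_combination hc
        omega
      have hz : (2 : ℤ) ^ (k + 1) ∣ z * (z + 1) :=
        ⟨c, by have : 4 * (z * (z + 1)) = 4 * (2 ^ (k + 1) * c) := by linear_combination hc
               linarith⟩
      have h2 : Prime (2 : ℤ) := Int.prime_two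
      by_cases hd : (2 : ℤ) ∣ z
      · have hd' : ¬ (2 : ℤ) ∣ z + 1 := by omega
        obtain ⟨d, rfl⟩ := h2.pow_dvd_of_dvd_mul_right _ hd' hz
        obtain ⟨f, rfl | rfl⟩ := Int.even_or_odd' d
        · exact Or.inl ⟨-f, by ring⟩
        · exact Or.inr (Or.inr (Or.inl ⟨-f, by ring⟩))
      · obtain ⟨d, hd⟩ := h2.pow_dvd_of_dvd_mul_left _ hd hz
        obtain rfl : z = 2 ^ (k + 1) * d - 1 := by linarith
        obtain ⟨f, rfl | rfl⟩ := Int.even_or_odd' d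
        · exact Or.inr (Or.inl ⟨-f, by ring⟩)
        · exact Or.inr (Or.inr (Or.inr ⟨-f, by ring⟩))

theorem sqrtOneCount_odd {m : ℕ} (hm : Odd m) : sqrtOneCount m = 2 ^ m.primeFactors.card := by
  induction m using Nat.recOnPosPrimePosCoprime with
  | prime_pow p k hp hk =>
    have h2 : p ≠ 2 := by
      rintro rfl
      exact (Nat.not_odd_iff_even.2 ((even_two).pow_of_ne_zero hk.ne')) hm
    rw [sqrtOneCount_odd_prime_pow hp h2 hk, Nat.primeFactors_prime_pow hk.ne' hp]
    simp
  | zero => exact absurd hm (by decide)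
  | one =>
    rw [sqrtOneCount_eq_card (n := 1) {1} (by decide)]
    simp
  | coprime a b ha hb hab iha ihb =>
    rw [sqrtOneCount_mul hab, iha (Nat.Odd.of_mul_left hm), ihb (Nat.Odd.of_mul_right hm),
      hab.primeFactors_mul, Finset.card_union_of_disjoint hab.disjoint_primeFactors, pow_add]

/-- The factor `4` makes the prime `2` contribute one factor `2` if `a` is odd, and two if `a` is even, so
that the exponent exceeds the number of prime divisors of `a` by one in both cases. -/
theorem sqrtOneCount_four_mul {a : ℕ} (ha : 0 < a) :
    sqrtOneCount (4 * a) = 2 ^ (a.primeFactors.card + 1) := by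
  obtain ⟨e, m, hm, rfl⟩ := Nat.exists_eq_two_pow_mul_odd ha.ne'
  have hcop : ∀ k, (2 ^ k).Coprime m := fun k => (Nat.coprime_two_left.2 hm).pow_left k
  rw [show 4 * (2 ^ e * m) = 2 ^ (e + 2) * m by ring, sqrtOneCount_mul (hcop _), sqrtOneCount_odd hm,
    (hcop e).primeFactors_mul, Finset.card_union_of_disjoint (hcop e).disjoint_primeFactors]
  rcases e with _ | e
  · rw [show 2 ^ (0 + 2) = 4 by norm_num, sqrtOneCount_four]
    simp [pow_succ, mul_comm]
  · rw [show e + 1 + 2 = e + 3 by ring, sqrtOneCount_two_pow,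
      Nat.primeFactors_prime_pow (Nat.succ_ne_zero e) Nat.prime_two]
    simp only [Finset.card_singleton]
    ring

theorem card_primeFactors_factorial (a : ℕ) : a.factorial.primeFactors.card = a.primeCounting := by
  rw [← Nat.primesLE_card_eq_primeCounting]
  congr 1
  ext p
  simp only [Nat.mem_primeFactors, Nat.mem_primesLE]
  constructor
  · rintro ⟨hp, hd, _⟩
    exact ⟨hp.dvd_factorial.1 hd, hp⟩
  · rintro ⟨h, hp⟩
    exact ⟨hp, hp.dvd_factorial.2 h, a.factorial_ne_zero⟩

/-- The solutions of `x ^ 2 = n y + 1` in `{0, …, n} ^ 2` correspond to the square roots of unity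
modulo `n`. -/
theorem card_sq_eq_mul_add_one {n : ℕ} (hn : 2 ≤ n) :
    (Finset.univ.filter fun v : Fin 2 → Fin (n + 1) =>
      (v 0 : ℕ) ^ 2 = n * v 1 + 1).card = sqrtOneCount n := by
  have : NeZero n := ⟨by omega⟩
  rw [sqrtOneCount_eq_card (Finset.univ.filter fun y : ZMod n => y ^ 2 = 1) (by simp)]
  have hlt : ∀ v : Fin 2 → Fin (n + 1), (v 0 : ℕ) ^ 2 = n * v 1 + 1 → (v 0 : ℕ) < n := by
    intro v h
    refine lt_of_le_of_ne (Nat.lt_succ_iff.1 (v 0).2) fun he => ?_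
    rw [he] at h
    have h1 : n ∣ n * v 1 + 1 := h ▸ dvd_pow_self n two_ne_zero
    have := Nat.le_of_dvd one_pos ((Nat.dvd_add_right (dvd_mul_right _ _)).1 h1)
    omega
  refine Finset.card_bij (fun v _ => ((v 0 : ℕ) : ZMod n)) ?_ ?_ ?_
  · intro v hv
    simp only [Finset.mem_filter, Finset.mem_univ, true_and] at hv ⊢
    have : (((v 0 : ℕ) ^ 2 : ℕ) : ZMod n) = 1 := by rw [hv]; simp
    exact_mod_cast this
  · intro v hv w hw h
    simp only [Finset.mem_filter, Finset.mem_univ, true_and] at hv hw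
    have h0 : (v 0 : ℕ) = w 0 := by
      have := (ZMod.natCast_eq_natCast_iff' _ _ _).1 h
      rwa [Nat.mod_eq_of_lt (hlt v hv), Nat.mod_eq_of_lt (hlt w hw)] at this
    have h1 : (v 1 : ℕ) = w 1 := by
      rw [h0] at hv
      exact Nat.eq_of_mul_eq_mul_left (by omega : 0 < n) (by omega)
    funext i
    fin_cases i
    · exact Fin.ext h0
    · exact Fin.ext h1
  · intro y hy
    simp only [Finset.mem_filter, Finset.mem_univ, true_and] at hy
    have hx : ((y.val ^ 2 : ℕ) : ZMod n) = ((1 : ℕ) : ZMod n) := by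
      push_cast; rw [ZMod.natCast_zmod_val, hy]
    have hmod := (ZMod.natCast_eq_natCast_iff' _ _ _).1 hx
    rw [Nat.mod_eq_of_lt (show 1 < n by omega)] at hmod
    have hdiv := Nat.div_add_mod (y.val ^ 2) n
    rw [hmod] at hdiv
    have hyn := ZMod.val_lt y
    have hq : y.val ^ 2 / n < n + 1 := by
      rw [Nat.div_lt_iff_lt_mul (by omega)]
      nlinarith
    refine ⟨![⟨y.val, by omega⟩, ⟨y.val ^ 2 / n, hq⟩], ?_, ?_⟩
    · simp only [Finset.mem_filter, Finset.mem_univ, true_and]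
      exact hdiv.symm
    · simp

theorem sqrtUnityPoly_val (n : ℕ) (v : Fin 2 → ℕ) :
    sqrtUnityPoly.val n v = ((v 0 : ℤ) ^ 2 - n * v 1 - 1) ^ 2 := by
  rw [sqrtUnityPoly, ExpPoly.val_collect]
  simp
  ring

/-- At the origin only the free monomial `1` survives. -/
theorem sqrtUnityPoly_absVal_zero (n : ℕ) : sqrtUnityPoly.absVal n 0 ≤ 1 := by
  refine (ExpPoly.absVal_collect_le _ _ _).trans ?_
  simp

theorem sq_sq_add_one_le_two_pow (n : ℕ) : (n ^ 2 + 1) ^ 2 ≤ 2 ^ (n + 5) := by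
  rcases Nat.lt_or_ge n 6 with h | h
  · interval_cases n <;> norm_num
  · induction n, h using Nat.le_induction with
    | base => norm_num
    | succ n hn ih =>
      rw [show n + 1 + 5 = n + 5 + 1 by ring, pow_succ 2]
      nlinarith

theorem sqrtUnityPoly_val_le {n : ℕ} (v : Fin 2 → Fin (n + 1)) :
    sqrtUnityPoly.val n (fun i => v i) ≤ 2 ^ (n + 5) := by
  rw [sqrtUnityPoly_val]
  refine le_trans ?_ (b := ((n : ℤ) ^ 2 + 1) ^ 2) (by exact_mod_cast sq_sq_add_one_le_two_pow n)
  have h0 : ((v 0 : ℕ) : ℤ) ≤ n := by exact_mod_cast Nat.lt_succ_iff.1 (v 0).2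
  have h1 : ((v 1 : ℕ) : ℤ) ≤ n := by exact_mod_cast Nat.lt_succ_iff.1 (v 1).2
  have h2 : 0 ≤ ((v 0 : ℕ) : ℤ) := Nat.cast_nonneg _
  have h3 : 0 ≤ ((v 1 : ℕ) : ℤ) := Nat.cast_nonneg _
  refine sq_le_sq' ?_ ?_ <;> nlinarith

theorem sqrtUnityPoly_card_zeros {n : ℕ} (hn : 2 ≤ n) :
    (Finset.univ.filter fun v : Fin 2 → Fin (n + 1) =>
      sqrtUnityPoly.val n (fun i => v i) = 0).card = sqrtOneCount n := by
  rw [← card_sq_eq_mul_add_one hn]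
  congr 1
  ext v
  simp only [Finset.mem_filter, Finset.mem_univ, true_and]
  rw [sqrtUnityPoly_val, pow_eq_zero_iff two_ne_zero, sub_sub, sub_eq_zero]
  exact_mod_cast Iff.rfl

namespace ArithTerm

variable {k : ℕ} (e : Fin k → ℕ) (a : ArithTerm k)

theorem eval_sqrtUnityCount (ha : 2 ≤ a.eval e) :
    (sqrtUnityCount a).eval e = sqrtOneCount (a.eval e) := by
  rw [← sqrtUnityPoly_card_zeros ha]
  refine eval_countZeros e a (a + 1) (a + 5) sqrtUnityPoly (Nat.succ_pos _) (Nat.succ_pos _)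
    ((sqrtUnityPoly_absVal_zero _).trans (Nat.succ_pos _)) (fun v => ?_) fun v => ?_
  · rw [sqrtUnityPoly_val]; positivity
  · exact sqrtUnityPoly_val_le v

theorem eval_primePi : (primePi a).eval e = (a.eval e).primeCounting := by
  have hf : (4 * fact a : ArithTerm k).eval e = 4 * (a.eval e).factorial := by
    rw [← eval_fact]; rfl
  have hpos := (a.eval e).factorial_pos
  have hc : (sqrtUnityCount (4 * fact a)).eval e = 2 ^ ((a.eval e).primeCounting + 1) := by
    rw [eval_sqrtUnityCount e _ (by rw [hf]; omega), hf, sqrtOneCount_four_mul hpos,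
      card_primeFactors_factorial]
  rw [primePi, omega, eval_sub, eval_nu2 e _ (by rw [hc]; positivity), hc, padicValNat.prime_pow]
  rfl

end ArithTerm

/-- The value of the hypercube term of `(x_1 ^ 2 - n x_2 - 1) ^ 2` for `t = n + 1` and
`u = n + 5`. The term is taken closed, with numerals for `n`, `t` and `u`, so that it is evaluated at
the empty assignment. -/
def sqrtUnityHypercube (n : ℕ) : ℕ :=
  (ArithTerm.hypercube sqrtUnityPoly (.num n : ArithTerm 0) (.num (n + 1)) (.num (n + 5))).eval
    Fin.elim0

theorem cast_sqrtUnityHypercube (n : ℕ) :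
    (sqrtUnityHypercube n : ℤ) = ∑ v : Fin 2 → Fin (n + 1), 2 ^ (2 * (n + 5) * cubeIndex v) *
      ((2 ^ (n + 5) - 1) * (2 ^ (n + 5) + 1 - (((v 0 : ℕ) : ℤ) ^ 2 - n * (v 1 : ℕ) - 1) ^ 2)) := by
  have h (v : Fin 2 → Fin (n + 1)) :
      (((v 0 : ℕ) : ℤ) ^ 2 - n * (v 1 : ℕ) - 1) ^ 2 = sqrtUnityPoly.val n fun i => v i :=
    (sqrtUnityPoly_val n fun i => (v i : ℕ)).symm
  simp only [h]
  refine ArithTerm.eval_hypercube Fin.elim0 (.num n : ArithTerm 0) (.num (n + 1)) (.num (n + 5))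
    sqrtUnityPoly (Nat.succ_pos _) (Nat.succ_pos _)
    ((sqrtUnityPoly_absVal_zero _).trans (Nat.succ_pos _)) fun v => sqrtUnityPoly_val_le v

/-- The polynomial has `2 ^ (π(a) + 1)` zeros on its cube if `n = 4 a !`. -/
theorem digitSum_sqrtUnityHypercube {a : ℕ} :
    digitSum (sqrtUnityHypercube (4 * a.factorial))
      = (4 * a.factorial + 5) * ((4 * a.factorial + 1) ^ 2 + 2 ^ (a.primeCounting + 1)) := by
  have hpos := a.factorial_pos
  rw [← card_primeFactors_factorial, ← sqrtOneCount_four_mul hpos,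
    ← sqrtUnityPoly_card_zeros (by omega)]
  set n := 4 * a.factorial
  refine ArithTerm.digitSum_eval_hypercube Fin.elim0 (.num n : ArithTerm 0) (.num (n + 1))
    (.num (n + 5)) sqrtUnityPoly (Nat.succ_pos _) (Nat.succ_pos _)
    ((sqrtUnityPoly_absVal_zero _).trans (Nat.succ_pos _)) (fun v => ?_) fun v => ?_
  · rw [sqrtUnityPoly_val]; positivity
  · exact sqrtUnityPoly_val_le v

/-! ### Zeros of the gadgets of the equation for the `n`-th prime -/

theorem sq_eq_zero_iff_natCast_eq {a b : ℕ} : ((a : ℤ) - b) ^ 2 = 0 ↔ a = b := by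
  rw [pow_eq_zero_iff two_ne_zero, sub_eq_zero, Nat.cast_inj]

theorem add_four_eq_zero_iff {p q r s : ℤ} (hp : 0 ≤ p) (hq : 0 ≤ q) (hr : 0 ≤ r) (hs : 0 ≤ s) :
    p + q + r + s = 0 ↔ ((p = 0 ∧ q = 0) ∧ r = 0) ∧ s = 0 := by
  omega

/-- Division with remainder: `X = Y Q + R` and `R + S + 1 = Y`, where `S` witnesses `R < Y`. -/
theorem division_eqs_iff {X Y R S Q : ℕ} :
    ((X : ℤ) - Y * Q - R) ^ 2 + ((R : ℤ) + S + 1 - Y) ^ 2 = 0 ↔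
      0 < Y ∧ Q = X / Y ∧ R = X % Y ∧ S = Y - 1 - X % Y := by
  rw [add_eq_zero_iff_of_nonneg (sq_nonneg _) (sq_nonneg _), pow_eq_zero_iff two_ne_zero,
    pow_eq_zero_iff two_ne_zero]
  constructor
  · rintro ⟨h1, h2⟩
    have h1' : R + Y * Q = X := by zify; linarith
    have h2' : R + S + 1 = Y := by zify; linarith
    have hY : 0 < Y := by omega
    have hR : R < Y := by omega
    have hQ := (Nat.div_mod_unique hY).2 ⟨h1', hR⟩
    exact ⟨hY, hQ.1.symm, hQ.2.symm, by omega⟩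
  · rintro ⟨hY, rfl, rfl, rfl⟩
    have h1 := Nat.mod_add_div X Y
    have h2 := Nat.mod_lt X hY
    constructor
    · have : (X : ℤ) = ((X % Y : ℕ) : ℤ) + Y * ((X / Y : ℕ) : ℤ) := by exact_mod_cast h1.symm
      linarith
    · have : X % Y + (Y - 1 - X % Y) + 1 = Y := by omega
      zify at this ⊢
      linarith

/-- The equations say that `2 ^ (Z + 1)` does not divide `X`, the remainder being `B + 1` and `C`
witnessing that it is less than `2 ^ (Z + 1)`, and that `X = 2 ^ Z D`. They determine all unknowns. -/
theorem two_adic_eqs_iff {X Z A B C D : ℕ} (hX : 0 < X) :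
    ((X : ℤ) - 2 ^ (Z + 1) * A - B - 1) ^ 2 + ((B : ℤ) + C + 2 - 2 ^ (Z + 1)) ^ 2
        + ((X : ℤ) - 2 ^ Z * D) ^ 2 = 0 ↔
      Z = padicValNat 2 X ∧ A = X / 2 ^ (Z + 1) ∧ B = X % 2 ^ (Z + 1) - 1 ∧
        C = 2 ^ (Z + 1) - 1 - X % 2 ^ (Z + 1) ∧ D = X / 2 ^ Z := by
  rw [add_eq_zero_iff_of_nonneg (by positivity) (by positivity),
    add_eq_zero_iff_of_nonneg (by positivity) (by positivity), pow_eq_zero_iff two_ne_zero,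
    pow_eq_zero_iff two_ne_zero, pow_eq_zero_iff two_ne_zero]
  have hZ : 0 < 2 ^ Z := by positivity
  have hZ1 : 0 < 2 ^ (Z + 1) := by positivity
  constructor
  · rintro ⟨⟨h1, h2⟩, h3⟩
    have h1' : (B + 1) + 2 ^ (Z + 1) * A = X := by zify; linarith
    have h2' : B + C + 2 = 2 ^ (Z + 1) := by zify; linarith
    have h3' : X = 2 ^ Z * D := by zify; linarith
    have hB : B + 1 < 2 ^ (Z + 1) := by omega
    have hQ := (Nat.div_mod_unique hZ1).2 ⟨h1', hB⟩
    refine ⟨le_antisymm ?_ ?_, hQ.1.symm, by omega, by omega, ?_⟩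
    · exact (padicValNat_dvd_iff_le hX.ne').1 ⟨D, h3'⟩
    · by_contra! hlt
      have := (padicValNat_dvd_iff_le (p := 2) hX.ne').2 (show Z + 1 ≤ _ from hlt)
      have := Nat.mod_eq_zero_of_dvd this
      omega
    · rw [h3', Nat.mul_div_cancel_left _ hZ]
  · rintro ⟨hval, rfl, rfl, rfl, rfl⟩
    have hd : 2 ^ Z ∣ X := (padicValNat_dvd_iff_le hX.ne').2 hval.le
    have hnd : ¬ 2 ^ (Z + 1) ∣ X := by
      rw [padicValNat_dvd_iff_le hX.ne']; omega
    have hm : 0 < X % 2 ^ (Z + 1) := Nat.pos_of_ne_zero fun h => hnd (Nat.dvd_of_mod_eq_zero h)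
    have h1 := Nat.mod_add_div X (2 ^ (Z + 1))
    have h2 := Nat.mod_lt X hZ1
    refine ⟨⟨?_, ?_⟩, ?_⟩
    · have : (X % 2 ^ (Z + 1) - 1) + 1 + 2 ^ (Z + 1) * (X / 2 ^ (Z + 1)) = X := by omega
      zify at this
      push_cast
      linarith
    · have : (X % 2 ^ (Z + 1) - 1) + (2 ^ (Z + 1) - 1 - X % 2 ^ (Z + 1)) + 2 = 2 ^ (Z + 1) := by
        omega
      zify at this
      linarith
    · have := Nat.mul_div_cancel' hd
      zify at this
      push_cast
      linarith

/-- The exponent of the numerator in the term for `a.choose b`. -/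
def binomExp (a b : ℕ) : ℕ := 2 * (a + 2) * ((a + 1) * (a + 1) + b + 1)

/-- The denominator in the term for `a.choose b`. -/
def binomDen (a : ℕ) : ℕ := 2 ^ (2 * ((a + 2) * (a + 2))) - 2 ^ (2 * (a + 2)) - 1

/-- The values of the seven auxiliary unknowns in the equation for `a.choose b`, numbered from `1`. The
value `0` elsewhere is arbitrary. -/
def binomAux (a b : ℕ) : ℕ → ℕ
  | 1 => binomExp a b
  | 2 => 2 * ((a + 2) * (a + 2))
  | 3 => 2 ^ binomExp a b / binomDen a
  | 4 => 2 ^ binomExp a b % binomDen a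
  | 5 => binomDen a - 1 - 2 ^ binomExp a b % binomDen a
  | 6 => 2 ^ binomExp a b / binomDen a / 2 ^ (2 * (a + 2))
  | 7 => 2 ^ (2 * (a + 2)) - 1 - a.choose b
  | _ => 0

theorem binomDen_add (a : ℕ) :
    0 < binomDen a ∧ binomDen a + 2 ^ (2 * (a + 2)) + 1 = 2 ^ (2 * ((a + 2) * (a + 2))) := by
  have h : 2 ^ (2 * (a + 2)) * 2 ^ 1 < 2 ^ (2 * ((a + 2) * (a + 2))) := by
    rw [← pow_add]
    exact Nat.pow_lt_pow_right (by norm_num) (by nlinarith)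
  have h1 : 1 < 2 ^ (2 * (a + 2)) := Nat.one_lt_two_pow (by omega)
  unfold binomDen
  omega

namespace PrimeEquation

open ExpPoly

variable (n : ℕ) (v : Fin 42 → ℕ)

@[simp] theorem val_x (j : ℕ) : (x j).val n v = v (lab j) := val_X _ _ _

@[simp] theorem val_tp (c : ℕ) (l : List (ℕ × ℕ)) :
    (tp c l).val n v = 2 ^ (c + (l.map fun s => s.1 * v (lab s.2)).sum) := by
  rw [tp, val_twoPow, List.map_map]; rfl

theorem eDiv_val_nonneg {m : ℕ} (v : Fin m → ℕ) (x y y₁ y₂ z : ExpPoly m) :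
    0 ≤ (eDiv x y y₁ y₂ z).val n v := by
  simp only [eDiv, val_add, val_pow]; positivity

theorem eMod_val_nonneg {m : ℕ} (v : Fin m → ℕ) (x y y₁ y₂ z : ExpPoly m) :
    0 ≤ (eMod x y y₁ y₂ z).val n v := by
  simp only [eMod, val_add, val_pow]; positivity

theorem eDiv_val_eq_zero_iff {m : ℕ} {v : Fin m → ℕ} {x y y₁ y₂ z : ExpPoly m} {X Y Y₁ Y₂ Z : ℕ}
    (hx : x.val n v = X) (hy : y.val n v = Y) (h₁ : y₁.val n v = Y₁) (h₂ : y₂.val n v = Y₂)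
    (hz : z.val n v = Z) :
    (eDiv x y y₁ y₂ z).val n v = 0 ↔
      0 < Y ∧ Z = X / Y ∧ Y₁ = X % Y ∧ Y₂ = Y - 1 - X % Y := by
  simp only [eDiv, val_add, val_pow, val_sub, val_mul, val_ofNat, hx, hy, h₁, h₂, hz]
  exact division_eqs_iff

theorem eMod_val_eq_zero_iff {m : ℕ} {v : Fin m → ℕ} {x y y₁ y₂ z : ExpPoly m} {X Y Y₁ Y₂ Z : ℕ}
    (hx : x.val n v = X) (hy : y.val n v = Y) (h₁ : y₁.val n v = Y₁) (h₂ : y₂.val n v = Y₂)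
    (hz : z.val n v = Z) :
    (eMod x y y₁ y₂ z).val n v = 0 ↔
      0 < Y ∧ Y₁ = X / Y ∧ Z = X % Y ∧ Y₂ = Y - 1 - X % Y := by
  simp only [eMod, val_add, val_pow, val_sub, val_mul, val_ofNat, hx, hy, h₁, h₂, hz]
  exact division_eqs_iff

theorem eBinom_val_nonneg (c i j y l : ℕ) : 0 ≤ (eBinom c i j y l).val n v := by
  simp only [eBinom, val_add, val_pow]
  have h1 := eDiv_val_nonneg n v
  have h2 := eMod_val_nonneg n v
  exact add_nonneg (add_nonneg (by positivity) (h1 _ _ _ _ _)) (h2 _ _ _ _ _)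

/-- The gadget determines the binomial coefficient and all its auxiliary unknowns. The hypothesis is that
of `binom_formula`. -/
theorem eBinom_val_eq_zero_iff (c i j y l : ℕ) (h : v (lab j) ≤ c * v (lab i)) :
    (eBinom c i j y l).val n v = 0 ↔
      v (lab l) = (c * v (lab i)).choose (v (lab j)) ∧
        ∀ r ∈ Finset.Icc 1 7, v (lab (y + r)) = binomAux (c * v (lab i)) (v (lab j)) r := by
  set a := c * v (lab i) with ha
  set b := v (lab j) with hb
  have hIcc : (∀ r ∈ Finset.Icc 1 7, v (lab (y + r)) = binomAux a b r) ↔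
      v (lab (y + 1)) = binomExp a b ∧ v (lab (y + 2)) = 2 * ((a + 2) * (a + 2)) ∧
      v (lab (y + 3)) = 2 ^ binomExp a b / binomDen a ∧
      v (lab (y + 4)) = 2 ^ binomExp a b % binomDen a ∧
      v (lab (y + 5)) = binomDen a - 1 - 2 ^ binomExp a b % binomDen a ∧
      v (lab (y + 6)) = 2 ^ binomExp a b / binomDen a / 2 ^ (2 * (a + 2)) ∧
      v (lab (y + 7)) = 2 ^ (2 * (a + 2)) - 1 - a.choose b := by
    constructor
    · intro h
      exact ⟨h 1 (by decide), h 2 (by decide), h 3 (by decide), h 4 (by decide), h 5 (by decide),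
        h 6 (by decide), h 7 (by decide)⟩
    · rintro ⟨h1, h2, h3, h4, h5, h6, h7⟩ r hr
      obtain ⟨hr1, hr7⟩ := Finset.mem_Icc.1 hr
      interval_cases r <;> assumption
  have e1 : (v (lab (y + 1)) - (2 * (c * v (lab i)) ^ 3 + 8 * (c * v (lab i)) ^ 2
      + 2 * (c * v (lab i)) * v (lab j) + 12 * (c * v (lab i)) + 4 * v (lab j) + 8) : ℤ) ^ 2 = 0 ↔
      v (lab (y + 1)) = binomExp a b := by
    rw [← sq_eq_zero_iff_natCast_eq]
    have : ((binomExp a b : ℕ) : ℤ) = 2 * (c * v (lab i)) ^ 3 + 8 * (c * v (lab i)) ^ 2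
      + 2 * (c * v (lab i)) * v (lab j) + 12 * (c * v (lab i)) + 4 * v (lab j) + 8 := by
      rw [binomExp, ha, hb]; push_cast; ring
    rw [this]
  have e2 : (v (lab (y + 2)) - (2 * (c * v (lab i)) ^ 2 + 8 * (c * v (lab i)) + 8) : ℤ) ^ 2 = 0 ↔
      v (lab (y + 2)) = 2 * ((a + 2) * (a + 2)) := by
    rw [← sq_eq_zero_iff_natCast_eq]
    have : ((2 * ((a + 2) * (a + 2)) : ℕ) : ℤ)
        = 2 * (c * v (lab i)) ^ 2 + 8 * (c * v (lab i)) + 8 := by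
      rw [ha]; push_cast; ring
    rw [this]
  obtain ⟨hD0, hD⟩ := binomDen_add a
  have hx : (tp 4 [(2 * c, i)]).val n v = ((2 ^ (2 * (a + 2)) : ℕ) : ℤ) := by
    rw [val_tp]; push_cast; congr 1; rw [ha]; simp; ring
  have hq : 2 ^ binomExp a b / binomDen a % 2 ^ (2 * (a + 2)) = a.choose b := binom_formula h
  rw [hIcc, eBinom]
  simp only [val_add, val_sub, val_mul, val_pow, val_x, val_const, val_ofNat]
  refine (add_four_eq_zero_iff (sq_nonneg _) (sq_nonneg _) (eDiv_val_nonneg n v _ _ _ _ _)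
    (eMod_val_nonneg n v _ _ _ _ _)).trans ?_
  push_cast
  rw [e1, e2, eMod_val_eq_zero_iff n (val_x n v _) hx (val_x n v _) (val_x n v _) (val_x n v _)]
  have hdiv (h1 : v (lab (y + 1)) = binomExp a b)
      (h2 : v (lab (y + 2)) = 2 * ((a + 2) * (a + 2))) :
      (eDiv (tp 0 [(1, y + 1)]) (tp 0 [(1, y + 2)] - tp 4 [(2 * c, i)] - 1)
        (x (y + 4)) (x (y + 5)) (x (y + 3))).val n v = 0 ↔ _ :=
    eDiv_val_eq_zero_iff n (X := 2 ^ binomExp a b) (Y := binomDen a)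
      (by rw [val_tp]; simp [h1])
      (by rw [val_sub, val_sub, hx, val_tp, val_ofNat]
          simp only [List.map_cons, List.map_nil, List.sum_cons, List.sum_nil, h2]
          zify at hD
          push_cast
          simp only [zero_add, one_mul, add_zero]
          linarith)
      (val_x n v _) (val_x n v _) (val_x n v _)
  constructor
  · rintro ⟨⟨⟨h1, h2⟩, h3⟩, h4⟩
    rw [hdiv h1 h2] at h3
    obtain ⟨-, h3, h3a, h3b⟩ := h3
    rw [h3, hq] at h4
    exact ⟨h4.2.2.1, h1, h2, h3, h3a, h3b, h4.2.1, h4.2.2.2⟩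
  · rintro ⟨h0, h1, h2, h3, h3a, h3b, h4a, h4b⟩
    rw [hdiv h1 h2, h3, hq]
    exact ⟨⟨⟨h1, h2⟩, hD0, rfl, h3a, h3b⟩, by positivity, h4a, h0, h4b⟩

theorem eFact_val_nonneg (i y j : ℕ) : 0 ≤ (eFact i y j).val n v := by
  simp only [eFact, val_add, val_pow]
  exact add_nonneg (add_nonneg (by positivity) (eBinom_val_nonneg n v _ _ _ _ _))
    (eDiv_val_nonneg n v _ _ _ _ _)

theorem eFact_val_eq_zero_iff (i y j : ℕ) :
    (eFact i y j).val n v = 0 ↔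
      v (lab (y + 1)) = v (lab i) ^ 2 ∧ v (lab (y + 2)) = 2 ^ (3 * v (lab i) ^ 2) ∧
      v (lab (y + 3)) = v (lab i) ^ 3 ∧
      v (lab (y + 4)) = (2 ^ (3 * v (lab i) ^ 2)).choose (v (lab i)) ∧
      (∀ r ∈ Finset.Icc 1 7,
        v (lab (y + 4 + r)) = binomAux (2 ^ (3 * v (lab i) ^ 2)) (v (lab i)) r) ∧
      v (lab (y + 12))
        = 2 ^ (3 * v (lab i) ^ 3) % (2 ^ (3 * v (lab i) ^ 2)).choose (v (lab i)) ∧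
      v (lab (y + 13)) = (2 ^ (3 * v (lab i) ^ 2)).choose (v (lab i)) - 1
        - 2 ^ (3 * v (lab i) ^ 3) % (2 ^ (3 * v (lab i) ^ 2)).choose (v (lab i)) ∧
      v (lab j) = (v (lab i)).factorial := by
  set a := v (lab i) with ha
  have hA : a ≤ 2 ^ (3 * a ^ 2) :=
    calc a ≤ 3 * a ^ 2 := by nlinarith [Nat.le_self_pow two_ne_zero a]
      _ ≤ _ := Nat.lt_two_pow_self.le
  have hC : 0 < (2 ^ (3 * a ^ 2)).choose a := Nat.choose_pos hA
  have hf : 2 ^ (3 * a ^ 3) / (2 ^ (3 * a ^ 2)).choose a = a.factorial := by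
    have := factorial_formula a
    rwa [show a * a * a = a ^ 3 by ring, show a * a = a ^ 2 by ring] at this
  have hbin (h2 : v (lab (y + 2)) = 2 ^ (3 * a ^ 2)) :=
    eBinom_val_eq_zero_iff n v 1 (y + 2) i (y + 4) (y + 4) (by rw [h2, one_mul]; exact hA)
  have hdiv (h3 : v (lab (y + 3)) = a ^ 3)
      (h4 : v (lab (y + 4)) = (2 ^ (3 * a ^ 2)).choose a) :
      (eDiv (tp 0 [(3, y + 3)]) (x (y + 4)) (x (y + 12)) (x (y + 13)) (x j)).val n v = 0 ↔ _ :=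
    eDiv_val_eq_zero_iff n (X := 2 ^ (3 * a ^ 3)) (Y := (2 ^ (3 * a ^ 2)).choose a)
      (by rw [val_tp]; simp [h3]) (by rw [val_x, h4]) (val_x n v _) (val_x n v _) (val_x n v _)
  rw [eFact]
  simp only [val_add, val_sub, val_mul, val_pow, val_x, val_tp, List.map_cons, List.map_nil,
    List.sum_cons, List.sum_nil, zero_add, add_zero]
  rw [add_eq_zero_iff_of_nonneg (add_nonneg (by positivity) (eBinom_val_nonneg n v _ _ _ _ _))
      (eDiv_val_nonneg n v _ _ _ _ _),
    add_eq_zero_iff_of_nonneg (by positivity) (eBinom_val_nonneg n v _ _ _ _ _),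
    add_eq_zero_iff_of_nonneg (by positivity) (by positivity),
    add_eq_zero_iff_of_nonneg (by positivity) (by positivity)]
  have c1 : ((v (lab (y + 1)) : ℤ) - v (lab i) ^ 2) ^ 2 = 0 ↔ v (lab (y + 1)) = a ^ 2 := by
    rw [← sq_eq_zero_iff_natCast_eq, ha, Nat.cast_pow]
  have c2 : ((v (lab (y + 2)) : ℤ) - 2 ^ (3 * v (lab (y + 1)))) ^ 2 = 0 ↔
      v (lab (y + 2)) = 2 ^ (3 * v (lab (y + 1))) := by
    rw [← sq_eq_zero_iff_natCast_eq]; push_cast; rfl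
  have c3 : ((v (lab (y + 3)) : ℤ) - v (lab i) * v (lab (y + 1))) ^ 2 = 0 ↔
      v (lab (y + 3)) = a * v (lab (y + 1)) := by
    rw [← sq_eq_zero_iff_natCast_eq, ha, Nat.cast_mul]
  rw [c1, c2, c3]
  constructor
  · rintro ⟨⟨⟨⟨h1, h2⟩, h3⟩, h4⟩, h5⟩
    rw [h1] at h2 h3
    have h3' : v (lab (y + 3)) = a ^ 3 := by rw [h3]; ring
    rw [hbin h2, h2, one_mul, ← ha] at h4
    rw [hdiv h3' h4.1, hf] at h5
    exact ⟨h1, h2, h3', h4.1, h4.2, h5.2.2.1, h5.2.2.2, h5.2.1⟩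
  · rintro ⟨h1, h2, h3, h4, h4b, h5a, h5b, h5c⟩
    rw [hbin h2, hdiv h3 h4, hf, h1, h2, one_mul, ← ha]
    exact ⟨⟨⟨⟨rfl, rfl⟩, by rw [h3]; ring⟩, h4, h4b⟩, hC, h5c, h5a, h5b⟩

/-- The values of the four auxiliary unknowns in the equation for the exponent of `2` in `X`, numbered
from `1`. The value `0` elsewhere is arbitrary. -/
def nuAux (X : ℕ) : ℕ → ℕ
  | 1 => X / 2 ^ (padicValNat 2 X + 1)
  | 2 => X % 2 ^ (padicValNat 2 X + 1) - 1
  | 3 => 2 ^ (padicValNat 2 X + 1) - 1 - X % 2 ^ (padicValNat 2 X + 1)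
  | 4 => X / 2 ^ padicValNat 2 X
  | _ => 0

theorem eNu_val_nonneg (i y j : ℕ) : 0 ≤ (eNu i y j).val n v := by
  simp only [eNu, eNotDvd, eDvd, val_add, val_pow]; positivity

theorem eNu_val_eq_zero_iff (i y j : ℕ) (h : 0 < v (lab i)) :
    (eNu i y j).val n v = 0 ↔ v (lab j) = padicValNat 2 (v (lab i)) ∧
      ∀ r ∈ Finset.Icc 1 4, v (lab (y + r)) = nuAux (v (lab i)) r := by
  simp only [eNu, eNotDvd, eDvd, val_add, val_sub, val_mul, val_pow, val_x, val_tp, val_ofNat,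
    List.map_cons, List.map_nil, List.sum_cons, List.sum_nil, zero_add, add_zero, one_mul,
    add_comm 1]
  refine (two_adic_eqs_iff h).trans (and_congr_right fun hj => ?_)
  rw [hj]
  constructor
  · rintro ⟨h1, h2, h3, h4⟩ r hr
    obtain ⟨hr1, hr4⟩ := Finset.mem_Icc.1 hr
    interval_cases r <;> assumption
  · intro h
    exact ⟨h 1 (by decide), h 2 (by decide), h 3 (by decide), h 4 (by decide)⟩

theorem eHW_val_nonneg (i y j : ℕ) : 0 ≤ (eHW i y j).val n v := by
  rw [eHW, val_add]
  exact add_nonneg (eBinom_val_nonneg n v _ _ _ _ _) (eNu_val_nonneg n v _ _ _)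

theorem eHW_val_eq_zero_iff (i y j : ℕ) :
    (eHW i y j).val n v = 0 ↔
      v (lab (y + 1)) = (2 * v (lab i)).choose (v (lab i)) ∧
      (∀ r ∈ Finset.Icc 1 7, v (lab (y + 1 + r)) = binomAux (2 * v (lab i)) (v (lab i)) r) ∧
      (∀ r ∈ Finset.Icc 1 4,
        v (lab (y + 8 + r)) = nuAux ((2 * v (lab i)).choose (v (lab i))) r) ∧
      v (lab j) = digitSum (v (lab i)) := by
  rw [eHW, val_add, add_eq_zero_iff_of_nonneg (eBinom_val_nonneg n v _ _ _ _ _)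
    (eNu_val_nonneg n v _ _ _), eBinom_val_eq_zero_iff n v 2 i i (y + 1) (y + 1) (by omega),
    and_assoc]
  refine and_congr_right fun h1 => and_congr_right fun _ => ?_
  rw [eNu_val_eq_zero_iff n v (y + 1) (y + 8) j (by rw [h1]; exact Nat.choose_pos (by omega)), h1,
    padicValNat_choose_two_mul_self, and_comm]

end PrimeEquation

/-! ### The hypercube value of `(x_1 ^ 2 - n x_2 - 1) ^ 2` in closed form -/

section ClosedForms

variable (q s : ℕ)

theorem cast_geomSum_succ (r t : ℕ) :
    (geomSum r q (t + 1) : ℤ) = geomSum r q t + (t : ℤ) ^ r * (q : ℤ) ^ t := by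
  rw [geomSum, Finset.sum_range_succ, ← geomSum]; push_cast; ring

theorem geomSum_zero_mul (t : ℕ) : (geomSum 0 q t : ℤ) * (q - 1) = (q : ℤ) ^ t - 1 := by
  induction t with
  | zero => simp [geomSum]
  | succ t ih => rw [cast_geomSum_succ]; linear_combination ih

theorem geomSum_one_mul : (geomSum 1 q (s + 1) : ℤ) * (q - 1) ^ 2
    = q * (s * (q : ℤ) ^ (s + 1) - (s + 1) * (q : ℤ) ^ s + 1) := by
  induction s with
  | zero => simp [geomSum]
  | succ s ih => rw [cast_geomSum_succ]; push_cast; linear_combination ih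

theorem geomSum_two_mul : (geomSum 2 q (s + 1) : ℤ) * (q - 1) ^ 3
    = q * ((s : ℤ) ^ 2 * (q : ℤ) ^ s * (q : ℤ) ^ 2 - (2 * (s : ℤ) ^ 2 + 2 * s - 1) * (q : ℤ) ^ (s + 1)
        + ((s : ℤ) + 1) ^ 2 * (q : ℤ) ^ s - q - 1) := by
  induction s with
  | zero => simp [geomSum]
  | succ s ih => rw [cast_geomSum_succ]; push_cast; linear_combination ih

theorem geomSum_four_mul : (geomSum 4 q (s + 1) : ℤ) * (q - 1) ^ 5
    = q * ((s : ℤ) ^ 4 * (q : ℤ) ^ s * (q : ℤ) ^ 4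
      + (1 - 4 * s + 6 * (s : ℤ) ^ 2 - 4 * (s : ℤ) ^ 3 - 4 * (s : ℤ) ^ 4) * (q : ℤ) ^ s * (q : ℤ) ^ 3
      + (11 - 12 * s - 6 * (s : ℤ) ^ 2 + 12 * (s : ℤ) ^ 3 + 6 * (s : ℤ) ^ 4) * (q : ℤ) ^ s
          * (q : ℤ) ^ 2
      + (11 + 12 * s - 6 * (s : ℤ) ^ 2 - 12 * (s : ℤ) ^ 3 - 4 * (s : ℤ) ^ 4) * (q : ℤ) ^ (s + 1)
      + ((s : ℤ) + 1) ^ 4 * (q : ℤ) ^ s - (q : ℤ) ^ 3 - 11 * (q : ℤ) ^ 2 - 11 * q - 1) := by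
  induction s with
  | zero => simp [geomSum]; right; ring
  | succ s ih => rw [cast_geomSum_succ]; push_cast; linear_combination ih

end ClosedForms

/-- The contribution of the constant block `2 ^ u` to the hypercube value. -/
def hypercubeConst (u t : ℕ) : ℕ :=
  2 ^ u * ((2 ^ u - 1) * ∑ k ∈ Finset.range (t ^ 2), 2 ^ (2 * u * k))

theorem hypercubeConst_mul (u t : ℕ) :
    hypercubeConst u t * (2 ^ u + 1) = 2 ^ u * (2 ^ (2 * u * t ^ 2) - 1) := by
  have h1 : 1 ≤ 2 ^ u := Nat.one_le_two_pow
  have h2 := geom_sum_mul_add ((2 ^ u) ^ 2 - 1) (t ^ 2)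
  rw [Nat.sub_add_cancel (Nat.one_le_pow _ _ h1)] at h2
  have h3 : (2 ^ u) ^ 2 - 1 = (2 ^ u + 1) * (2 ^ u - 1) := Nat.sq_sub_sq (2 ^ u) 1
  have h4 : ∀ j, ((2 ^ u) ^ 2) ^ j = 2 ^ (2 * u * j) := fun j => by
    rw [← pow_mul, ← pow_mul]; congr 1; ring
  simp only [h4] at h2
  rw [← h2, Nat.add_sub_cancel, h3, hypercubeConst]
  ring

theorem geomSum_mul_geomSum (r s u t : ℕ) :
    geomSum r (2 ^ (2 * u)) t * geomSum s (2 ^ (2 * u * t)) t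
      = ∑ v : Fin 2 → Fin t, 2 ^ (2 * u * cubeIndex v) * ((v 0 : ℕ) ^ r * (v 1 : ℕ) ^ s) := by
  have h := ExpMono.prod_geomSum (m := 2) 0 t u ⟨1, 0, 0, ![r, s], 0⟩
  simpa [Fin.prod_univ_two, ExpMono.size] using h

/-- The expansion of the square, one product of generalized geometric progressions for each monomial. The
free monomial `1` is merged with the constant `2 ^ u + 1` of the blocks into `hypercubeConst`. -/
theorem cast_sqrtUnityHypercube_eq (n : ℕ) :
    (sqrtUnityHypercube n : ℤ) = hypercubeConst (n + 5) (n + 1) + (1 - 2 ^ (n + 5)) *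
      (geomSum 4 (2 ^ (2 * (n + 5))) (n + 1) * geomSum 0 (2 ^ (2 * (n + 5) * (n + 1))) (n + 1)
        - 2 * (geomSum 2 (2 ^ (2 * (n + 5))) (n + 1)
            * geomSum 0 (2 ^ (2 * (n + 5) * (n + 1))) (n + 1))
        - 2 * n * (geomSum 2 (2 ^ (2 * (n + 5))) (n + 1)
            * geomSum 1 (2 ^ (2 * (n + 5) * (n + 1))) (n + 1))
        + n ^ 2 * (geomSum 0 (2 ^ (2 * (n + 5))) (n + 1)
            * geomSum 2 (2 ^ (2 * (n + 5) * (n + 1))) (n + 1))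
        + 2 * n * (geomSum 0 (2 ^ (2 * (n + 5))) (n + 1)
            * geomSum 1 (2 ^ (2 * (n + 5) * (n + 1))) (n + 1))) := by
  have hG (r s : ℕ) : (geomSum r (2 ^ (2 * (n + 5))) (n + 1) : ℤ)
      * geomSum s (2 ^ (2 * (n + 5) * (n + 1))) (n + 1)
      = ∑ v : Fin 2 → Fin (n + 1), 2 ^ (2 * (n + 5) * cubeIndex v)
        * (((v 0 : ℕ) : ℤ) ^ r * ((v 1 : ℕ) : ℤ) ^ s) := by
    exact_mod_cast geomSum_mul_geomSum r s (n + 5) (n + 1)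
  have hC : (hypercubeConst (n + 5) (n + 1) : ℤ)
      = ∑ v : Fin 2 → Fin (n + 1), 2 ^ (2 * (n + 5) * cubeIndex v)
        * (2 ^ (n + 5) * (2 ^ (n + 5) - 1)) := by
    rw [hypercubeConst, ← sum_cubeIndex (m := 2) (fun k => 2 ^ (2 * (n + 5) * k)), Nat.cast_mul,
      Nat.cast_mul, Nat.cast_sub Nat.one_le_two_pow, ← Finset.sum_mul]
    push_cast
    ring
  rw [cast_sqrtUnityHypercube, hG, hG, hG, hG, hG, hC]
  simp only [Finset.mul_sum, ← Finset.sum_add_distrib, ← Finset.sum_sub_distrib]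
  exact Finset.sum_congr rfl fun v _ => by ring

/-- There are `(n + 1) ^ 2` blocks of `2 (n + 5)` binary digits each. -/
theorem sqrtUnityHypercube_lt (n : ℕ) :
    sqrtUnityHypercube n < 2 ^ (2 * (n + 5) * (n + 1) ^ 2) := by
  have h4 := geom_sum_mul_add (2 ^ (2 * (n + 5)) - 1) ((n + 1) ^ 2)
  rw [Nat.sub_add_cancel Nat.one_le_two_pow, ← pow_mul] at h4
  rw [← h4]
  refine Nat.lt_succ_of_le ?_
  rw [Finset.sum_mul]
  simp only [← pow_mul]
  rw [← sum_cubeIndex (m := 2) (fun k => 2 ^ (2 * (n + 5) * k) * (2 ^ (2 * (n + 5)) - 1))]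
  zify
  rw [cast_sqrtUnityHypercube]
  refine Finset.sum_le_sum fun v _ => ?_
  have h1 : (1 : ℤ) ≤ 2 ^ (n + 5) := one_le_pow₀ (by norm_num)
  have h2 : (2 : ℤ) ^ (2 * (n + 5)) = 2 ^ (n + 5) * 2 ^ (n + 5) := by rw [two_mul, pow_add]
  rw [Nat.cast_sub Nat.one_le_two_pow]
  push_cast
  refine mul_le_mul_of_nonneg_left ?_ (by positivity)
  rw [h2]
  generalize (2 : ℤ) ^ (n + 5) = z at h1
  nlinarith [sq_nonneg (((v 0 : ℕ) : ℤ) ^ 2 - n * (v 1 : ℕ) - 1)]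

/-- The values of the nine auxiliary unknowns in the equation for the hypercube value, numbered from
`1`. The value `0` elsewhere is arbitrary. -/
def hypercubeAux (n : ℕ) : ℕ → ℕ
  | 1 => 2 ^ (2 * (n + 5)) - 1
  | 2 => 2 ^ (2 * (n + 5) * (n + 1)) - 1
  | 3 => geomSum 0 (2 ^ (2 * (n + 5))) (n + 1)
  | 4 => geomSum 2 (2 ^ (2 * (n + 5))) (n + 1)
  | 5 => geomSum 4 (2 ^ (2 * (n + 5))) (n + 1)
  | 6 => geomSum 0 (2 ^ (2 * (n + 5) * (n + 1))) (n + 1)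
  | 7 => geomSum 1 (2 ^ (2 * (n + 5) * (n + 1))) (n + 1)
  | 8 => geomSum 2 (2 ^ (2 * (n + 5) * (n + 1))) (n + 1)
  | 9 => hypercubeConst (n + 5) (n + 1)
  | _ => 0

theorem forall_eq_hypercubeAux_iff (n : ℕ) (w : ℕ → ℕ) :
    (∀ r ∈ Finset.Icc 1 9, w r = hypercubeAux n r) ↔
      w 1 = 2 ^ (2 * (n + 5)) - 1 ∧ w 2 = 2 ^ (2 * (n + 5) * (n + 1)) - 1 ∧
      w 3 = geomSum 0 (2 ^ (2 * (n + 5))) (n + 1) ∧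
      w 4 = geomSum 2 (2 ^ (2 * (n + 5))) (n + 1) ∧
      w 5 = geomSum 4 (2 ^ (2 * (n + 5))) (n + 1) ∧
      w 6 = geomSum 0 (2 ^ (2 * (n + 5) * (n + 1))) (n + 1) ∧
      w 7 = geomSum 1 (2 ^ (2 * (n + 5) * (n + 1))) (n + 1) ∧
      w 8 = geomSum 2 (2 ^ (2 * (n + 5) * (n + 1))) (n + 1) ∧
      w 9 = hypercubeConst (n + 5) (n + 1) := by
  have h : Finset.Icc 1 9 = {1, 2, 3, 4, 5, 6, 7, 8, 9} := by decide
  simp only [h, Finset.forall_mem_insert, Finset.mem_singleton, forall_eq, hypercubeAux]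

theorem sum_ten_sq_eq_zero_iff {a b c d e f g h i j : ℤ} :
    a ^ 2 + b ^ 2 + c ^ 2 + d ^ 2 + e ^ 2 + f ^ 2 + g ^ 2 + h ^ 2 + i ^ 2 + j ^ 2 = 0 ↔
      a = 0 ∧ b = 0 ∧ c = 0 ∧ d = 0 ∧ e = 0 ∧ f = 0 ∧ g = 0 ∧ h = 0 ∧ i = 0 ∧ j = 0 := by
  have key (x : ℤ) : x = 0 ↔ x ^ 2 = 0 := (pow_eq_zero_iff two_ne_zero).symm
  rw [key a, key b, key c, key d, key e, key f, key g, key h, key i, key j]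
  have := sq_nonneg a; have := sq_nonneg b; have := sq_nonneg c; have := sq_nonneg d
  have := sq_nonneg e; have := sq_nonneg f; have := sq_nonneg g; have := sq_nonneg h
  have := sq_nonneg i; have := sq_nonneg j
  omega

theorem mul_sub_eq_zero_iff_of_mul_eq {g G d R : ℤ} (hd : d ≠ 0) (h : G * d = R) :
    g * d - R = 0 ↔ g = G := by
  rw [← h, ← sub_mul, mul_eq_zero, or_iff_left hd, sub_eq_zero]

namespace PrimeEquation

open ExpPoly

variable (n : ℕ) (v : Fin 42 → ℕ)

theorem eM4_val_nonneg : 0 ≤ eM4.val n v := by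
  simp only [eM4, val_add, val_pow]; positivity

/-- Multiplied by the powers of `q - 1`, the generalized geometric progressions satisfy polynomial
equations in `q`, `s` and `q ^ s`; since `q > 1`, these equations determine them. -/
theorem eM4_val_eq_zero_iff (h3 : v (lab 3) = v (lab 2) ^ 2) (h4 : v (lab 4) = v (lab 2) ^ 3)
    (h5 : v (lab 5) = 4 * v (lab 2) + 1) :
    eM4.val n v = 0 ↔
      (∀ r ∈ Finset.Icc 1 9, v (lab (21 + r)) = hypercubeAux (4 * v (lab 2)) r) ∧
        v (lab 6) = sqrtUnityHypercube (4 * v (lab 2)) := by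
  simp only [eM4, val_add, val_sub, val_mul, val_pow, val_x, val_tp, val_ofNat,
    List.map_cons, List.map_nil, List.sum_cons, List.sum_nil, zero_add, add_zero, h3, h4, h5]
  rw [sum_ten_sq_eq_zero_iff]
  set f := v (lab 2)
  set N := 4 * f with hN
  obtain ⟨q₁, hq1⟩ : ∃ q : ℕ, q = 2 ^ (2 * (N + 5)) := ⟨_, rfl⟩
  obtain ⟨q₂, hq2⟩ : ∃ q : ℕ, q = 2 ^ (2 * (N + 5) * (N + 1)) := ⟨_, rfl⟩
  have p1 : (2 : ℤ) ^ (5 + 4 * f) = 2 ^ (N + 5) := by rw [hN]; ring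
  have p2 : (2 : ℤ) ^ (10 + 8 * f) = q₁ := by rw [hq1, hN]; push_cast; congr 1; ring
  have p3 : (2 : ℤ) ^ (10 + (48 * f + 32 * f ^ 2)) = q₂ := by
    rw [hq2, hN]; push_cast; congr 1; ring
  have p3' : (q₁ : ℤ) ^ (N + 1) = q₂ := by rw [hq1, hq2]; push_cast; rw [← pow_mul]
  have p4 : (2 : ℤ) ^ (40 * f + 32 * f ^ 2) = (q₁ : ℤ) ^ N := by
    rw [hq1, hN]; push_cast; rw [← pow_mul]; congr 1; ring
  have p5 : (2 : ℤ) ^ (10 + (88 * f + (224 * f ^ 2 + 128 * f ^ 3))) = (q₂ : ℤ) ^ (N + 1) := by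
    rw [hq2, hN]; push_cast; rw [← pow_mul]; congr 1; ring
  have p6 : (2 : ℤ) ^ (40 * f + (192 * f ^ 2 + 128 * f ^ 3)) = (q₂ : ℤ) ^ N := by
    rw [hq2, hN]; push_cast; rw [← pow_mul]; congr 1; ring
  have p7 : (q₂ : ℤ) ^ (N + 1) = 2 ^ (2 * (N + 5) * (N + 1) ^ 2) := by
    rw [hq2]; push_cast; rw [← pow_mul]; congr 1; ring
  have hF : (4 : ℤ) * f = N := by rw [hN]; push_cast; ring
  have hF1 : ((4 * f + 1 : ℕ) : ℤ) = (N : ℤ) + 1 := by rw [hN]; push_cast; ring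
  have hq1' : (1 : ℤ) < q₁ := by
    rw [hq1]
    exact_mod_cast Nat.one_lt_two_pow (show 2 * (N + 5) ≠ 0 by omega)
  have hq2' : (1 : ℤ) < q₂ := by
    rw [hq2]
    exact_mod_cast Nat.one_lt_two_pow (Nat.mul_pos (by omega) (Nat.succ_pos N)).ne'
  have hd1 : (q₁ : ℤ) - 1 ≠ 0 := by omega
  have hd2 : (q₂ : ℤ) - 1 ≠ 0 := by omega
  have e1 : (v (lab 22) : ℤ) - q₁ + 1 = 0 ↔ v (lab 22) = q₁ - 1 := by omega
  have e2 : (v (lab 23) : ℤ) - q₂ + 1 = 0 ↔ v (lab 23) = q₂ - 1 := by omega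
  have g01 := geomSum_zero_mul q₁ (N + 1)
  have g02 := geomSum_zero_mul q₂ (N + 1)
  have g12 := geomSum_one_mul q₂ N
  have g21 := geomSum_two_mul q₁ N
  have g22 := geomSum_two_mul q₂ N
  have g41 := geomSum_four_mul q₁ N
  rw [p3'] at g01 g21 g41
  have hC : (hypercubeConst (N + 5) (N + 1) : ℤ) * (2 ^ (N + 5) + 1)
      = 2 ^ (N + 5) * ((q₂ : ℤ) ^ (N + 1) - 1) := by
    rw [p7]
    have := hypercubeConst_mul (N + 5) (N + 1)
    zify [Nat.one_le_two_pow (n := 2 * (N + 5) * (N + 1) ^ 2)] at this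
    exact this
  have hdC : (2 : ℤ) ^ (N + 5) + 1 ≠ 0 := by positivity
  have hM := cast_sqrtUnityHypercube_eq N
  rw [← hq1, ← hq2] at hM
  have hIcc : (∀ r ∈ Finset.Icc 1 9, v (lab (21 + r)) = hypercubeAux N r) ↔
      v (lab 22) = q₁ - 1 ∧ v (lab 23) = q₂ - 1 ∧ v (lab 24) = geomSum 0 q₁ (N + 1) ∧
      v (lab 25) = geomSum 2 q₁ (N + 1) ∧ v (lab 26) = geomSum 4 q₁ (N + 1) ∧
      v (lab 27) = geomSum 0 q₂ (N + 1) ∧ v (lab 28) = geomSum 1 q₂ (N + 1) ∧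
      v (lab 29) = geomSum 2 q₂ (N + 1) ∧ v (lab 30) = hypercubeConst (N + 5) (N + 1) :=
    hq1 ▸ hq2 ▸ forall_eq_hypercubeAux_iff N fun r => v (lab (21 + r))
  rw [hIcc]
  push_cast at p1 p2 p3 p4 p5 p6 e1 e2 hF ⊢
  rw [p1, p2, p3, p4, p5, p6, e1, e2, hF]
  have hv1 (h : v (lab 22) = q₁ - 1) : (v (lab 22) : ℤ) = q₁ - 1 := by rw [h]; omega
  have hv2 (h : v (lab 23) = q₂ - 1) : (v (lab 23) : ℤ) = q₂ - 1 := by rw [h]; omega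
  constructor
  · rintro ⟨h1, h2, a01, a02, a12, a21, a22, a41, aC, aM⟩
    rw [hv1 h1] at a01 a21 a41
    rw [hv2 h2] at a02 a12 a22
    rw [mul_sub_eq_zero_iff_of_mul_eq hd1 g01, Nat.cast_inj] at a01
    rw [mul_sub_eq_zero_iff_of_mul_eq (pow_ne_zero _ hd1) g21, Nat.cast_inj] at a21
    rw [mul_sub_eq_zero_iff_of_mul_eq (pow_ne_zero _ hd1) g41, Nat.cast_inj] at a41
    rw [mul_sub_eq_zero_iff_of_mul_eq hd2 g02, Nat.cast_inj] at a02
    rw [mul_sub_eq_zero_iff_of_mul_eq (pow_ne_zero _ hd2) g12, Nat.cast_inj] at a12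
    rw [mul_sub_eq_zero_iff_of_mul_eq (pow_ne_zero _ hd2) g22, Nat.cast_inj] at a22
    rw [mul_sub_eq_zero_iff_of_mul_eq hdC hC, Nat.cast_inj] at aC
    refine ⟨⟨h1, h2, a01, a21, a41, a02, a12, a22, aC⟩, ?_⟩
    rw [a01, a21, a41, a02, a12, a22, aC] at aM
    zify
    linear_combination aM - hM
  · rintro ⟨⟨h1, h2, a01, a21, a41, a02, a12, a22, aC⟩, aM⟩
    rw [hv1 h1, hv2 h2, a01, a21, a41, a02, a12, a22, aC, aM]
    refine ⟨h1, h2, ?_, ?_, ?_, ?_, ?_, ?_, ?_, ?_⟩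
    · exact sub_eq_zero.2 g01
    · exact sub_eq_zero.2 g02
    · exact sub_eq_zero.2 g12
    · exact sub_eq_zero.2 g21
    · exact sub_eq_zero.2 g22
    · exact sub_eq_zero.2 g41
    · exact sub_eq_zero.2 hC
    · linear_combination hM

end PrimeEquation

/-! ### The zeros of the polynomial for the `n`-th prime -/

namespace PrimeEquation

open ExpPoly

/-- The values of the `42` unknowns at the zero whose first coordinate is `a`. The value `0` outside
`{1, …, 42}` is arbitrary. The truncated subtraction in the slack variable `8` is a true one whenever
there is a zero with first coordinate `a`. -/
def solution (n a : ℕ) : ℕ → ℕ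
  | 1 => a
  | 2 => a.factorial
  | 3 => a.factorial ^ 2
  | 4 => a.factorial ^ 3
  | 5 => 4 * a.factorial + 1
  | 6 => sqrtUnityHypercube (4 * a.factorial)
  | 7 => digitSum (sqrtUnityHypercube (4 * a.factorial))
  | 8 => 2 ^ n - 2 ^ (a.primeCounting + 1)
  | 9 => a ^ 2
  | 10 => 2 ^ (3 * a ^ 2)
  | 11 => a ^ 3
  | 12 => (2 ^ (3 * a ^ 2)).choose a
  | 13 => binomAux (2 ^ (3 * a ^ 2)) a 1
  | 14 => binomAux (2 ^ (3 * a ^ 2)) a 2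
  | 15 => binomAux (2 ^ (3 * a ^ 2)) a 3
  | 16 => binomAux (2 ^ (3 * a ^ 2)) a 4
  | 17 => binomAux (2 ^ (3 * a ^ 2)) a 5
  | 18 => binomAux (2 ^ (3 * a ^ 2)) a 6
  | 19 => binomAux (2 ^ (3 * a ^ 2)) a 7
  | 20 => 2 ^ (3 * a ^ 3) % (2 ^ (3 * a ^ 2)).choose a
  | 21 => (2 ^ (3 * a ^ 2)).choose a - 1 - 2 ^ (3 * a ^ 3) % (2 ^ (3 * a ^ 2)).choose a
  | 22 => hypercubeAux (4 * a.factorial) 1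
  | 23 => hypercubeAux (4 * a.factorial) 2
  | 24 => hypercubeAux (4 * a.factorial) 3
  | 25 => hypercubeAux (4 * a.factorial) 4
  | 26 => hypercubeAux (4 * a.factorial) 5
  | 27 => hypercubeAux (4 * a.factorial) 6
  | 28 => hypercubeAux (4 * a.factorial) 7
  | 29 => hypercubeAux (4 * a.factorial) 8
  | 30 => hypercubeAux (4 * a.factorial) 9
  | 31 => (2 * sqrtUnityHypercube (4 * a.factorial)).choose (sqrtUnityHypercube (4 * a.factorial))
  | 32 => binomAux (2 * sqrtUnityHypercube (4 * a.factorial)) (sqrtUnityHypercube (4 * a.factorial)) 1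
  | 33 => binomAux (2 * sqrtUnityHypercube (4 * a.factorial)) (sqrtUnityHypercube (4 * a.factorial)) 2
  | 34 => binomAux (2 * sqrtUnityHypercube (4 * a.factorial)) (sqrtUnityHypercube (4 * a.factorial)) 3
  | 35 => binomAux (2 * sqrtUnityHypercube (4 * a.factorial)) (sqrtUnityHypercube (4 * a.factorial)) 4
  | 36 => binomAux (2 * sqrtUnityHypercube (4 * a.factorial)) (sqrtUnityHypercube (4 * a.factorial)) 5
  | 37 => binomAux (2 * sqrtUnityHypercube (4 * a.factorial)) (sqrtUnityHypercube (4 * a.factorial)) 6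
  | 38 => binomAux (2 * sqrtUnityHypercube (4 * a.factorial)) (sqrtUnityHypercube (4 * a.factorial)) 7
  | 39 => nuAux ((2 * sqrtUnityHypercube (4 * a.factorial)).choose
      (sqrtUnityHypercube (4 * a.factorial))) 1
  | 40 => nuAux ((2 * sqrtUnityHypercube (4 * a.factorial)).choose
      (sqrtUnityHypercube (4 * a.factorial))) 2
  | 41 => nuAux ((2 * sqrtUnityHypercube (4 * a.factorial)).choose
      (sqrtUnityHypercube (4 * a.factorial))) 3
  | 42 => nuAux ((2 * sqrtUnityHypercube (4 * a.factorial)).choose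
      (sqrtUnityHypercube (4 * a.factorial))) 4
  | _ => 0

theorem poly_val_nonneg (n : ℕ) (v : Fin 42 → ℕ) : 0 ≤ poly.val n v := by
  rw [poly, val_collect]
  simp only [val_add, val_pow]
  exact add_nonneg (add_nonneg (add_nonneg (add_nonneg (add_nonneg (add_nonneg
    (eFact_val_nonneg n v 1 8 2) (sq_nonneg _)) (sq_nonneg _)) (sq_nonneg _))
    (eM4_val_nonneg n v)) (eHW_val_nonneg n v 6 30 7)) (sq_nonneg _)

theorem add_seven_eq_zero_iff {a b c d e f g : ℤ} (ha : 0 ≤ a) (hb : 0 ≤ b) (hc : 0 ≤ c)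
    (hd : 0 ≤ d) (he : 0 ≤ e) (hf : 0 ≤ f) (hg : 0 ≤ g) :
    a + b + c + d + e + f + g = 0 ↔
      a = 0 ∧ b = 0 ∧ c = 0 ∧ d = 0 ∧ e = 0 ∧ f = 0 ∧ g = 0 := by
  omega

/-- The slack equation `b + (4 f + 5) (d - (4 f + 1) ^ 2 - 2 ^ n) = 0` at
`b = (4 f + 5) ((4 f + 1) ^ 2 + 2 ^ (π + 1))` says that `d = 2 ^ n - 2 ^ (π + 1)`. -/
theorem slack_eq_zero_iff {f d n c : ℕ} :
    ((((4 * f + 5) * ((4 * f + 1) ^ 2 + 2 ^ (c + 1)) : ℕ) : ℤ)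
      + (4 * f + 5) * (-((4 * f + 1 : ℕ) : ℤ) ^ 2 + d - 2 ^ n)) ^ 2 = 0 ↔
      c + 1 ≤ n ∧ d = 2 ^ n - 2 ^ (c + 1) := by
  have h : ((((4 * f + 5) * ((4 * f + 1) ^ 2 + 2 ^ (c + 1)) : ℕ) : ℤ)
      + (4 * f + 5) * (-((4 * f + 1 : ℕ) : ℤ) ^ 2 + d - 2 ^ n))
      = (4 * f + 5) * (((2 ^ (c + 1) + d : ℕ) : ℤ) - ((2 ^ n : ℕ) : ℤ)) := by push_cast; ring
  have h5 : (4 * f + 5 : ℤ) ≠ 0 := by positivity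
  rw [h, pow_eq_zero_iff two_ne_zero, mul_eq_zero, or_iff_right h5, sub_eq_zero, Nat.cast_inj,
    ← Nat.pow_le_pow_iff_right (a := 2) (by norm_num)]
  omega

/-- All unknowns are determined by the first one, and the slack equation requires
`2 ^ (π(a) + 1) ≤ 2 ^ n` of it. -/
theorem poly_val_eq_zero_iff (n : ℕ) (v : Fin 42 → ℕ) :
    poly.val n v = 0 ↔ (v (lab 1)).primeCounting + 1 ≤ n ∧
      ∀ j ∈ Finset.Icc 1 42, v (lab j) = solution n (v (lab 1)) j := by
  rw [poly, val_collect]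
  simp only [val_add, val_sub, val_mul, val_neg, val_pow, val_x, val_ofNat, val_twoPowParam]
  refine (add_seven_eq_zero_iff (eFact_val_nonneg n v 1 8 2) (sq_nonneg _) (sq_nonneg _)
    (sq_nonneg _) (eM4_val_nonneg n v) (eHW_val_nonneg n v 6 30 7) (sq_nonneg _)).trans ?_
  rw [eFact_val_eq_zero_iff, eHW_val_eq_zero_iff]
  set a := v (lab 1) with ha
  have c3 : ((v (lab 3) : ℤ) - v (lab 2) ^ 2) ^ 2 = 0 ↔ v (lab 3) = v (lab 2) ^ 2 := by
    rw [← sq_eq_zero_iff_natCast_eq, Nat.cast_pow]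
  have c4 : ((v (lab 4) : ℤ) - v (lab 2) * v (lab 3)) ^ 2 = 0 ↔
      v (lab 4) = v (lab 2) * v (lab 3) := by
    rw [← sq_eq_zero_iff_natCast_eq, Nat.cast_mul]
  have c5 : ((v (lab 5) : ℤ) - (4 : ℕ) * v (lab 2) - (1 : ℕ)) ^ 2 = 0 ↔
      v (lab 5) = 4 * v (lab 2) + 1 := by
    rw [← sq_eq_zero_iff_natCast_eq]; push_cast; rw [sub_sub]
  rw [c3, c4, c5]
  constructor
  · rintro ⟨⟨h9, h10, h11, h12, hA, h20, h21, h2⟩, h3, h4, h5, hM, ⟨h31, hB, hN, h7⟩, h8⟩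
    have h4' : v (lab 4) = v (lab 2) ^ 3 := by rw [h4, h3]; ring
    rw [eM4_val_eq_zero_iff n v h3 h4' h5] at hM
    obtain ⟨hM, h6⟩ := hM
    rw [h2] at h3 h4' h5 h6 hM
    rw [h6] at h31 hB hN h7
    rw [h7, h2, h5, digitSum_sqrtUnityHypercube] at h8
    obtain ⟨hn, h8⟩ := slack_eq_zero_iff.1 h8
    refine ⟨hn, fun j hj => ?_⟩
    obtain ⟨hj1, hj42⟩ := Finset.mem_Icc.1 hj
    interval_cases j
    exacts [rfl, h2, h3, h4', h5, h6, h7, h8, h9, h10, h11, h12, hA 1 (by decide),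
      hA 2 (by decide), hA 3 (by decide), hA 4 (by decide), hA 5 (by decide), hA 6 (by decide),
      hA 7 (by decide), h20, h21, hM 1 (by decide), hM 2 (by decide), hM 3 (by decide),
      hM 4 (by decide), hM 5 (by decide), hM 6 (by decide), hM 7 (by decide), hM 8 (by decide),
      hM 9 (by decide), h31, hB 1 (by decide), hB 2 (by decide), hB 3 (by decide),
      hB 4 (by decide), hB 5 (by decide), hB 6 (by decide), hB 7 (by decide), hN 1 (by decide),
      hN 2 (by decide), hN 3 (by decide), hN 4 (by decide)]
  · rintro ⟨hn, h⟩
    have h2 : v (lab 2) = a.factorial := h 2 (by decide)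
    have h3 : v (lab 3) = a.factorial ^ 2 := h 3 (by decide)
    have h4 : v (lab 4) = a.factorial ^ 3 := h 4 (by decide)
    have h5 : v (lab 5) = 4 * a.factorial + 1 := h 5 (by decide)
    have h6 : v (lab 6) = sqrtUnityHypercube (4 * a.factorial) := h 6 (by decide)
    have h7 : v (lab 7) = digitSum (sqrtUnityHypercube (4 * a.factorial)) := h 7 (by decide)
    have h8 : v (lab 8) = 2 ^ n - 2 ^ (a.primeCounting + 1) := h 8 (by decide)
    rw [eM4_val_eq_zero_iff n v (by rw [h3, h2]) (by rw [h4, h2]) (by rw [h5, h2]), h2, h3, h4, h5,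
      h6, h7, digitSum_sqrtUnityHypercube]
    refine ⟨⟨h 9 (by decide), h 10 (by decide), h 11 (by decide), h 12 (by decide), fun r hr => ?_,
      h 20 (by decide), h 21 (by decide), rfl⟩, rfl, by ring, rfl, ⟨fun r hr => ?_, rfl⟩,
      ⟨h 31 (by decide), fun r hr => ?_, fun r hr => ?_, rfl⟩, slack_eq_zero_iff.2 ⟨hn, h8⟩⟩
    all_goals
      obtain ⟨hr1, hr2⟩ := Finset.mem_Icc.1 hr
      interval_cases r
    exacts [h 13 (by decide), h 14 (by decide), h 15 (by decide), h 16 (by decide),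
      h 17 (by decide), h 18 (by decide), h 19 (by decide), h 22 (by decide), h 23 (by decide),
      h 24 (by decide), h 25 (by decide), h 26 (by decide), h 27 (by decide), h 28 (by decide),
      h 29 (by decide), h 30 (by decide), h 32 (by decide), h 33 (by decide), h 34 (by decide),
      h 35 (by decide), h 36 (by decide), h 37 (by decide), h 38 (by decide), h 39 (by decide),
      h 40 (by decide), h 41 (by decide), h 42 (by decide)]

end PrimeEquation

/-! ### The size of the unknowns -/

theorem digitSum_le (n : ℕ) : digitSum n ≤ n := Nat.digit_sum_le 2 n

theorem lt_binomExp (a b : ℕ) : a + 1 < binomExp a b := by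
  unfold binomExp; nlinarith

theorem choose_le_two_pow_binomExp (a b : ℕ) : a.choose b ≤ 2 ^ binomExp a b :=
  (Nat.choose_le_two_pow a b).trans
    (Nat.pow_le_pow_right (by norm_num) (by have := lt_binomExp a b; omega))

theorem binomAux_le (a b r : ℕ) : binomAux a b r ≤ 2 ^ binomExp a b := by
  have hD : binomDen a ≤ 2 ^ binomExp a b := by
    have h2 : 2 ^ (2 * ((a + 2) * (a + 2))) ≤ 2 ^ binomExp a b :=
      Nat.pow_le_pow_right (by norm_num) (by unfold binomExp; nlinarith)
    exact (Nat.sub_le _ _).trans ((Nat.sub_le _ _).trans h2)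
  have hx : 2 ^ (2 * (a + 2)) ≤ 2 ^ binomExp a b :=
    Nat.pow_le_pow_right (by norm_num) (by unfold binomExp; nlinarith)
  unfold binomAux
  split
  · exact Nat.lt_two_pow_self.le
  · refine le_trans ?_ Nat.lt_two_pow_self.le
    unfold binomExp; nlinarith
  · exact Nat.div_le_self _ _
  · exact Nat.mod_le _ _
  · omega
  · exact (Nat.div_le_self _ _).trans (Nat.div_le_self _ _)
  · omega
  · exact Nat.zero_le _

theorem binomExp_le {a b L : ℕ} (h : b ≤ a) (ha : a + 1 ≤ 2 ^ L) :
    binomExp a b ≤ 2 ^ (3 * L + 3) := by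
  have e : 2 ^ (3 * L + 3) = 8 * (2 ^ L * (2 ^ L * 2 ^ L)) := by
    rw [pow_add, mul_comm 3 L, pow_mul]; ring
  rw [e]
  unfold binomExp
  generalize 2 ^ L = z at ha
  have h1 : a + 2 ≤ 2 * z := by omega
  have h2 : (a + 1) * (a + 1) + b + 1 ≤ 2 * (z * z) := by nlinarith
  calc 2 * (a + 2) * ((a + 1) * (a + 1) + b + 1) ≤ 2 * (2 * z) * (2 * (z * z)) :=
        Nat.mul_le_mul (Nat.mul_le_mul_left 2 h1) h2
    _ = 8 * (z * (z * z)) := by ring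

theorem PrimeEquation.nuAux_le {X : ℕ} (hX : 0 < X) (r : ℕ) : nuAux X r ≤ 2 * X := by
  have h : 2 ^ padicValNat 2 X ≤ X := Nat.le_of_dvd hX pow_padicValNat_dvd
  unfold nuAux
  split
  · exact (Nat.div_le_self _ _).trans (by omega)
  · have := Nat.mod_le X (2 ^ (padicValNat 2 X + 1)); omega
  · have := pow_succ 2 (padicValNat 2 X); omega
  · exact (Nat.div_le_self _ _).trans (by omega)
  · exact Nat.zero_le _

theorem geomSum_le (r q t : ℕ) (hq : 0 < q) : geomSum r q t ≤ t ^ (r + 1) * q ^ t := by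
  calc geomSum r q t ≤ ∑ _j ∈ Finset.range t, t ^ r * q ^ t :=
        Finset.sum_le_sum fun j hj => Nat.mul_le_mul
          (Nat.pow_le_pow_left (Finset.mem_range.1 hj).le r)
          (Nat.pow_le_pow_right hq (Finset.mem_range.1 hj).le)
    _ = t ^ (r + 1) * q ^ t := by rw [Finset.sum_const, Finset.card_range, smul_eq_mul]; ring

theorem hypercubeAux_le (n r : ℕ) : hypercubeAux n r ≤ 2 ^ (6 * (2 * (n + 5) * (n + 1) ^ 2)) := by
  set L := 2 * (n + 5) * (n + 1) ^ 2 with hL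
  have hpow {x : ℕ} (h : x ≤ 6 * L) : 2 ^ x ≤ 2 ^ (6 * L) := Nat.pow_le_pow_right (by norm_num) h
  have ht : n + 1 ≤ 2 ^ L :=
    calc n + 1 ≤ L := by rw [hL]; nlinarith [Nat.zero_le (n ^ 2)]
      _ ≤ 2 ^ L := Nat.lt_two_pow_self.le
  have hG {r q : ℕ} (hr : r ≤ 4) (hq : 0 < q) (h : q ^ (n + 1) ≤ 2 ^ L) :
      geomSum r q (n + 1) ≤ 2 ^ (6 * L) := by
    refine (geomSum_le r q (n + 1) hq).trans ?_
    calc (n + 1) ^ (r + 1) * q ^ (n + 1) ≤ (2 ^ L) ^ (r + 1) * 2 ^ L :=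
          Nat.mul_le_mul (Nat.pow_le_pow_left ht _) h
      _ = 2 ^ (L * (r + 2)) := by rw [← pow_mul, ← pow_add]; congr 1
      _ ≤ 2 ^ (6 * L) := hpow (by rw [mul_comm]; exact Nat.mul_le_mul_right _ (by omega))
  have h2 : (2 ^ (2 * (n + 5) * (n + 1))) ^ (n + 1) ≤ 2 ^ L := by
    rw [← pow_mul, mul_assoc, ← sq]
  have h1 : (2 ^ (2 * (n + 5))) ^ (n + 1) ≤ 2 ^ L := by
    rw [← pow_mul]
    refine Nat.pow_le_pow_right (by norm_num) ?_
    rw [hL]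
    exact Nat.mul_le_mul_left _ (Nat.le_self_pow two_ne_zero _)
  have e1 : 2 * (n + 5) ≤ 6 * L := by rw [hL]; nlinarith [Nat.zero_le (n ^ 2), Nat.zero_le (n ^ 3)]
  have e2 : 2 * (n + 5) * (n + 1) ≤ 6 * L := by
    rw [hL]; nlinarith [Nat.zero_le (n ^ 2), Nat.zero_le (n ^ 3)]
  unfold hypercubeAux
  split
  · exact (Nat.sub_le _ _).trans (hpow e1)
  · exact (Nat.sub_le _ _).trans (hpow e2)
  · exact hG (by norm_num) (by positivity) h1
  · exact hG (by norm_num) (by positivity) h1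
  · exact hG (by norm_num) (by positivity) h1
  · exact hG (by norm_num) (by positivity) h2
  · exact hG (by norm_num) (by positivity) h2
  · exact hG (by norm_num) (by positivity) h2
  · refine le_trans ?_ (hpow (show L ≤ 6 * L by omega))
    have h := hypercubeConst_mul (n + 5) (n + 1)
    refine le_of_mul_le_mul_right ?_ (show 0 < 2 ^ (n + 5) + 1 by positivity)
    rw [h, ← hL, mul_comm (2 ^ L)]
    exact Nat.mul_le_mul (Nat.le_succ _) (Nat.sub_le _ _)
  · exact Nat.zero_le _

theorem factorial_pow_three_le {n a : ℕ} (ha : a ≤ n ^ 2) : a.factorial ^ 3 ≤ 2 ^ (2 * n ^ 4) := by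
  have h3 : n ^ 3 ≤ 2 ^ n ^ 2 := by
    rcases Nat.lt_or_ge n 3 with h | h
    · interval_cases n <;> norm_num
    · calc n ^ 3 ≤ (2 ^ n) ^ 3 := Nat.pow_le_pow_left Nat.lt_two_pow_self.le 3
        _ = 2 ^ (n * 3) := by rw [← pow_mul]
        _ ≤ 2 ^ n ^ 2 := Nat.pow_le_pow_right (by norm_num) (by nlinarith)
  calc a.factorial ^ 3 ≤ ((n ^ 2).factorial) ^ 3 := Nat.pow_le_pow_left (Nat.factorial_le ha) 3
    _ ≤ ((n ^ 2) ^ (n ^ 2)) ^ 3 := Nat.pow_le_pow_left (Nat.factorial_le_pow _) 3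
    _ = (n ^ 3) ^ (2 * n ^ 2) := by simp only [← pow_mul]; congr 1; ring
    _ ≤ (2 ^ n ^ 2) ^ (2 * n ^ 2) := Nat.pow_le_pow_left h3 _
    _ = 2 ^ (2 * n ^ 4) := by rw [← pow_mul]; congr 1; ring

namespace PrimeEquation

/-- The largest unknowns are below `2 ^ 2 ^ (c L)`, where `sqrtUnityHypercube (4 a !)`
has at most `L = 2 (4 a ! + 5) (4 a ! + 1) ^ 2` binary digits. This `L` is at most `450 (a !) ^ 3`, and
`(a !) ^ 3 ≤ 2 ^ (2 n ^ 4)`. -/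
theorem solution_lt {n a : ℕ} (hn : 1 ≤ n) (ha : a ≤ n ^ 2) (j : ℕ) :
    solution n a j < 2 ^ 2 ^ 2 ^ (2 * n ^ 4 + 16) := by
  obtain ⟨K, hK⟩ : ∃ K, K = 2 ^ (2 * n ^ 4 + 16) := ⟨_, rfl⟩
  rw [← hK]
  have hKK : K < 2 ^ K := Nat.lt_two_pow_self
  have hKe : K = 2 ^ (2 * n ^ 4) * 65536 := by rw [hK, pow_add]; norm_num
  have hn4 : 2 * n ^ 4 < 2 ^ (2 * n ^ 4) := Nat.lt_two_pow_self
  have hnn : n ≤ n ^ 4 := Nat.le_self_pow (by norm_num) n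
  have haa : a ^ 2 ≤ n ^ 4 := by
    calc a ^ 2 ≤ (n ^ 2) ^ 2 := Nat.pow_le_pow_left ha 2
      _ = n ^ 4 := by ring
  have hpow {x : ℕ} (h : x < 2 ^ K) : 2 ^ x < 2 ^ 2 ^ K := Nat.pow_lt_pow_right (by norm_num) h
  have hf0 := a.factorial_pos
  have hf3 : a.factorial ^ 3 ≤ 2 ^ (2 * n ^ 4) := factorial_pow_three_le ha
  have hKT : K < 2 ^ 2 ^ K := hKK.trans Nat.lt_two_pow_self
  obtain ⟨f, hf⟩ : ∃ f, f = a.factorial := ⟨_, rfl⟩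
  have hf1 : f ≤ f ^ 3 := Nat.le_self_pow (by norm_num) f
  have hf2 : f ^ 2 ≤ f ^ 3 := Nat.pow_le_pow_right (by omega) (by norm_num)
  set L := 2 * (4 * a.factorial + 5) * (4 * a.factorial + 1) ^ 2 with hL
  rw [← hf] at hf0 hf3 hL
  have hLle : L ≤ 450 * f ^ 3 := by
    calc L ≤ 2 * (9 * f) * (5 * f) ^ 2 := by
          rw [hL]
          exact Nat.mul_le_mul (by omega) (Nat.pow_le_pow_left (by omega) 2)
      _ = 450 * f ^ 3 := by ring
  have hLK : 6 * L + 6 < K := by omega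
  have hML : sqrtUnityHypercube (4 * a.factorial) < 2 ^ L := sqrtUnityHypercube_lt _
  obtain ⟨M, hM⟩ : ∃ M, M = sqrtUnityHypercube (4 * a.factorial) := ⟨_, rfl⟩
  have hLT : 2 ^ L < 2 ^ 2 ^ K := hpow (by omega)
  have hHyp (r : ℕ) : hypercubeAux (4 * a.factorial) r < 2 ^ 2 ^ K :=
    (hypercubeAux_le _ r).trans_lt (hpow (by omega))
  have hEM : 2 ^ binomExp (2 * M) M < 2 ^ 2 ^ K := by
    refine hpow ((binomExp_le (L := L + 1) (by omega) ?_).trans_lt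
      (Nat.pow_lt_pow_right (by norm_num) (by omega)))
    rw [pow_succ]; omega
  have haA : a ≤ 2 ^ (3 * a ^ 2) :=
    calc a ≤ 3 * a ^ 2 := by nlinarith [Nat.le_self_pow two_ne_zero a]
      _ ≤ _ := Nat.lt_two_pow_self.le
  have hEA : 2 ^ binomExp (2 ^ (3 * a ^ 2)) a < 2 ^ 2 ^ K := by
    refine hpow ((binomExp_le (L := 3 * a ^ 2 + 1) haA ?_).trans_lt
      (Nat.pow_lt_pow_right (by norm_num) (by omega)))
    have := Nat.one_le_two_pow (n := 3 * a ^ 2)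
    rw [pow_succ 2]; omega
  have hA (r : ℕ) : binomAux (2 ^ (3 * a ^ 2)) a r < 2 ^ 2 ^ K := (binomAux_le _ _ r).trans_lt hEA
  have hB (r : ℕ) : binomAux (2 * M) M r < 2 ^ 2 ^ K := (binomAux_le _ _ r).trans_lt hEM
  have hAC : (2 ^ (3 * a ^ 2)).choose a < 2 ^ 2 ^ K :=
    (choose_le_two_pow_binomExp _ _).trans_lt hEA
  have hAC0 : 0 < (2 ^ (3 * a ^ 2)).choose a := Nat.choose_pos haA
  have hC2 : 2 * (2 * M).choose M < 2 ^ 2 ^ K := by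
    refine lt_of_le_of_lt ?_ hEM
    calc 2 * (2 * M).choose M ≤ 2 * 2 ^ (2 * M) :=
          Nat.mul_le_mul_left 2 (Nat.choose_le_two_pow _ _)
      _ = 2 ^ (2 * M + 1) := by ring
      _ ≤ _ := Nat.pow_le_pow_right (by norm_num) (lt_binomExp _ _).le
  have hC0 : 0 < (2 * M).choose M := Nat.choose_pos (by omega)
  have hN (r : ℕ) : nuAux ((2 * M).choose M) r < 2 ^ 2 ^ K := (nuAux_le hC0 r).trans_lt hC2
  have ha3 : a ^ 3 < 2 ^ 2 ^ K := by
    calc a ^ 3 ≤ (2 ^ a) ^ 3 := Nat.pow_le_pow_left Nat.lt_two_pow_self.le 3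
      _ = 2 ^ (a * 3) := by rw [← pow_mul]
      _ < 2 ^ 2 ^ K := hpow (by have := Nat.le_self_pow two_ne_zero a; omega)
  have ha2 : a ^ 2 < 2 ^ 2 ^ K := by omega
  have ha1 : a < 2 ^ 2 ^ K := by have := Nat.le_self_pow two_ne_zero a; omega
  have hdig : digitSum M < 2 ^ 2 ^ K := by have := digitSum_le M; omega
  have h2n : 2 ^ n < 2 ^ 2 ^ K := hpow (by omega)
  have hAA : 2 ^ (3 * a ^ 2) < 2 ^ 2 ^ K := hpow (by omega)
  unfold solution
  rw [← hM, ← hf]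
  rw [← hf] at hHyp
  split
  exacts [ha1, by omega, by omega, by omega, by omega, by omega, hdig,
    (Nat.sub_le _ _).trans_lt h2n, ha2, hAA, ha3, hAC, hA 1, hA 2, hA 3, hA 4, hA 5, hA 6, hA 7,
    (Nat.mod_lt _ hAC0).trans hAC, ((Nat.sub_le _ _).trans (Nat.sub_le _ _)).trans_lt hAC,
    hHyp 1, hHyp 2, hHyp 3, hHyp 4, hHyp 5, hHyp 6, hHyp 7, hHyp 8, hHyp 9, by omega,
    hB 1, hB 2, hB 3, hB 4, hB 5, hB 6, hB 7, hN 1, hN 2, hN 3, hN 4, by omega]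

end PrimeEquation

/-! ### The size of the polynomial on the cube -/

namespace PrimeEquation

open ExpPoly

/-- The sum of the absolute values of the monomials of `P` is less than `2 ^ (e t)` on the cube of
side `t`, for all parameters `n < t`. The summand `1` makes the bounds for sums and products both
additive in `e`. -/
def LogBound (t : ℕ) (P : ExpPoly 42) (e : ℕ) : Prop :=
  ∀ (n : ℕ) (v : Fin 42 → ℕ), n < t → (∀ i, v i < t) → 1 + P.absVal n v ≤ 2 ^ (e * t)

namespace LogBound

variable {t : ℕ} {P Q : ExpPoly 42} {d e : ℕ}

theorem mono (h : LogBound t P d) (hde : d ≤ e) : LogBound t P e := fun n v hn hv =>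
  (h n v hn hv).trans (Nat.pow_le_pow_right (by norm_num) (Nat.mul_le_mul_right t hde))

theorem add (hP : LogBound t P d) (hQ : LogBound t Q e) : LogBound t (P + Q) (d + e) := by
  intro n v hn hv
  have h := Nat.mul_le_mul (hP n v hn hv) (hQ n v hn hv)
  rw [absVal_add, add_mul, pow_add]
  nlinarith

theorem sub (hP : LogBound t P d) (hQ : LogBound t Q e) : LogBound t (P - Q) (d + e) := by
  intro n v hn hv
  rw [absVal_sub, ← absVal_add]
  exact hP.add hQ n v hn hv

theorem neg (hP : LogBound t P d) : LogBound t (-P) d := by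
  intro n v hn hv
  rw [absVal_neg]
  exact hP n v hn hv

theorem mul (hP : LogBound t P d) (hQ : LogBound t Q e) : LogBound t (P * Q) (d + e) := by
  intro n v hn hv
  have h := Nat.mul_le_mul (hP n v hn hv) (hQ n v hn hv)
  rw [absVal_mul, add_mul, pow_add]
  nlinarith

theorem of_const (c : ℤ) : LogBound t (const c) c.natAbs := by
  intro n v hn hv
  rw [absVal_const, add_comm]
  exact (Nat.succ_le_of_lt Nat.lt_two_pow_self).trans
    (Nat.pow_le_pow_right (by norm_num) (Nat.le_mul_of_pos_right _ (by omega)))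

theorem of_ofNat (c : ℕ) : LogBound t (no_index (OfNat.ofNat c)) c := of_const (c : ℤ)

theorem pow (hP : LogBound t P d) (j : ℕ) : LogBound t (P ^ j) (j * d + 1) := by
  induction j with
  | zero => exact (of_const 1).mono (by simp)
  | succ j ih => exact (ih.mul hP).mono (by rw [add_mul]; omega)

theorem of_x (j : ℕ) : LogBound t (x j) 1 := by
  intro n v hn hv
  have h := hv (lab j)
  rw [x, absVal_X, one_mul]
  exact (show 1 + v (lab j) ≤ t by omega).trans Nat.lt_two_pow_self.le

theorem of_twoPowParam : LogBound t twoPowParam 2 := by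
  intro n v hn _
  rw [absVal_twoPowParam]
  calc 1 + 2 ^ n ≤ 2 ^ n + 2 ^ n := Nat.add_le_add_right Nat.one_le_two_pow _
    _ = 2 ^ (n + 1) := by ring
    _ ≤ 2 ^ (2 * t) := Nat.pow_le_pow_right (by norm_num) (by omega)

theorem of_tp (c : ℕ) (l : List (ℕ × ℕ)) : LogBound t (tp c l) (c + 1 + (l.map Prod.fst).sum) := by
  intro n v hn hv
  rw [tp, absVal_twoPow, List.map_map]
  have h : (l.map ((fun s : ℕ × Fin 42 => s.1 * v s.2) ∘ fun s => (s.1, lab s.2))).sum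
      ≤ (l.map Prod.fst).sum * t := by
    induction l with
    | nil => simp
    | cons s l ih =>
      simp only [List.map_cons, List.sum_cons, add_mul, Function.comp_apply]
      exact Nat.add_le_add (Nat.mul_le_mul_left _ (hv _).le) ih
  generalize ((l.map ((fun s : ℕ × Fin 42 => s.1 * v s.2) ∘ fun s => (s.1, lab s.2))).sum) = m at h
  calc 1 + 2 ^ (c + m) ≤ 2 ^ (c + m) + 2 ^ (c + m) := Nat.add_le_add_right Nat.one_le_two_pow _
    _ = 2 ^ (c + 1 + m) := by ring
    _ ≤ _ := Nat.pow_le_pow_right (by norm_num) (by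
        rw [add_mul]
        exact Nat.add_le_add (Nat.le_mul_of_pos_right _ (by omega)) h)

theorem of_collect (hP : LogBound t P d) (hde : d ≤ e) : LogBound t (collect P) e :=
  fun n v hn hv =>
    (Nat.add_le_add_left (absVal_collect_le n v P) 1).trans (hP.mono hde n v hn hv)

end LogBound

/-- The exponent is computed along the structure of the polynomial before the collection of like
monomials; its exact value is irrelevant. -/
theorem poly_logBound (t : ℕ) : LogBound t poly 20000 := by
  rw [poly]
  apply LogBound.of_collect
  · simp only [eFact, eHW, eNu, eBinom, eM4, eDiv, eMod, eDvd, eNotDvd]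
    repeat' with_reducible first
      | exact LogBound.of_x _ | exact LogBound.of_tp _ _ | exact LogBound.of_const _
      | exact LogBound.of_twoPowParam | exact LogBound.of_ofNat _
      | apply LogBound.add | apply LogBound.sub | apply LogBound.mul
      | apply LogBound.pow | apply LogBound.neg
  -- The exponent that the rules have built is a closed expression, compared by evaluation.
  · exact Nat.le_of_ble_eq_true rfl

end PrimeEquation

/-! ### The term for the `n`-th prime -/

namespace ArithTerm

variable {k : ℕ} (e : Fin k → ℕ) (n : ArithTerm k)

open PrimeEquation

theorem eval_primeT : (primeT n).eval e = 2 ^ 2 ^ 2 ^ (2 * n.eval e ^ 4 + 16) := rfl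

theorem eval_primeU : (primeU n).eval e = 2 ^ (2 ^ (9 * (primeT n).eval e + 8) + 9) := rfl

/-- The zeros of the polynomial in a cube that is large enough correspond to the `a` with
`π(a) + 1 ≤ n`, which are the numbers below the `n`-th prime; these satisfy `a ≤ n ^ 2`. -/
theorem card_zeros_poly {n : ℕ} (hn : 1 ≤ n) {t : ℕ} (ht : ∀ a ≤ n ^ 2, ∀ j, solution n a j < t) :
    (Finset.univ.filter fun v : Fin 42 → Fin t => poly.val n (fun i => v i) = 0).card =
      Nat.nth Nat.Prime (n - 1) := by
  have hlt (a : ℕ) : a < Nat.nth Nat.Prime (n - 1) ↔ a.primeCounting + 1 ≤ n := by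
    rw [← Nat.succ_le_iff, ← Nat.count_le_iff_le_nth Nat.infinite_setOfPred_prime]
    change a.primeCounting ≤ n - 1 ↔ _
    omega
  refine (Finset.card_bij (t := Finset.range (Nat.nth Nat.Prime (n - 1)))
    (fun v _ => (v (lab 1) : ℕ)) ?_ ?_ ?_).trans (Finset.card_range _)
  · intro v hv
    have h := (poly_val_eq_zero_iff n _).1 (Finset.mem_filter.1 hv).2
    exact Finset.mem_range.2 ((hlt _).2 h.1)
  · intro v hv w hw h1
    have hv := ((poly_val_eq_zero_iff n _).1 (Finset.mem_filter.1 hv).2).2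
    have hw := ((poly_val_eq_zero_iff n _).1 (Finset.mem_filter.1 hw).2).2
    funext i
    have hi : lab (i + 1) = i := Fin.ext (Nat.mod_eq_of_lt i.2)
    have hmem : (i : ℕ) + 1 ∈ Finset.Icc 1 42 := Finset.mem_Icc.2 ⟨by omega, by omega⟩
    have hvi := hv _ hmem
    have hwi := hw _ hmem
    rw [hi] at hvi hwi
    rw [h1] at hvi
    exact Fin.ext (hvi.trans hwi.symm)
  · intro a ha
    have ha := Finset.mem_range.1 ha
    have hsq : a ≤ n ^ 2 := by have := nth_prime_le n hn; omega
    have hj (j : ℕ) (hj : j ∈ Finset.Icc 1 42) : ((lab j : Fin 42) : ℕ) + 1 = j := by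
      obtain ⟨h1, h2⟩ := Finset.mem_Icc.1 hj
      have : ((lab j : Fin 42) : ℕ) = j - 1 := Nat.mod_eq_of_lt (by omega)
      omega
    refine ⟨fun i => ⟨solution n a (i + 1), ht a hsq _⟩, ?_, rfl⟩
    refine Finset.mem_filter.2 ⟨Finset.mem_univ _, (poly_val_eq_zero_iff n _).2
      ⟨(hlt a).1 ha, fun j hj' => ?_⟩⟩
    change solution n a ((lab j : Fin 42) + 1) = solution n a j
    rw [hj j hj']

/-- Here `u` is large enough for the bound `2 ^ (20000 t)` on the polynomial. -/
theorem eval_nthPrime (hn : 1 ≤ n.eval e) :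
    (nthPrime n).eval e = Nat.nth Nat.Prime (n.eval e - 1) := by
  have ht : n.eval e < (primeT n).eval e := by
    rw [eval_primeT]
    refine lt_trans ?_ (Nat.lt_two_pow_self.trans (Nat.lt_two_pow_self.trans Nat.lt_two_pow_self))
    have := Nat.le_self_pow (show 4 ≠ 0 by norm_num) (n.eval e)
    omega
  have hu : 20000 * (primeT n).eval e ≤ (primeU n).eval e := by
    rw [eval_primeU]
    generalize (primeT n).eval e = t
    calc 20000 * t ≤ 2 ^ 15 * 2 ^ t := Nat.mul_le_mul (by norm_num) Nat.lt_two_pow_self.le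
      _ = 2 ^ (15 + t) := by rw [pow_add]
      _ ≤ 2 ^ (2 ^ (9 * t + 8) + 9) := Nat.pow_le_pow_right (by norm_num) (by
          have := Nat.lt_two_pow_self (n := 9 * t + 8); omega)
  have habs (v : Fin 42 → ℕ) (hv : ∀ i, v i < (primeT n).eval e) :
      poly.absVal (n.eval e) v ≤ 2 ^ (primeU n).eval e :=
    le_trans (by have := poly_logBound _ (n.eval e) v ht hv; omega)
      (Nat.pow_le_pow_right (by norm_num) hu)
  rw [nthPrime, eval_countZeros e n (primeT n) (primeU n) poly (by omega) (by omega)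
    ((habs 0 fun i => by change 0 < _; omega).trans (Nat.le_succ _))
    (fun v => poly_val_nonneg _ _) (fun v => ?_)]
  · refine card_zeros_poly hn fun a ha j => ?_
    rw [eval_primeT]
    exact solution_lt hn ha j
  · refine (le_abs_self _).trans ((ExpPoly.abs_val_le _ _ _).trans ?_)
    exact_mod_cast habs (fun i => v i) fun i => (v i).2

theorem eval_nextPrime (x : ℕ) :
    nextPrime.eval ![x] = Nat.nth Nat.Prime x.primeCounting := by
  have h : (primePi (var 0) + 1 : ArithTerm 1).eval ![x] = x.primeCounting + 1 := by
    rw [eval_add, eval_primePi]; rfl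
  rw [nextPrime, eval_nthPrime _ _ (by rw [h]; omega), h, Nat.add_sub_cancel]

end ArithTerm

theorem mainTheorem9 :
    (∀ x : ℕ, IsLeast {q : ℕ | q.Prime ∧ x < q} (ArithTerm.nextPrime.eval ![x])) ∧
    (∀ s : ℕ → ℕ, s 1 = 2 → (∀ n : ℕ, 1 ≤ n → s (n + 1) = ArithTerm.nextPrime.eval ![s n]) →
      ∀ n : ℕ, 1 ≤ n →
        s n = Nat.nth Nat.Prime (n - 1) ∧
        s n = (ArithTerm.nthPrime (ArithTerm.var 0) : ArithTerm 1).eval ![n]) := by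
  refine ⟨fun x => ?_, fun s h1 hs n hn => ?_⟩
  · rw [ArithTerm.eval_nextPrime]
    refine ⟨⟨Nat.prime_nth_prime _, ?_⟩, fun q hq => ?_⟩
    · exact (Nat.count_le_iff_le_nth Nat.infinite_setOfPred_prime).1 (le_refl x.primeCounting)
    · rw [← Nat.nth_count hq.1]
      exact Nat.nth_monotone Nat.infinite_setOfPred_prime (Nat.count_monotone _ (Nat.succ_le_of_lt hq.2))
  · have key : s n = Nat.nth Nat.Prime (n - 1) := by
      induction n, hn using Nat.le_induction with
      | base => rw [h1, Nat.sub_self, Nat.nth_prime_zero_eq_two]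
      | succ n hn ih =>
        rw [hs n hn, ArithTerm.eval_nextPrime, ih, Nat.add_sub_cancel]
        congr 1
        change Nat.count Nat.Prime (Nat.nth Nat.Prime (n - 1) + 1) = n
        rw [Nat.count_nth_succ_of_infinite Nat.infinite_setOfPred_prime, Nat.sub_add_cancel hn]
    refine ⟨key, ?_⟩
    rw [ArithTerm.eval_nthPrime ![n] (ArithTerm.var 0) (by change 1 ≤ n; exact hn)]
    exact key
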